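/- **Conventions.** Let $p$ be a prime, $R$ a perfect field of characteristic $p$, $R'=W_2(R)$ the ring of $p$-typical Witt vectors of length two, and $q:R'\to R$ the projection, so that $p\operatorname{Ker}q=0$. Complexes are homologically indexed by $\mathbb Z$, with differential of degree $-1$. For a commutative ring $S$, $C_\bullet(S)$ is the category of complexes of $S$-modules and $C^{pf}_\bullet(S)\subset C_\bullet(S)$ the full subcategory of bounded complexes of finitely generated projective $S$-modules. Let $q^*:C^{pf}_\bullet(R')\to C^{pf}_\bullet(R)$ be the functor $V\mapsto V/p=R\otimes_{R'}V$; complexes of $R$-modules are also regarded as complexes of $R'$-modules via $q$. *Filtered truncations.* For a complex $E$ with a decreasing filtration $F^\bullet$ by subcomplexes put $$(\tau^F_{\ge n}E)_i=d^{-1}(F^{n+1-i}E_{i-1})\cap F^{n-i}E_i,\qquad (\tau^F_{\le n}E)_i=E_i/\bigl(F^{n+1-i}E_i+d(F^{n-i}E_{i+1})\bigr),$$ with the induced filtrations, and $\tau^F_{[0,1]}=\tau^F_{\ge0}\tau^F_{\le1}$. *Multiplicative resolution data.* Let $G=\mathbb Z/p\mathbb Z$. Fix $\nu=\langle P_\bullet,I^\bullet\rangle$,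 where $P_\bullet\to\mathbb Z$ is a resolution of the trivial $\mathbb Z[G]$-module $\mathbb Z$ by projective $\mathbb Z[G]$-modules, $\mathbb Z\to I^\bullet$ is a right resolution of $\mathbb Z$ by $\mathbb Z[G]$-modules that are $\mathbb Z$-free and injective relative to $\mathbb Z$ (equivalently, projective over $\mathbb Z[G]$), and both $I^\bullet$ and $\overline P_\bullet=\operatorname{Cone}(P_\bullet\to\mathbb Z)$ (so $\overline P_0=\mathbb Z$ and $\overline P_i=P_{i-1}$ for $i\ge1$) are equipped with structures of unital associative $G$-equivariant DG algebras over $\mathbb Z$. The term $I^n$ has homological degree $-n$. *The complex $C(V)$.* For $V\in C_\bullet(S)$ let $G$ act on $V^{\otimes_S p}$ by cyclic permutations with the Koszul signs, and let $F^iV^{\otimes p}$ be the part of $V^{\otimes p}$ of degrees $\le -ip$. Put $$\check C(V)=\bigl(V^{\otimes_Sp}\otimes_{\mathbb Z}\overline P_\bullet\otimes_{\mathbb Z}I^\bullet\bigr)^{G}$$ (direct-sum total complex), with the filtration induced by $F^\bullet V^{\otimes p}$, and $C(V)=\tau^F_{[0,1]}\check C(V)$, with its induced filtration. For $V\in C^{pf}_\bullet(R')$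 the quotient map $V\to V/p$ induces $q:C(V)\to C(V/p)$, and the map $(V/p)^{\otimes p}=V^{\otimes p}/p\xrightarrow{\ p\ }V^{\otimes p}$ induces $p:C(V/p)\to C(V)$, where $q\circ p=0$. For $W\in C^{pf}_\bullet(R)$ let $\overline C^r(W)=\operatorname{Ker}\bigl(C(W)\to\tau^F_{\le0}C(W)\bigr)$ and $\overline C^l(W)=C(W)/\tau^F_{\ge1}C(W)$. Define functors $C^l,C^r:C^{pf}_\bullet(R')\to C_\bullet(R')$ by $$C^l(V)=C(V)/p\bigl(\overline C^r(V/p)\bigr),\qquad C^r(V)=\operatorname{Ker}\bigl(C(V)\xrightarrow{\ q\ }C(V/p)\to\overline C^l(V/p)\bigr).$$ The maps $q$ and $p$ induce natural structure maps $l_V:C^l(V)\to C(V/p)$ and $r_V:C(V/p)\to C^r(V)$ (these make $C^l$ and $C^r$ the left and the right DG splitting of the DG elementary extension $C$). **Proposition.** The functors $C^l$ and $C^r$, with their structure maps, depend only on $V/p$; that is, they factor through $q^*:C^{pf}_\bullet(R')\to C^{pf}_\bullet(R)$. Precisely, for any multiplicative resolution data $\nu$ as above: 1. there are a functor $\mathcal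 C^l:C^{pf}_\bullet(R)\to C_\bullet(R')$, an isomorphism of functors $e:\mathcal C^l\circ q^*\cong C^l$, and a natural transformation $l:\mathcal C^l\to C$ of functors on $C^{pf}_\bullet(R)$, such that $l_V\circ e_V=l_{V/p}$ for all $V\in C^{pf}_\bullet(R')$ (here $l_{V/p}$ is the component of the natural transformation $l$ at $q^*V$); 2. there are a functor $\mathcal C^r:C^{pf}_\bullet(R)\to C_\bullet(R')$, an isomorphism of functors $e:\mathcal C^r\circ q^*\cong C^r$, and a natural transformation $r:C\to\mathcal C^r$ of functors on $C^{pf}_\bullet(R)$, such that $e_V\circ r_{V/p}=r_V$ for all $V\in C^{pf}_\bullet(R')$ (here $r_{V/p}$ is the component of the natural transformation $r$ at $q^*V$). -/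

import Mathlib

open CategoryTheory TensorProduct

universe u

noncomputable section

namespace CyclicPowers

/-! ### Filtered complexes and filtered truncations -/

/-- Chain complexes of `S`-modules, indexed by all integers, with differential `K_{n+1} → K_n`. -/
abbrev Ch (S : Type u) [CommRing S] := ChainComplex (ModuleCat.{u} S) ℤ

/-- The subcomplex of `K` with terms `A n`. -/
def subCh {S : Type u} [CommRing S] (K : Ch S) (A : ∀ n : ℤ, Submodule S (K.X n))
    (hA : ∀ n m, A n ≤ (A m).comap (K.d n m).hom) : Ch S where
  X n := ModuleCat.of S (A n)
  d n m := ModuleCat.ofHom ((K.d n m).hom.restrict (hA n m))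
  shape n m h := by
    ext x
    have : K.d n m = 0 := K.shape n m h
    simp [LinearMap.restrict_apply, this]
  d_comp_d' i j k _ _ := by
    apply ModuleCat.hom_ext
    refine LinearMap.ext fun x => Subtype.ext ?_
    exact congrArg (fun f => f.hom x.1) (K.d_comp_d i j k)

/-- The quotient complex of `K` by the subcomplex with terms `A n`. -/
def quotCh {S : Type u} [CommRing S] (K : Ch S) (A : ∀ n : ℤ, Submodule S (K.X n))
    (hA : ∀ n m, A n ≤ (A m).comap (K.d n m).hom) : Ch S where
  X n := ModuleCat.of S (K.X n ⧸ A n)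
  d n m := ModuleCat.ofHom ((A n).mapQ (A m) (K.d n m).hom (hA n m))
  shape n m h := by
    have : K.d n m = 0 := K.shape n m h
    apply ModuleCat.hom_ext
    apply Submodule.linearMap_qext
    ext x
    simp [this]
  d_comp_d' i j k _ _ := by
    apply ModuleCat.hom_ext
    apply Submodule.linearMap_qext
    ext x
    have := congrArg (fun f => f.hom (x : K.X i)) (K.d_comp_d i j k)
    simp only [ModuleCat.hom_comp, LinearMap.comp_apply] at this
    simp [this]

/-- The map of subcomplexes induced by a map of complexes. -/
def subChMap {S : Type u} [CommRing S] {K L : Ch S} {A : ∀ n : ℤ, Submodule S (K.X n)}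
    {hA : ∀ n m, A n ≤ (A m).comap (K.d n m).hom} {B : ∀ n : ℤ, Submodule S (L.X n)}
    {hB : ∀ n m, B n ≤ (B m).comap (L.d n m).hom} (f : K ⟶ L)
    (hf : ∀ n, A n ≤ (B n).comap (f.f n).hom) : subCh K A hA ⟶ subCh L B hB where
  f n := ModuleCat.ofHom ((f.f n).hom.restrict (hf n))
  comm' n m _ := by
    apply ModuleCat.hom_ext
    refine LinearMap.ext fun x => Subtype.ext ?_
    exact congrArg (fun g => g.hom x.1) (f.comm n m)

/-- The map of quotient complexes induced by a map of complexes. -/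
def quotChMap {S : Type u} [CommRing S] {K L : Ch S} {A : ∀ n : ℤ, Submodule S (K.X n)}
    {hA : ∀ n m, A n ≤ (A m).comap (K.d n m).hom} {B : ∀ n : ℤ, Submodule S (L.X n)}
    {hB : ∀ n m, B n ≤ (B m).comap (L.d n m).hom} (f : K ⟶ L)
    (hf : ∀ n, A n ≤ (B n).comap (f.f n).hom) : quotCh K A hA ⟶ quotCh L B hB where
  f n := ModuleCat.ofHom ((A n).mapQ (B n) (f.f n).hom (hf n))
  comm' n m _ := by
    apply ModuleCat.hom_ext
    apply Submodule.linearMap_qext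
    ext x
    exact congrArg (fun g => (B m).mkQ (g.hom (x : K.X n))) (f.comm n m)

/-- A complex of `S`-modules with a decreasing filtration by subcomplexes `F^i`, `i ∈ ℤ`. -/
structure FiltCh (S : Type u) [CommRing S] where
  /-- the underlying complex -/
  K : Ch S
  /-- `F i n` is the degree `n` term of `F^i` -/
  F : ℤ → ∀ n : ℤ, Submodule S (K.X n)
  anti : ∀ i j n, i ≤ j → F j n ≤ F i n
  d_mem : ∀ i n m, F i n ≤ (F i m).comap (K.d n m).hom

namespace FiltCh

/-- Morphisms of filtered complexes. -/
@[ext]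
structure Hom {S : Type u} [CommRing S] (E E' : FiltCh S) where
  f : E.K ⟶ E'.K
  mem : ∀ i n, E.F i n ≤ (E'.F i n).comap (f.f n).hom

instance (S : Type u) [CommRing S] : Category (FiltCh S) where
  Hom := Hom
  id E := ⟨𝟙 _, fun i n x hx => by simpa using hx⟩
  comp f g := ⟨f.f ≫ g.f, fun i n x hx => by
    simpa using g.mem i n (f.mem i n hx)⟩

@[ext]
lemma hom_ext {S : Type u} [CommRing S] {E E' : FiltCh S} {f g : E ⟶ E'} (h : f.f = g.f) :
    f = g := Hom.ext h

@[simp] lemma id_f {S : Type u} [CommRing S] (E : FiltCh S) : Hom.f (𝟙 E) = 𝟙 E.K := rfl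

@[simp] lemma comp_f {S : Type u} [CommRing S] {E E' E'' : FiltCh S} (f : E ⟶ E') (g : E' ⟶ E'') :
    Hom.f (f ≫ g) = f.f ≫ g.f := rfl

/-- Forgetting the filtration. -/
@[simps]
def forget (S : Type u) [CommRing S] : FiltCh S ⥤ Ch S where
  obj E := E.K
  map f := f.f

/-- `τ^F_{≥ n} E_i = d⁻¹(F^{n+1-i} E_{i-1}) ∩ F^{n-i} E_i`, as a submodule of `E_i`. -/
def geSub {S : Type u} [CommRing S] (E : FiltCh S) (n i : ℤ) : Submodule S (E.K.X i) :=
  (E.F (n + 1 - i) (i - 1)).comap (E.K.d i (i - 1)).hom ⊓ E.F (n - i) i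

/-- `F^{n+1-i} E_i + d(F^{n-i} E_{i+1})`, the kernel of the projection `E_i → τ^F_{≤ n} E_i`. -/
def leSub {S : Type u} [CommRing S] (E : FiltCh S) (n i : ℤ) : Submodule S (E.K.X i) :=
  E.F (n + 1 - i) i ⊔ (E.F (n - i) (i + 1)).map (E.K.d (i + 1) i).hom

lemma geSub_d {S : Type u} [CommRing S] (E : FiltCh S) (n i j : ℤ) :
    E.geSub n i ≤ (E.geSub n j).comap (E.K.d i j).hom := by
  intro x hx
  by_cases h : j + 1 = i
  · obtain rfl : j = i - 1 := by omega
    refine ⟨?_, ?_⟩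
    · have := congrArg (fun f => f.hom x) (E.K.d_comp_d i (i - 1) (i - 1 - 1))
      change (E.K.d (i - 1) (i - 1 - 1)).hom ((E.K.d i (i - 1)).hom x) ∈
        E.F (n + 1 - (i - 1)) (i - 1 - 1)
      replace this : (E.K.d (i - 1) (i - 1 - 1)).hom ((E.K.d i (i - 1)).hom x) = 0 := this
      rw [this]
      exact zero_mem _
    · have := hx.1
      rw [show n + 1 - i = n - (i - 1) by ring] at this
      exact this
  · have : E.K.d i j = 0 := E.K.shape i j h
    simp [this]

lemma leSub_d {S : Type u} [CommRing S] (E : FiltCh S) (n i j : ℤ) :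
    E.leSub n i ≤ (E.leSub n j).comap (E.K.d i j).hom := by
  by_cases h : j + 1 = i
  · subst h
    refine sup_le ?_ ?_
    · intro x hx
      refine Submodule.mem_sup_right ⟨x, ?_, rfl⟩
      rw [show n + 1 - (j + 1) = n - j by ring] at hx
      exact hx
    · rintro _ ⟨x, hx, rfl⟩
      have : (E.K.d (j + 1) j).hom ((E.K.d (j + 1 + 1) (j + 1)).hom x) = 0 :=
        congrArg (fun f => f.hom x) (E.K.d_comp_d (j + 1 + 1) (j + 1) j)
      rw [Submodule.mem_comap, this]
      exact zero_mem _
  · have : E.K.d i j = 0 := E.K.shape i j h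
    intro x _
    simp [this]

lemma geSub_map {S : Type u} [CommRing S] {E E' : FiltCh S} (f : E ⟶ E') (n i : ℤ) :
    E.geSub n i ≤ (E'.geSub n i).comap (f.f.f i).hom := by
  intro x hx
  refine ⟨?_, f.mem _ _ hx.2⟩
  have := congrArg (fun g => g.hom x) (f.f.comm i (i - 1))
  simp only [ModuleCat.hom_comp, LinearMap.comp_apply] at this
  rw [SetLike.mem_coe, Submodule.mem_comap, this]
  exact f.mem _ _ hx.1

lemma leSub_map {S : Type u} [CommRing S] {E E' : FiltCh S} (f : E ⟶ E') (n i : ℤ) :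
    E.leSub n i ≤ (E'.leSub n i).comap (f.f.f i).hom := by
  refine sup_le (fun x hx => Submodule.mem_sup_left (f.mem _ _ hx)) ?_
  rintro _ ⟨x, hx, rfl⟩
  refine Submodule.mem_sup_right ⟨_, f.mem _ _ hx, ?_⟩
  have := congrArg (fun g => g.hom x) (f.f.comm (i + 1) i)
  simpa only [ModuleCat.hom_comp, LinearMap.comp_apply] using this

/-- The filtered truncation functor `τ^F_{≥ n}`. -/
def ge (S : Type u) [CommRing S] (n : ℤ) : FiltCh S ⥤ FiltCh S where
  obj E :=
    { K := subCh E.K (E.geSub n) (E.geSub_d n)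
      F := fun i m => (E.F i m).comap (E.geSub n m).subtype
      anti := fun i j m h x hx => E.anti i j m h hx
      d_mem := fun i n m x hx => E.d_mem i n m hx }
  map f := ⟨subChMap f.f (geSub_map f n), fun i m x hx => f.mem i m hx⟩

/-- The filtered truncation functor `τ^F_{≤ n}`. -/
def le (S : Type u) [CommRing S] (n : ℤ) : FiltCh S ⥤ FiltCh S where
  obj E :=
    { K := quotCh E.K (E.leSub n) (E.leSub_d n)
      F := fun i m => (E.F i m).map (E.leSub n m).mkQ
      anti := fun i j m h => Submodule.map_mono (E.anti i j m h)
      d_mem := by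
        rintro i n m _ ⟨x, hx, rfl⟩
        exact ⟨_, E.d_mem i n m hx, rfl⟩ }
  map f := ⟨quotChMap f.f (leSub_map f n), by
    rintro i m _ ⟨x, hx, rfl⟩
    exact ⟨_, f.mem i m hx, rfl⟩⟩
  map_id E := by
    apply hom_ext
    apply HomologicalComplex.hom_ext
    intro m
    apply ModuleCat.hom_ext
    apply Submodule.linearMap_qext
    rfl
  map_comp f g := by
    apply hom_ext
    apply HomologicalComplex.hom_ext
    intro m
    apply ModuleCat.hom_ext
    apply Submodule.linearMap_qext
    rfl

/-- `τ^F_{[0,1]} = τ^F_{≥ 0} τ^F_{≤ 1}`. -/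
def trunc01 (S : Type u) [CommRing S] : FiltCh S ⥤ FiltCh S := le S 1 ⋙ ge S 0

end FiltCh

/-! ### The `p`-th tensor power of a complex, with its cyclic permutation -/

section Tensor

/-- The total module `⨁ V_n` of a complex. -/
abbrev Tot {S : Type u} [CommRing S] (V : Ch S) : Type u := DirectSum ℤ fun n => V.X n

/-- The inclusion `V_n → ⨁ V_n`. -/
abbrev inc {S : Type u} [CommRing S] (V : Ch S) (n : ℤ) : V.X n →ₗ[S] Tot V :=
  DirectSum.lof S ℤ (fun n => V.X n) n

/-- The differential on the total module. -/
def dTot {S : Type u} [CommRing S] (V : Ch S) : Tot V →ₗ[S] Tot V :=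
  DirectSum.toModule S ℤ _ fun n => inc V (n - 1) ∘ₗ (V.d n (n - 1)).hom

/-- The sign operator `v ↦ (-1)^{|v|} v`. -/
def sgnTot {S : Type u} [CommRing S] (V : Ch S) : Tot V →ₗ[S] Tot V :=
  DirectSum.toModule S ℤ _ fun n => if Even n then inc V n else - inc V n

/-- The projection to the even part. -/
def evenTot {S : Type u} [CommRing S] (V : Ch S) : Tot V →ₗ[S] Tot V :=
  DirectSum.toModule S ℤ _ fun n => if Even n then inc V n else 0

/-- The projection to the odd part. -/
def oddTot {S : Type u} [CommRing S] (V : Ch S) : Tot V →ₗ[S] Tot V :=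
  DirectSum.toModule S ℤ _ fun n => if Even n then 0 else inc V n

/-- The map of total modules induced by a map of complexes. -/
def mapTot {S : Type u} [CommRing S] {V W : Ch S} (f : V ⟶ W) : Tot V →ₗ[S] Tot W :=
  DirectSum.toModule S ℤ _ fun n => inc W n ∘ₗ (f.f n).hom

section
variable {S : Type u} [CommRing S] (V W : Ch S)

lemma tot_ext {M : Type*} [AddCommMonoid M] [Module S M] {f g : Tot V →ₗ[S] M}
    (h : ∀ n (v : V.X n), f (inc V n v) = g (inc V n v)) : f = g :=
  DirectSum.linearMap_ext S fun n => LinearMap.ext fun v => h n v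

@[simp] lemma dTot_inc (n : ℤ) (v : V.X n) :
    dTot V (inc V n v) = inc V (n - 1) ((V.d n (n - 1)).hom v) := by
  simp [dTot, DirectSum.toModule_lof]

@[simp] lemma sgnTot_inc (n : ℤ) (v : V.X n) :
    sgnTot V (inc V n v) = if Even n then inc V n v else - inc V n v := by
  simp only [sgnTot, DirectSum.toModule_lof]; split_ifs <;> rfl

@[simp] lemma evenTot_inc (n : ℤ) (v : V.X n) :
    evenTot V (inc V n v) = if Even n then inc V n v else 0 := by
  simp only [evenTot, DirectSum.toModule_lof]; split_ifs <;> rfl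

@[simp] lemma oddTot_inc (n : ℤ) (v : V.X n) :
    oddTot V (inc V n v) = if Even n then 0 else inc V n v := by
  simp only [oddTot, DirectSum.toModule_lof]; split_ifs <;> rfl

@[simp] lemma mapTot_inc {V W : Ch S} (f : V ⟶ W) (n : ℤ) (v : V.X n) :
    mapTot f (inc V n v) = inc W n ((f.f n).hom v) := by
  simp [mapTot, DirectSum.toModule_lof]

lemma dTot_dTot : dTot V ∘ₗ dTot V = 0 := by
  apply tot_ext
  intro n v
  have : (V.d (n - 1) (n - 1 - 1)).hom ((V.d n (n - 1)).hom v) = 0 :=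
    congrArg (fun f => f.hom v) (V.d_comp_d n (n - 1) (n - 1 - 1))
  simp only [LinearMap.comp_apply, dTot_inc, this, map_zero, LinearMap.zero_apply]

lemma sgnTot_sgnTot : sgnTot V ∘ₗ sgnTot V = LinearMap.id := by
  apply tot_ext
  intro n v
  by_cases h : Even n <;> simp [h]

lemma sgnTot_dTot : sgnTot V ∘ₗ dTot V = - (dTot V ∘ₗ sgnTot V) := by
  apply tot_ext
  intro n v
  by_cases h : Even n <;> simp [h]

lemma evenTot_dTot : evenTot V ∘ₗ dTot V = dTot V ∘ₗ oddTot V := by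
  apply tot_ext
  intro n v
  by_cases h : Even n <;> simp [h]

lemma oddTot_dTot : oddTot V ∘ₗ dTot V = dTot V ∘ₗ evenTot V := by
  apply tot_ext
  intro n v
  by_cases h : Even n <;> simp [h]

lemma sgnTot_evenTot : sgnTot V ∘ₗ evenTot V = evenTot V := by
  apply tot_ext
  intro n v
  by_cases h : Even n <;> simp [h]

lemma sgnTot_oddTot : sgnTot V ∘ₗ oddTot V = - oddTot V := by
  apply tot_ext
  intro n v
  by_cases h : Even n <;> simp [h]

lemma evenTot_sgnTot : evenTot V ∘ₗ sgnTot V = evenTot V := by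
  apply tot_ext
  intro n v
  by_cases h : Even n <;> simp [h]

lemma oddTot_sgnTot : oddTot V ∘ₗ sgnTot V = - oddTot V := by
  apply tot_ext
  intro n v
  by_cases h : Even n <;> simp [h]

variable {V W}

lemma mapTot_dTot (f : V ⟶ W) : mapTot f ∘ₗ dTot V = dTot W ∘ₗ mapTot f := by
  apply tot_ext
  intro n v
  have : (f.f (n - 1)).hom ((V.d n (n - 1)).hom v) = (W.d n (n - 1)).hom ((f.f n).hom v) :=
    congrArg (fun g => g.hom v) (f.comm n (n - 1)).symm
  simp only [LinearMap.comp_apply, dTot_inc, mapTot_inc, this]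

lemma mapTot_sgnTot (f : V ⟶ W) : mapTot f ∘ₗ sgnTot V = sgnTot W ∘ₗ mapTot f := by
  apply tot_ext
  intro n v
  by_cases h : Even n <;> simp [h]

lemma mapTot_evenTot (f : V ⟶ W) : mapTot f ∘ₗ evenTot V = evenTot W ∘ₗ mapTot f := by
  apply tot_ext
  intro n v
  by_cases h : Even n <;> simp [h]

lemma mapTot_oddTot (f : V ⟶ W) : mapTot f ∘ₗ oddTot V = oddTot W ∘ₗ mapTot f := by
  apply tot_ext
  intro n v
  by_cases h : Even n <;> simp [h]

lemma mapTot_surjective (f : V ⟶ W) (hf : ∀ n, Function.Surjective (f.f n).hom) :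
    Function.Surjective (mapTot f) := by
  intro w
  induction w using DirectSum.induction_on with
  | zero => exact ⟨0, map_zero _⟩
  | of n w =>
    obtain ⟨v, rfl⟩ := hf n w
    exact ⟨inc V n v, mapTot_inc f n v⟩
  | add x y hx hy =>
    obtain ⟨a, rfl⟩ := hx
    obtain ⟨b, rfl⟩ := hy
    exact ⟨a + b, map_add _ _ _⟩

end

/-- The `p`-fold tensor power over `S` of the total module of `V`. -/
def TensPow (p : ℕ) {S : Type u} [CommRing S] (V : Ch S) : Type u :=
  PiTensorProduct S fun _ : Fin p => Tot V

instance (p : ℕ) {S : Type u} [CommRing S] (V : Ch S) : AddCommGroup (TensPow p V) :=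
  inferInstanceAs (AddCommGroup (PiTensorProduct S fun _ : Fin p => Tot V))

instance (p : ℕ) {S : Type u} [CommRing S] (V : Ch S) : Module S (TensPow p V) :=
  inferInstanceAs (Module S (PiTensorProduct S fun _ : Fin p => Tot V))

/-- The pure tensor `v_0 ⊗ ⋯ ⊗ v_{p-1}`. -/
def pureTens (p : ℕ) {S : Type u} [CommRing S] (V : Ch S) :
    MultilinearMap S (fun _ : Fin p => Tot V) (TensPow p V) :=
  PiTensorProduct.tprod S

/-- `f_0 ⊗ ⋯ ⊗ f_{p-1}`. -/
def mapTens (p : ℕ) {S : Type u} [CommRing S] {V W : Ch S} (f : Fin p → Tot V →ₗ[S] Tot W) :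
    TensPow p V →ₗ[S] TensPow p W :=
  PiTensorProduct.map f

/-- `V^{⊗ p}` in degree `j`: spanned by `v_0 ⊗ ⋯ ⊗ v_{p-1}` with `v_t` homogeneous and
`|v_0| + ⋯ + |v_{p-1}| = j`. -/
def degTens (p : ℕ) {S : Type u} [CommRing S] (V : Ch S) (j : ℤ) : Submodule S (TensPow p V) :=
  Submodule.span S {x | ∃ (k : Fin p → ℤ) (v : ∀ t, V.X (k t)), ∑ t, k t = j ∧
    pureTens p V (fun t => inc V (k t) (v t)) = x}

/-- The differential on `V^{⊗ p}`:
`d(v_0 ⊗ ⋯ ⊗ v_{p-1}) = ∑_t (-1)^{|v_0| + ⋯ + |v_{t-1}|} v_0 ⊗ ⋯ ⊗ d v_t ⊗ ⋯ ⊗ v_{p-1}`. -/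
def dTens (p : ℕ) {S : Type u} [CommRing S] (V : Ch S) : TensPow p V →ₗ[S] TensPow p V :=
  ∑ t : Fin p, mapTens p fun s =>
    if s < t then sgnTot V else if s = t then dTot V else LinearMap.id

/-- The sign operator `x ↦ (-1)^{|x|} x` on `V^{⊗ p}`. -/
def sgnTens (p : ℕ) {S : Type u} [CommRing S] (V : Ch S) : TensPow p V →ₗ[S] TensPow p V :=
  mapTens p fun _ => sgnTot V

/-- The cyclic permutation without signs, `v_0 ⊗ ⋯ ⊗ v_{p-1} ↦ v_{p-1} ⊗ v_0 ⊗ ⋯ ⊗ v_{p-2}`. -/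
def reTens (p : ℕ) {S : Type u} [CommRing S] (V : Ch S) : TensPow p V →ₗ[S] TensPow p V :=
  (PiTensorProduct.reindex S (fun _ : Fin p => Tot V) (finRotate p)).toLinearMap

/-- The cyclic permutation with Koszul sign,
`σ(v_0 ⊗ ⋯ ⊗ v_{p-1}) = (-1)^{|v_{p-1}| (|v_0| + ⋯ + |v_{p-2}|)} v_{p-1} ⊗ v_0 ⊗ ⋯ ⊗ v_{p-2}`:
there is no sign if `v_{p-1}` is even, and the sign operator is applied to the other factors if
`v_{p-1}` is odd. -/
def rotTens (p : ℕ) {S : Type u} [CommRing S] (V : Ch S) : TensPow p V →ₗ[S] TensPow p V :=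
  reTens p V ∘ₗ
    ((mapTens p fun s => if (s : ℕ) + 1 = p then evenTot V else LinearMap.id) +
      mapTens p fun s => if (s : ℕ) + 1 = p then oddTot V else sgnTot V)

section
variable {p : ℕ} {S : Type u} [CommRing S] {V W U : Ch S}

@[simp] lemma mapTens_pure (f : Fin p → Tot V →ₗ[S] Tot W) (v : Fin p → Tot V) :
    mapTens p f (pureTens p V v) = pureTens p W fun t => f t (v t) :=
  PiTensorProduct.map_tprod f v

lemma tens_ext {M : Type*} [AddCommMonoid M] [Module S M] {f g : TensPow p V →ₗ[S] M}
    (h : ∀ v, f (pureTens p V v) = g (pureTens p V v)) : f = g :=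
  PiTensorProduct.ext (MultilinearMap.ext h)

lemma mapTens_comp (g : Fin p → Tot W →ₗ[S] Tot U) (f : Fin p → Tot V →ₗ[S] Tot W) :
    mapTens p g ∘ₗ mapTens p f = mapTens p fun t => g t ∘ₗ f t :=
  tens_ext fun v => by simp

@[simp] lemma reTens_pure (v : Fin p → Tot V) :
    reTens p V (pureTens p V v) = pureTens p V fun t => v ((finRotate p).symm t) :=
  PiTensorProduct.reindex_tprod _ _

lemma comp_sum_aux {A B C : Type*} [AddCommGroup A] [AddCommGroup B] [AddCommGroup C] [Module S A]
    [Module S B] [Module S C] (g : B →ₗ[S] C) (f : Fin p → A →ₗ[S] B) :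
    g ∘ₗ (∑ t, f t) = ∑ t, g ∘ₗ f t :=
  LinearMap.ext fun x => by simp

lemma sum_comp_aux {A B C : Type*} [AddCommGroup A] [AddCommGroup B] [AddCommGroup C] [Module S A]
    [Module S B] [Module S C] (g : A →ₗ[S] B) (f : Fin p → B →ₗ[S] C) :
    (∑ t, f t) ∘ₗ g = ∑ t, f t ∘ₗ g :=
  LinearMap.ext fun x => by simp

lemma mapTens_neg (f g : Fin p → Tot V →ₗ[S] Tot W) (s : Fin p) (hs : f s = - g s)
    (h : ∀ t, t ≠ s → f t = g t) : mapTens p f = - mapTens p g := by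
  apply tens_ext
  intro v
  rw [mapTens_pure, LinearMap.neg_apply, mapTens_pure]
  have : (fun t => f t (v t)) = Function.update (fun t => g t (v t)) s (-(g s (v s))) := by
    funext t
    by_cases ht : t = s
    · subst ht; simp [hs]
    · simp [ht, h t ht]
  rw [this, MultilinearMap.map_update_neg, Function.update_eq_self]

lemma mapTens_rot (f : Fin p → Tot V →ₗ[S] Tot W) :
    mapTens p f ∘ₗ reTens p V = reTens p W ∘ₗ mapTens p fun s => f (finRotate p s) :=
  tens_ext fun v => by simp [-finRotate_apply, -finRotate_symm_apply]

lemma val_finRotate (s : Fin p) :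
    (finRotate p s : ℕ) = if (s : ℕ) + 1 = p then 0 else (s : ℕ) + 1 := by
  obtain _ | n := p
  · exact s.elim0
  · rw [coe_finRotate]
    simp [Fin.ext_iff]

lemma dTens_dTens : dTens p V ∘ₗ dTens p V = 0 := by
  have key : ∀ s t : Fin p, s < t →
      (mapTens p fun r => if r < s then sgnTot V else if r = s then dTot V else LinearMap.id) ∘ₗ
      (mapTens p fun r => if r < t then sgnTot V else if r = t then dTot V else LinearMap.id) =
      - ((mapTens p fun r => if r < t then sgnTot V else if r = t then dTot V else LinearMap.id) ∘ₗ
      (mapTens p fun r => if r < s then sgnTot V else if r = s then dTot V else LinearMap.id)) := by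
    intro s t hst
    rw [mapTens_comp, mapTens_comp]
    apply mapTens_neg _ _ s
    · simp [hst, sgnTot_dTot]
    · intro r hr
      rcases lt_trichotomy r s with h | h | h
      · simp [h, h.trans hst]
      · exact absurd h hr
      · simp [hr, h.not_gt]
  have diag : ∀ t : Fin p,
      (mapTens p fun r => if r < t then sgnTot V else if r = t then dTot V else LinearMap.id) ∘ₗ
      (mapTens p fun r => if r < t then sgnTot V else if r = t then dTot V else LinearMap.id)
        = 0 := by
    intro t
    rw [mapTens_comp]
    apply tens_ext
    intro v
    rw [mapTens_pure]
    refine (pureTens p V).map_coord_zero t ?_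
    simpa using congrArg (fun f => f (v t)) (dTot_dTot V)
  have e : dTens p V ∘ₗ dTens p V = ∑ x : Fin p × Fin p,
      (mapTens p fun r => if r < x.1 then sgnTot V else if r = x.1 then dTot V
        else LinearMap.id) ∘ₗ
      (mapTens p fun r => if r < x.2 then sgnTot V else if r = x.2 then dTot V
        else LinearMap.id) := by
    rw [Fintype.sum_prod_type]
    apply LinearMap.ext
    intro x
    simp only [dTens, LinearMap.comp_apply, LinearMap.sum_apply, map_sum]
    rw [Finset.sum_comm]
  rw [e]
  refine Finset.sum_involution (fun x _ => (x.2, x.1)) ?_ ?_ (fun _ _ => Finset.mem_univ _)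
    (fun _ _ => rfl)
  · rintro ⟨s, t⟩ -
    rcases lt_trichotomy s t with h | h | h
    · simp [key s t h]
    · subst h; simp [diag]
    · simp [key t s h]
  · rintro ⟨s, t⟩ - h h'
    obtain rfl : t = s := congrArg Prod.fst h'
    exact h (diag t)

lemma sgnTens_sgnTens : sgnTens p V ∘ₗ sgnTens p V = LinearMap.id := by
  rw [sgnTens, mapTens_comp]
  apply tens_ext
  intro v
  simp [sgnTot_sgnTot]

lemma sgnTens_dTens : sgnTens p V ∘ₗ dTens p V = - (dTens p V ∘ₗ sgnTens p V) := by
  simp only [dTens, comp_sum_aux, sum_comp_aux, ← Finset.sum_neg_distrib]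
  refine Finset.sum_congr rfl fun t _ => ?_
  rw [sgnTens, mapTens_comp, mapTens_comp]
  apply mapTens_neg _ _ t
  · simp [sgnTot_dTot]
  · intro r hr
    rcases lt_trichotomy r t with h | h | h
    · simp [h]
    · exact absurd h hr
    · simp [hr, h.not_gt]

lemma sgnTens_rotTens : sgnTens p V ∘ₗ rotTens p V = rotTens p V ∘ₗ sgnTens p V := by
  rw [sgnTens, rotTens, ← LinearMap.comp_assoc, mapTens_rot, LinearMap.comp_assoc,
    LinearMap.comp_assoc, LinearMap.comp_add, LinearMap.add_comp]
  simp only [mapTens_comp]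
  congr 3
  · funext s
    split_ifs
    · rw [sgnTot_evenTot, evenTot_sgnTot]
    · simp
  · funext s
    split_ifs
    · rw [sgnTot_oddTot, oddTot_sgnTot]
    · rfl

lemma dTens_rotTens : dTens p V ∘ₗ rotTens p V = rotTens p V ∘ₗ dTens p V := by
  have e : dTens p V = ∑ t : Fin p, mapTens p fun s =>
      if s < finRotate p t then sgnTot V else if s = finRotate p t then dTot V
        else LinearMap.id := by
    rw [dTens]
    exact (Equiv.sum_comp (finRotate p) fun t => mapTens p fun s =>
      if s < t then sgnTot V else if s = t then dTot V else LinearMap.id).symm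
  conv_lhs => rw [e]
  rw [dTens, sum_comp_aux, comp_sum_aux]
  refine Finset.sum_congr rfl fun t _ => ?_
  rw [rotTens, ← LinearMap.comp_assoc, mapTens_rot, LinearMap.comp_assoc, LinearMap.comp_assoc]
  congr 1
  rw [LinearMap.comp_add, LinearMap.add_comp]
  simp only [mapTens_comp, Equiv.apply_eq_iff_eq]
  by_cases ht : (t : ℕ) + 1 = p
  · rw [add_comm]
    congr 1
    · congr 1
      funext s
      by_cases hs : (s : ℕ) + 1 = p
      · obtain rfl : s = t := Fin.ext (by omega)
        simp [-finRotate_apply, hs, evenTot_dTot]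
      · have h1 : s < t := Fin.lt_def.2 (by have := s.2; omega)
        have h2 : ¬ finRotate p s < finRotate p t := by
          rw [Fin.lt_def, val_finRotate, val_finRotate]; simp [-finRotate_apply, ht]
        simp [-finRotate_apply, hs, h1, h2, h1.ne]
    · congr 1
      funext s
      by_cases hs : (s : ℕ) + 1 = p
      · obtain rfl : s = t := Fin.ext (by omega)
        simp [-finRotate_apply, hs, oddTot_dTot]
      · have h1 : s < t := Fin.lt_def.2 (by have := s.2; omega)
        have h2 : ¬ finRotate p s < finRotate p t := by
          rw [Fin.lt_def, val_finRotate, val_finRotate]; simp [-finRotate_apply, ht]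
        simp [-finRotate_apply, hs, h1, h2, h1.ne, sgnTot_sgnTot]
  · congr 1
    · congr 1
      funext s
      by_cases hs : (s : ℕ) + 1 = p
      · have h1 : ¬ s < t := by rw [Fin.lt_def]; have := t.2; omega
        have h0 : s ≠ t := by rintro rfl; exact ht hs
        have h2 : finRotate p s < finRotate p t := by
          rw [Fin.lt_def, val_finRotate, val_finRotate]; simp [-finRotate_apply, ht, hs]
        simp [-finRotate_apply, hs, h1, h2, h0, sgnTot_evenTot]
      · have h2 : finRotate p s < finRotate p t ↔ s < t := by
          rw [Fin.lt_def, val_finRotate, val_finRotate, Fin.lt_def]; simp [-finRotate_apply, ht, hs]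
        simp [-finRotate_apply, hs, h2]
    · have htp : ∃ l : Fin p, (l : ℕ) + 1 = p := ⟨⟨p - 1, by have := t.2; omega⟩, by
        have := t.2; simp only; omega⟩
      obtain ⟨l, hl⟩ := htp
      have h1 : ¬ l < t := by rw [Fin.lt_def]; have := t.2; omega
      have h0 : l ≠ t := by rintro rfl; exact ht hl
      have h2 : finRotate p l < finRotate p t := by
        rw [Fin.lt_def, val_finRotate, val_finRotate]; simp [-finRotate_apply, ht, hl]
      have h3 : ∀ s : Fin p, s ≠ l → (s : ℕ) + 1 ≠ p := fun s hs h =>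
        hs (Fin.ext (by omega))
      have h4 : ∀ s : Fin p, s ≠ l → (finRotate p s < finRotate p t ↔ s < t) := by
        intro s hs
        rw [Fin.lt_def, val_finRotate, val_finRotate, Fin.lt_def]; simp [-finRotate_apply, ht, h3 s hs]
      rw [mapTens_neg _ (fun s => if s = l then oddTot V else
        if s < t then LinearMap.id else if s = t then dTot V ∘ₗ sgnTot V else sgnTot V) l,
        eq_comm, mapTens_neg _ (fun s => if s = l then oddTot V else
        if s < t then LinearMap.id else if s = t then dTot V ∘ₗ sgnTot V else sgnTot V) t]
      · simp [-finRotate_apply, ht, h0.symm, sgnTot_dTot]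
      · intro s hs
        by_cases hsl : s = l
        · subst hsl; simp [-finRotate_apply, hl, h1, h0]
        · by_cases hst : s < t
          · simp [-finRotate_apply, h3 s hsl, hsl, hst, sgnTot_sgnTot]
          · simp [-finRotate_apply, h3 s hsl, hsl, hst, hs]
      · simp [-finRotate_apply, hl, h2, sgnTot_oddTot]
      · intro s hs
        by_cases hst : s < t
        · simp [-finRotate_apply, h3 s hs, hs, hst, h4 s hs, sgnTot_sgnTot]
        · by_cases hst' : s = t
          · subst hst'; simp [-finRotate_apply, ht, hs]
          · simp [-finRotate_apply, h3 s hs, hs, hst, hst', h4 s hs]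

/-! #### Degrees -/

lemma pure_mem_degTens {j : ℤ} (k : Fin p → ℤ) (hk : ∑ t, k t = j) (w : Fin p → Tot V)
    (hw : ∀ t, ∃ v, inc V (k t) v = w t) : pureTens p V w ∈ degTens p V j := by
  choose v hv using hw
  exact Submodule.subset_span ⟨k, v, hk, by congr 1; funext t; exact hv t⟩

lemma sgnTot_inc_mem (n : ℤ) (v : V.X n) : ∃ w, inc V n w = sgnTot V (inc V n v) := by
  by_cases h : Even n
  · exact ⟨v, by simp [h]⟩
  · exact ⟨-v, by simp [h]⟩

lemma inc_congr {n m : ℤ} (h : n = m) {x : Tot V} (hx : ∃ v, inc V m v = x) :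
    ∃ v, inc V n v = x := by
  subst h; exact hx

lemma dTens_deg (j : ℤ) : degTens p V j ≤ (degTens p V (j - 1)).comap (dTens p V) := by
  refine Submodule.span_le.2 ?_
  rintro _ ⟨k, v, rfl, rfl⟩
  simp only [dTens, SetLike.mem_coe, Submodule.mem_comap, LinearMap.sum_apply, mapTens_pure]
  refine sum_mem fun t _ => ?_
  refine pure_mem_degTens (Function.update k t (k t - 1)) ?_ _ ?_
  · rw [Finset.sum_update_of_mem (Finset.mem_univ t),
      ← Finset.add_sum_erase Finset.univ k (Finset.mem_univ t), Finset.sdiff_singleton_eq_erase]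
    ring
  · intro s
    rcases lt_trichotomy s t with h | h | h
    · refine inc_congr (Function.update_of_ne h.ne _ _) ?_
      simpa only [h, if_true] using sgnTot_inc_mem (k s) (v s)
    · subst h
      refine inc_congr (Function.update_self _ _ _) ?_
      simp only [lt_irrefl, if_false, if_true, dTot_inc]
      exact ⟨_, rfl⟩
    · refine inc_congr (Function.update_of_ne h.ne' _ _) ?_
      simp only [h.not_gt, h.ne', if_false]
      exact ⟨_, rfl⟩

lemma sgnTens_deg (j : ℤ) : degTens p V j ≤ (degTens p V j).comap (sgnTens p V) := by
  refine Submodule.span_le.2 ?_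
  rintro _ ⟨k, v, rfl, rfl⟩
  simp only [sgnTens, SetLike.mem_coe, Submodule.mem_comap, mapTens_pure]
  exact pure_mem_degTens k rfl _ fun t => sgnTot_inc_mem (k t) (v t)

end

/-- Maps of `p`-fold tensor powers that respect the grading, the differential and the cyclic
permutation. -/
@[ext]
structure TensHom (p : ℕ) {S : Type u} [CommRing S] (V W : Ch S) where
  /-- the underlying linear map -/
  toLin : TensPow p V →ₗ[S] TensPow p W
  deg : ∀ j, degTens p V j ≤ (degTens p W j).comap toLin
  comm_d : toLin ∘ₗ dTens p V = dTens p W ∘ₗ toLin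
  comm_sgn : toLin ∘ₗ sgnTens p V = sgnTens p W ∘ₗ toLin
  comm_rot : toLin ∘ₗ rotTens p V = rotTens p W ∘ₗ toLin

section
variable {p : ℕ} {S : Type u} [CommRing S] {V W U : Ch S}

/-- The identity. -/
@[simps]
def TensHom.id (p : ℕ) {S : Type u} [CommRing S] (V : Ch S) : TensHom p V V :=
  ⟨LinearMap.id, fun _ => le_rfl, rfl, rfl, rfl⟩

/-- Composition. -/
@[simps]
def TensHom.comp (f : TensHom p V W) (g : TensHom p W U) : TensHom p V U where
  toLin := g.toLin ∘ₗ f.toLin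
  deg j x hx := g.deg j (f.deg j hx)
  comm_d := by rw [LinearMap.comp_assoc, f.comm_d, ← LinearMap.comp_assoc, g.comm_d]; rfl
  comm_sgn := by rw [LinearMap.comp_assoc, f.comm_sgn, ← LinearMap.comp_assoc, g.comm_sgn]; rfl
  comm_rot := by rw [LinearMap.comp_assoc, f.comm_rot, ← LinearMap.comp_assoc, g.comm_rot]; rfl

lemma mapTens_comm (f : Tot V →ₗ[S] Tot W) (g : Fin p → Tot V →ₗ[S] Tot V)
    (g' : Fin p → Tot W →ₗ[S] Tot W) (h : ∀ t, f ∘ₗ g t = g' t ∘ₗ f) :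
    (mapTens p fun _ => f) ∘ₗ mapTens p g = mapTens p g' ∘ₗ mapTens p fun _ => f := by
  rw [mapTens_comp, mapTens_comp]
  congr 1
  funext t
  exact h t

/-- `f^{⊗ p}` for a map of complexes `f`. -/
@[simps]
def TensHom.ofMap (p : ℕ) {S : Type u} [CommRing S] {V W : Ch S} (f : V ⟶ W) : TensHom p V W where
  toLin := mapTens p fun _ => mapTot f
  deg j := by
    refine Submodule.span_le.2 ?_
    rintro _ ⟨k, v, rfl, rfl⟩
    simp only [SetLike.mem_coe, Submodule.mem_comap, mapTens_pure]
    exact pure_mem_degTens k rfl _ fun t => ⟨_, (mapTot_inc f _ _).symm⟩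
  comm_d := by
    rw [dTens, dTens, comp_sum_aux, sum_comp_aux]
    refine Finset.sum_congr rfl fun t _ => mapTens_comm _ _ _ fun s => ?_
    split_ifs
    · exact mapTot_sgnTot f
    · exact mapTot_dTot f
    · rfl
  comm_sgn := mapTens_comm _ _ _ fun _ => mapTot_sgnTot f
  comm_rot := by
    rw [rotTens, rotTens, ← LinearMap.comp_assoc, mapTens_rot, LinearMap.comp_assoc,
      LinearMap.comp_assoc, LinearMap.comp_add, LinearMap.add_comp]
    congr 2
    · refine mapTens_comm _ _ _ fun s => ?_
      split_ifs
      · exact mapTot_evenTot f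
      · rfl
    · refine mapTens_comm _ _ _ fun s => ?_
      split_ifs
      · exact mapTot_oddTot f
      · exact mapTot_sgnTot f

lemma mapTot_id : mapTot (𝟙 V) = LinearMap.id := tot_ext _ fun n v => by simp

lemma mapTot_comp (f : V ⟶ W) (g : W ⟶ U) : mapTot (f ≫ g) = mapTot g ∘ₗ mapTot f :=
  tot_ext _ fun n v => by simp

lemma TensHom.ofMap_id : TensHom.ofMap p (𝟙 V) = TensHom.id p V := by
  apply TensHom.ext
  apply tens_ext
  intro v
  simp [mapTot_id]

lemma TensHom.ofMap_comp (f : V ⟶ W) (g : W ⟶ U) :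
    TensHom.ofMap p (f ≫ g) = (TensHom.ofMap p f).comp (TensHom.ofMap p g) := by
  apply TensHom.ext
  apply tens_ext
  intro v
  simp [mapTot_comp]

/-! #### Multiplication by `p` as a map `V^{⊗ p}/p → V^{⊗ p}` -/

/-- A map of complexes that looks like a quotient map `V → V/p`, in the weak sense needed below:
it is surjective, and `p` kills its kernel. -/
structure IsPQuot (p : ℕ) {S : Type u} [CommRing S] {V W : Ch S} (η : V ⟶ W) : Prop where
  surj : ∀ n, Function.Surjective (η.f n).hom
  ker : ∀ n (v : V.X n), (η.f n).hom v = 0 → (p : S) • v = 0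

lemma mapTot_apply (f : V ⟶ W) (x : Tot V) (n : ℤ) : mapTot f x n = (f.f n).hom (x n) := by
  induction x using DirectSum.induction_on with
  | zero => simp
  | of m v =>
    change mapTot f (inc V m v) n = (f.f n).hom (inc V m v n)
    rw [mapTot_inc]
    by_cases h : m = n
    · subst h
      rw [DirectSum.lof_apply, DirectSum.lof_apply]
    · rw [DirectSum.lof_eq_of, DirectSum.lof_eq_of, DirectSum.of_eq_of_ne _ _ _ (Ne.symm h),
        DirectSum.of_eq_of_ne _ _ _ (Ne.symm h), map_zero]
  | add x y hx hy => simp only [map_add, DirectSum.add_apply, hx, hy]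

lemma IsPQuot.ker_tot {η : V ⟶ W} (h : IsPQuot p η) (x : Tot V) (hx : mapTot η x = 0) :
    (p : S) • x = 0 := by
  refine DFinsupp.ext fun n => ?_
  refine h.ker n (x n) ?_
  rw [← mapTot_apply, hx]
  rfl

lemma IsPQuot.smul_update {η : V ⟶ W} (h : IsPQuot p η) (v : Fin p → Tot V) (t : Fin p)
    (x y : Tot V) (hxy : mapTot η x = mapTot η y) :
    (p : S) • pureTens p V (Function.update v t x) =
      (p : S) • pureTens p V (Function.update v t y) := by
  rw [← MultilinearMap.map_update_smul, ← MultilinearMap.map_update_smul, ← sub_eq_zero,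
    ← MultilinearMap.map_update_sub, ← smul_sub, h.ker_tot (x - y) (by rw [map_sub, hxy, sub_self])]
  exact (pureTens p V).map_coord_zero t (by simp)

lemma IsPQuot.smul_congr {η : V ⟶ W} (h : IsPQuot p η) (v w : Fin p → Tot V)
    (hvw : ∀ t, mapTot η (v t) = mapTot η (w t)) :
    (p : S) • pureTens p V v = (p : S) • pureTens p V w := by
  have key : ∀ s : Finset (Fin p),
      (p : S) • pureTens p V (s.piecewise w v) = (p : S) • pureTens p V v := by
    intro s
    induction s using Finset.induction_on with
    | empty => simp
    | insert j s hj ih =>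
      rw [Finset.piecewise_insert, ← ih]
      conv_rhs => rw [← Function.update_eq_self j (s.piecewise w v)]
      refine h.smul_update _ _ _ _ ?_
      rw [Finset.piecewise_eq_of_notMem _ _ _ hj, hvw]
  have := key Finset.univ
  rw [Finset.piecewise_univ] at this
  exact this.symm

/-- A set-theoretic section of `mapTot η`. -/
def IsPQuot.sec {η : V ⟶ W} (h : IsPQuot p η) : Tot W → Tot V :=
  Function.surjInv (mapTot_surjective η h.surj)

lemma IsPQuot.mapTot_sec {η : V ⟶ W} (h : IsPQuot p η) (w : Tot W) :
    mapTot η (h.sec w) = w := Function.surjInv_eq _ w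

/-- The multilinear map underlying `IsPQuot.pLin`. -/
def IsPQuot.pMulti {η : V ⟶ W} (h : IsPQuot p η) :
    MultilinearMap S (fun _ : Fin p => Tot W) (TensPow p V) where
  toFun w := (p : S) • pureTens p V fun t => h.sec (w t)
  map_update_add' := by
    intro _ w t x y
    obtain rfl : ‹DecidableEq (Fin p)› = instDecidableEqFin p := Subsingleton.elim _ _
    have key : ∀ (z : Tot W) (z' : Tot V), mapTot η z' = z →
        (p : S) • pureTens p V (fun s => h.sec (Function.update w t z s)) =
        (p : S) • pureTens p V (Function.update (fun s => h.sec (w s)) t z') := by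
      intro z z' hz
      refine h.smul_congr _ _ fun s => ?_
      by_cases hs : s = t
      · subst hs; simp [h.mapTot_sec, hz]
      · simp [hs, h.mapTot_sec]
    rw [key _ (h.sec x + h.sec y) (by simp [h.mapTot_sec]), key _ _ (h.mapTot_sec x),
      key _ _ (h.mapTot_sec y), MultilinearMap.map_update_add, smul_add]
  map_update_smul' := by
    intro _ w t c x
    obtain rfl : ‹DecidableEq (Fin p)› = instDecidableEqFin p := Subsingleton.elim _ _
    have key : ∀ (z : Tot W) (z' : Tot V), mapTot η z' = z →
        (p : S) • pureTens p V (fun s => h.sec (Function.update w t z s)) =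
        (p : S) • pureTens p V (Function.update (fun s => h.sec (w s)) t z') := by
      intro z z' hz
      refine h.smul_congr _ _ fun s => ?_
      by_cases hs : s = t
      · subst hs; simp [h.mapTot_sec, hz]
      · simp [hs, h.mapTot_sec]
    rw [key _ (c • h.sec x) (by simp [h.mapTot_sec]), key _ _ (h.mapTot_sec x),
      MultilinearMap.map_update_smul, smul_comm]

/-- The map `η(v_0) ⊗ ⋯ ⊗ η(v_{p-1}) ↦ p (v_0 ⊗ ⋯ ⊗ v_{p-1})`. -/
def IsPQuot.pLin {η : V ⟶ W} (h : IsPQuot p η) : TensPow p W →ₗ[S] TensPow p V :=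
  PiTensorProduct.lift h.pMulti

lemma IsPQuot.pLin_comp {η : V ⟶ W} (h : IsPQuot p η) :
    h.pLin ∘ₗ (TensHom.ofMap p η).toLin = (p : S) • LinearMap.id := by
  apply tens_ext
  intro v
  simp only [TensHom.ofMap_toLin, LinearMap.comp_apply, mapTens_pure, LinearMap.smul_apply,
    LinearMap.id_apply]
  refine (PiTensorProduct.lift.tprod _).trans ?_
  exact h.smul_congr _ _ fun t => h.mapTot_sec _

lemma IsPQuot.tens_surj {η : V ⟶ W} (h : IsPQuot p η) :
    Function.Surjective (TensHom.ofMap p η).toLin := by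
  rw [← LinearMap.range_eq_top, eq_top_iff]
  have : Submodule.span S (Set.range (pureTens p W)) = ⊤ := PiTensorProduct.span_tprod_eq_top
  rw [← this, Submodule.span_le]
  rintro _ ⟨w, rfl⟩
  exact ⟨pureTens p V fun t => h.sec (w t), by simp [h.mapTot_sec]⟩

lemma IsPQuot.cancel {η : V ⟶ W} (h : IsPQuot p η) {M : Type*} [AddCommGroup M] [Module S M]
    {f g : TensPow p W →ₗ[S] M}
    (hfg : f ∘ₗ (TensHom.ofMap p η).toLin = g ∘ₗ (TensHom.ofMap p η).toLin) : f = g :=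
  LinearMap.ext fun x => by
    obtain ⟨y, rfl⟩ := h.tens_surj x
    exact congrArg (fun f => f y) hfg

/-- Multiplication by `p`, as a map `(V/p)^{⊗ p} = V^{⊗ p}/p → V^{⊗ p}`. -/
@[simps]
def IsPQuot.pHom {η : V ⟶ W} (h : IsPQuot p η) : TensHom p W V where
  toLin := h.pLin
  deg j := by
    refine Submodule.span_le.2 ?_
    rintro _ ⟨k, w, rfl, rfl⟩
    choose v hv using fun t => h.surj (k t) (w t)
    have e : pureTens p W (fun t => inc W (k t) (w t)) =
        (TensHom.ofMap p η).toLin (pureTens p V fun t => inc V (k t) (v t)) := by simp [hv]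
    have e' := congrArg (fun f => f (pureTens p V fun t => inc V (k t) (v t))) h.pLin_comp
    rw [SetLike.mem_coe, Submodule.mem_comap, e]
    simp only [LinearMap.comp_apply] at e'
    rw [e']
    exact Submodule.smul_mem _ _ (pure_mem_degTens k rfl _ fun t => ⟨_, rfl⟩)
  comm_d := h.cancel <| by
    rw [LinearMap.comp_assoc, ← (TensHom.ofMap p η).comm_d, ← LinearMap.comp_assoc, h.pLin_comp,
      LinearMap.comp_assoc, h.pLin_comp]
    ext; simp
  comm_sgn := h.cancel <| by
    rw [LinearMap.comp_assoc, ← (TensHom.ofMap p η).comm_sgn, ← LinearMap.comp_assoc, h.pLin_comp,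
      LinearMap.comp_assoc, h.pLin_comp]
    ext; simp
  comm_rot := h.cancel <| by
    rw [LinearMap.comp_assoc, ← (TensHom.ofMap p η).comm_rot, ← LinearMap.comp_assoc, h.pLin_comp,
      LinearMap.comp_assoc, h.pLin_comp]
    ext; simp

lemma IsPQuot.pHom_natural {V' W' : Ch S} {η : V ⟶ W} {η' : V' ⟶ W'} (h : IsPQuot p η)
    (h' : IsPQuot p η') (f : V ⟶ V') (g : W ⟶ W') (e : η ≫ g = f ≫ η') :
    (TensHom.ofMap p g).comp h'.pHom = h.pHom.comp (TensHom.ofMap p f) := by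
  apply TensHom.ext
  refine h.cancel ?_
  have e1 : (TensHom.ofMap p g).toLin ∘ₗ (TensHom.ofMap p η).toLin =
      (TensHom.ofMap p η').toLin ∘ₗ (TensHom.ofMap p f).toLin := by
    have := congrArg TensHom.toLin (congrArg (TensHom.ofMap p) e)
    rw [TensHom.ofMap_comp, TensHom.ofMap_comp] at this
    exact this
  simp only [TensHom.comp_toLin, IsPQuot.pHom_toLin]
  rw [LinearMap.comp_assoc, e1, ← LinearMap.comp_assoc, h'.pLin_comp, LinearMap.comp_assoc,
    h.pLin_comp]
  ext; simp

/-- `W` is killed by `p`, so the composition `V^{⊗ p}/p → V^{⊗ p} → V^{⊗ p}/p` vanishes. -/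
lemma IsPQuot.pHom_comp_ofMap {η : V ⟶ W} (h : IsPQuot p η)
    (hW : ∀ n (w : W.X n), (p : S) • w = 0) (hp : 0 < p) :
    (TensHom.ofMap p η).toLin ∘ₗ h.pLin = 0 := by
  refine h.cancel ?_
  rw [LinearMap.comp_assoc, h.pLin_comp]
  apply tens_ext
  intro v
  have h0 : (p : S) • mapTot η (v ⟨0, hp⟩) = 0 :=
    DFinsupp.ext fun n => hW n _
  simp only [TensHom.ofMap_toLin, LinearMap.comp_apply, LinearMap.smul_apply, LinearMap.id_apply,
    map_smul, mapTens_pure, LinearMap.zero_apply]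
  rw [← Function.update_eq_self (⟨0, hp⟩ : Fin p) (fun t => mapTot η (v t)),
    ← MultilinearMap.map_update_smul, h0]
  exact (pureTens p W).map_coord_zero ⟨0, hp⟩ (by simp)

end
end Tensor

/-! ### Multiplicative resolution data for `ℤ/p` -/

/-- The cyclic group `ℤ/p`, written multiplicatively. -/
abbrev Cyc (p : ℕ) := Multiplicative (ZMod p)

/-- A unital associative DG ring (with homological grading: the differential has degree `-1`)
with an action of `ℤ/p` by automorphisms of DG rings. -/
structure EquivariantDGRing (p : ℕ) where
  /-- the underlying ring, the direct sum of the terms -/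
  A : Type u
  [ring : Ring A]
  [action : MulSemiringAction (Cyc p) A]
  /-- the terms -/
  gr : ℤ → AddSubgroup A
  [graded : GradedRing gr]
  /-- the differential -/
  d : A →+ A
  d_mem : ∀ i x, x ∈ gr i → d x ∈ gr (i - 1)
  d_d : ∀ x, d (d x) = 0
  leibniz : ∀ i x y, x ∈ gr i → d (x * y) = d x * y + i.negOnePow • (x * d y)
  smul_mem : ∀ (g : Cyc p) i x, x ∈ gr i → g • x ∈ gr i
  d_smul : ∀ (g : Cyc p) x, d (g • x) = g • d x

namespace EquivariantDGRing

attribute [instance] ring action graded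

/-- The degree `i` term as a representation of `ℤ/p`, that is, a `ℤ[ℤ/p]`-module. -/
def rep {p : ℕ} (D : EquivariantDGRing.{u} p) (i : ℤ) : Representation ℤ (Cyc p) (D.gr i) where
  toFun g := AddMonoidHom.toIntLinearMap
    { toFun := fun x => ⟨g • x.1, D.smul_mem g i x.1 x.2⟩
      map_zero' := Subtype.ext (smul_zero g)
      map_add' := fun x y => Subtype.ext (smul_add g x.1 y.1) }
  map_one' := LinearMap.ext fun x => Subtype.ext (one_smul _ x.1)
  map_mul' g h := LinearMap.ext fun x => Subtype.ext (mul_smul g h x.1)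

/-- The degree `i` term is a projective `ℤ[ℤ/p]`-module. -/
def IsProjectiveTerm {p : ℕ} (D : EquivariantDGRing.{u} p) (i : ℤ) : Prop :=
  Module.Projective (MonoidAlgebra ℤ (Cyc p)) (D.rep i).asModule

/-- The sign operator `x ↦ (-1)^{|x|} x`. -/
def sgn {p : ℕ} (D : EquivariantDGRing.{u} p) : D.A →ₗ[ℤ] D.A :=
  AddMonoidHom.toIntLinearMap <|
    (DirectSum.toAddMonoid fun i => i.negOnePow • (D.gr i).subtype).comp
      (DirectSum.decomposeAddEquiv D.gr).toAddMonoidHom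

/-- The differential as a `ℤ`-linear map. -/
def dLin {p : ℕ} (D : EquivariantDGRing.{u} p) : D.A →ₗ[ℤ] D.A := D.d.toIntLinearMap

/-- The action of the generator of `ℤ/p`. -/
def gen {p : ℕ} (D : EquivariantDGRing.{u} p) : D.A →ₗ[ℤ] D.A :=
  (DistribSMul.toAddMonoidHom D.A (Multiplicative.ofAdd (1 : ZMod p))).toIntLinearMap

section
variable {p : ℕ} (D : EquivariantDGRing.{u} p)

lemma sgn_of_mem {i : ℤ} {x : D.A} (hx : x ∈ D.gr i) : D.sgn x = i.negOnePow • x := by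
  lift x to D.gr i using hx
  simp [sgn, DirectSum.decompose_coe]

lemma hom_ext {M : Type*} [AddCommGroup M] {f g : D.A →ₗ[ℤ] M}
    (h : ∀ i, ∀ x ∈ D.gr i, f x = g x) : f = g := by
  refine LinearMap.ext fun x => ?_
  induction x using DirectSum.Decomposition.inductionOn D.gr with
  | zero => simp
  | homogeneous m => exact h _ m m.2
  | add a b ha hb => rw [map_add, map_add, ha, hb]

lemma dLin_mem {i : ℤ} {x : D.A} (hx : x ∈ D.gr i) : D.dLin x ∈ D.gr (i - 1) := D.d_mem i x hx

lemma sgn_mem {i : ℤ} {x : D.A} (hx : x ∈ D.gr i) : D.sgn x ∈ D.gr i := by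
  rw [D.sgn_of_mem hx]
  exact zsmul_mem hx _

lemma gen_mem {i : ℤ} {x : D.A} (hx : x ∈ D.gr i) : D.gen x ∈ D.gr i := D.smul_mem _ i x hx

lemma dLin_dLin : D.dLin ∘ₗ D.dLin = 0 := LinearMap.ext D.d_d

lemma dLin_gen : D.dLin ∘ₗ D.gen = D.gen ∘ₗ D.dLin := LinearMap.ext (D.d_smul _)

lemma sgn_gen : D.sgn ∘ₗ D.gen = D.gen ∘ₗ D.sgn := D.hom_ext fun i x hx => by
  rw [LinearMap.comp_apply, LinearMap.comp_apply, D.sgn_of_mem hx, D.sgn_of_mem (D.gen_mem hx)]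
  exact (map_zsmul D.gen _ x).symm

lemma dLin_sgn : D.dLin ∘ₗ D.sgn = - (D.sgn ∘ₗ D.dLin) := D.hom_ext fun i x hx => by
  rw [LinearMap.neg_apply, LinearMap.comp_apply, LinearMap.comp_apply, D.sgn_of_mem hx,
    D.sgn_of_mem (D.dLin_mem hx), Int.negOnePow_sub, Int.negOnePow_one]
  have := map_zsmul D.dLin (i.negOnePow : ℤ) x
  rw [Units.smul_def, this, mul_neg, mul_one, Units.smul_def, Units.val_neg, neg_smul, neg_neg]

end

end EquivariantDGRing

/-- Multiplicative resolution data for `ℤ/p`: a projective resolution `P → ℤ` and a resolution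
`ℤ → I^0 → I^1 → ⋯` of the trivial `ℤ[ℤ/p]`-module `ℤ`, with DG ring structures on the cone `P̄` of
`P → ℤ` (so that `P̄_0 = ℤ`, `P̄_i = P_{i-1}` for `i ≥ 1`, and `P̄` is acyclic) and on `I` (with `I^n`
placed in homological degree `-n`).  The terms of `I` are projective `ℤ[ℤ/p]`-modules (equivalently,
`ℤ`-free and injective relative to `ℤ`). -/
structure MulResolutionData (p : ℕ) where
  /-- the cone `P̄` of `P → ℤ` -/
  P : EquivariantDGRing.{u} p
  /-- the resolution `I` -/
  I : EquivariantDGRing.{u} p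
  P_neg : ∀ i < 0, P.gr i = ⊥
  P_zero : ∀ x ∈ P.gr 0, ∃ n : ℤ, x = n
  P_char : Function.Injective (Int.cast : ℤ → P.A)
  P_proj : ∀ i > 0, P.IsProjectiveTerm i
  P_acyclic : ∀ x, P.d x = 0 → ∃ y, P.d y = x
  I_pos : ∀ i > 0, I.gr i = ⊥
  I_proj : ∀ i ≤ 0, I.IsProjectiveTerm i
  I_char : Function.Injective (Int.cast : ℤ → I.A)
  I_zero : ∀ x ∈ I.gr 0, I.d x = 0 → ∃ n : ℤ, x = n
  I_exact : ∀ i < 0, ∀ x ∈ I.gr i, I.d x = 0 → ∃ y, I.d y = x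

/-! ### The Tate complex -/

namespace MulResolutionData

section Coefficients
variable {p : ℕ} (ν : MulResolutionData.{u} p)

/-- `P̄ ⊗ I`. -/
def B : Type u := ν.P.A ⊗[ℤ] ν.I.A

instance : AddCommGroup ν.B := inferInstanceAs (AddCommGroup (ν.P.A ⊗[ℤ] ν.I.A))

/-- The element `x ⊗ y` of `P̄ ⊗ I`. -/
def tmulB (x : ν.P.A) (y : ν.I.A) : ν.B := x ⊗ₜ[ℤ] y

/-- The endomorphism `f ⊗ g` of `P̄ ⊗ I`. -/
def mapB (f : ν.P.A →ₗ[ℤ] ν.P.A) (g : ν.I.A →ₗ[ℤ] ν.I.A) : ν.B →ₗ[ℤ] ν.B :=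
  AddMonoidHom.toIntLinearMap (M := ν.B) (M₂ := ν.B) (TensorProduct.map f g).toAddMonoidHom

/-- The degree `m` term of `P̄ ⊗ I`. -/
def degB (m : ℤ) : Submodule ℤ ν.B :=
  Submodule.span ℤ {z | ∃ a b, a + b = m ∧ ∃ x ∈ ν.P.gr a, ∃ y ∈ ν.I.gr b, ν.tmulB x y = z}

/-- The differential on `P̄ ⊗ I`, `d(x ⊗ y) = dx ⊗ y + (-1)^{|x|} x ⊗ dy`. -/
def dB : ν.B →ₗ[ℤ] ν.B := ν.mapB ν.P.dLin LinearMap.id + ν.mapB ν.P.sgn ν.I.dLin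

/-- The diagonal action of the generator of `ℤ/p` on `P̄ ⊗ I`. -/
def genB : ν.B →ₗ[ℤ] ν.B := ν.mapB ν.P.gen ν.I.gen

lemma mapB_tmulB (f : ν.P.A →ₗ[ℤ] ν.P.A) (g : ν.I.A →ₗ[ℤ] ν.I.A) (x : ν.P.A) (y : ν.I.A) :
    ν.mapB f g (ν.tmulB x y) = ν.tmulB (f x) (g y) := rfl

lemma B_ext {f g : ν.B →ₗ[ℤ] ν.B} (h : ∀ x y, f (ν.tmulB x y) = g (ν.tmulB x y)) : f = g := by
  refine LinearMap.ext fun z => ?_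
  refine TensorProduct.induction_on (motive := fun z : ν.P.A ⊗[ℤ] ν.I.A =>
    f (show ν.B from z) = g (show ν.B from z)) z ?_ h ?_
  · exact (map_zero f).trans (map_zero g).symm
  · intro a b ha hb
    exact (map_add f a b).trans ((congrArg₂ (· + ·) ha hb).trans (map_add g a b).symm)

lemma tmulB_neg (x : ν.P.A) (y : ν.I.A) : ν.tmulB (-x) y = - ν.tmulB x y :=
  TensorProduct.neg_tmul x y

lemma tmulB_zero (x : ν.P.A) : ν.tmulB x 0 = 0 := TensorProduct.tmul_zero _ x

lemma zero_tmulB (y : ν.I.A) : ν.tmulB 0 y = 0 := TensorProduct.zero_tmul _ y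

lemma dB_dB : ν.dB ∘ₗ ν.dB = 0 := by
  apply ν.B_ext
  intro x y
  have h1 : ν.P.dLin (ν.P.dLin x) = 0 := ν.P.d_d x
  have h2 : ν.I.dLin (ν.I.dLin y) = 0 := ν.I.d_d y
  have h3 : ν.P.dLin (ν.P.sgn x) = - ν.P.sgn (ν.P.dLin x) :=
    congrArg (fun f => f x) ν.P.dLin_sgn
  simp [dB, mapB_tmulB, h1, h2, h3, tmulB_neg, tmulB_zero, zero_tmulB]

lemma dB_genB : ν.dB ∘ₗ ν.genB = ν.genB ∘ₗ ν.dB := by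
  apply ν.B_ext
  intro x y
  have h1 : ν.P.dLin (ν.P.gen x) = ν.P.gen (ν.P.dLin x) := congrArg (fun f => f x) ν.P.dLin_gen
  have h2 : ν.I.dLin (ν.I.gen y) = ν.I.gen (ν.I.dLin y) := congrArg (fun f => f y) ν.I.dLin_gen
  have h3 : ν.P.sgn (ν.P.gen x) = ν.P.gen (ν.P.sgn x) := congrArg (fun f => f x) ν.P.sgn_gen
  simp [dB, genB, mapB_tmulB, h1, h2, h3]

lemma dB_mem (m : ℤ) : ν.degB m ≤ (ν.degB (m - 1)).comap ν.dB := by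
  refine Submodule.span_le.2 ?_
  rintro _ ⟨a, b, rfl, x, hx, y, hy, rfl⟩
  rw [SetLike.mem_coe, Submodule.mem_comap, dB, LinearMap.add_apply, mapB_tmulB, mapB_tmulB]
  exact add_mem (Submodule.subset_span ⟨a - 1, b, by ring, _, ν.P.dLin_mem hx, y, hy, rfl⟩)
    (Submodule.subset_span ⟨a, b - 1, by ring, _, ν.P.sgn_mem hx, _, ν.I.dLin_mem hy, rfl⟩)

end Coefficients

section Tate
variable {p : ℕ} (ν : MulResolutionData.{u} p) {S : Type u} [CommRing S]

/-- `V^{⊗ p} ⊗ P̄ ⊗ I`. -/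
abbrev X (V : Ch S) : Type u := TensPow p V ⊗[ℤ] ν.B

/-- `f ⊗ g`. -/
def act {V W : Ch S} (f : TensPow p V →ₗ[S] TensPow p W) (g : ν.B →ₗ[ℤ] ν.B) :
    ν.X V →ₗ[S] ν.X W :=
  TensorProduct.AlgebraTensorModule.map f g

/-- The differential on `V^{⊗ p} ⊗ P̄ ⊗ I`. -/
def dX (V : Ch S) : ν.X V →ₗ[S] ν.X V :=
  ν.act (dTens p V) LinearMap.id + ν.act (sgnTens p V) ν.dB

/-- The diagonal action of the generator of `ℤ/p` on `V^{⊗ p} ⊗ P̄ ⊗ I`. -/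
def genX (V : Ch S) : ν.X V →ₗ[S] ν.X V := ν.act (rotTens p V) ν.genB

/-- The degree `n` term of `V^{⊗ p} ⊗ P̄ ⊗ I`. -/
def degX (V : Ch S) (n : ℤ) : Submodule S (ν.X V) :=
  Submodule.span S {z | ∃ j m, j + m = n ∧ ∃ e ∈ degTens p V j, ∃ b ∈ ν.degB m, e ⊗ₜ b = z}

/-- The degree `n` term of `F^i V^{⊗ p} ⊗ P̄ ⊗ I`, where `F^i V^{⊗ p}` is the part of `V^{⊗ p}` of
degrees `≤ - i p` (the `p`-th rescaling of the stupid filtration). -/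
def filX (V : Ch S) (i n : ℤ) : Submodule S (ν.X V) :=
  Submodule.span S {z | ∃ j m, j + m = n ∧ j ≤ - (i * p) ∧
    ∃ e ∈ degTens p V j, ∃ b ∈ ν.degB m, e ⊗ₜ b = z}

/-- The degree `n` term of the `ℤ/p`-invariants `(V^{⊗ p} ⊗ P̄ ⊗ I)^{ℤ/p}`. -/
def invX (V : Ch S) (n : ℤ) : Submodule S (ν.X V) :=
  ν.degX V n ⊓ LinearMap.ker (ν.genX V - LinearMap.id)

@[simp] lemma act_tmul {V W : Ch S} (f : TensPow p V →ₗ[S] TensPow p W) (g : ν.B →ₗ[ℤ] ν.B)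
    (e : TensPow p V) (b : ν.B) : ν.act f g (e ⊗ₜ b) = f e ⊗ₜ g b := rfl

lemma act_comp {V W U : Ch S} (f : TensPow p V →ₗ[S] TensPow p W) (g : ν.B →ₗ[ℤ] ν.B)
    (f' : TensPow p W →ₗ[S] TensPow p U) (g' : ν.B →ₗ[ℤ] ν.B) :
    ν.act f' g' ∘ₗ ν.act f g = ν.act (f' ∘ₗ f) (g' ∘ₗ g) :=
  (TensorProduct.AlgebraTensorModule.map_comp f' f g' g).symm

lemma X_ext {V W : Ch S} {f g : ν.X V →ₗ[S] ν.X W} (h : ∀ e b, f (e ⊗ₜ b) = g (e ⊗ₜ b)) : f = g :=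
  TensorProduct.AlgebraTensorModule.ext h

lemma dX_dX (V : Ch S) : ν.dX V ∘ₗ ν.dX V = 0 := by
  rw [dX, LinearMap.add_comp, LinearMap.comp_add, LinearMap.comp_add]
  simp only [act_comp, dTens_dTens, sgnTens_dTens, dB_dB, LinearMap.id_comp, LinearMap.comp_id]
  apply ν.X_ext
  intro e b
  simp [TensorProduct.neg_tmul]

lemma dX_genX (V : Ch S) : ν.dX V ∘ₗ ν.genX V = ν.genX V ∘ₗ ν.dX V := by
  rw [dX, genX, LinearMap.add_comp, LinearMap.comp_add]
  simp only [act_comp, dTens_rotTens, sgnTens_rotTens, dB_genB, LinearMap.id_comp,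
    LinearMap.comp_id]

lemma dX_degX (V : Ch S) (n : ℤ) : ν.degX V n ≤ (ν.degX V (n - 1)).comap (ν.dX V) := by
  refine Submodule.span_le.2 ?_
  rintro _ ⟨j, m, rfl, e, he, b, hb, rfl⟩
  simp only [SetLike.mem_coe, Submodule.mem_comap, dX, LinearMap.add_apply, act_tmul,
    LinearMap.id_apply]
  exact add_mem (Submodule.subset_span ⟨j - 1, m, by ring, _, dTens_deg j he, _, hb, rfl⟩)
    (Submodule.subset_span ⟨j, m - 1, by ring, _, sgnTens_deg j he, _, ν.dB_mem m hb, rfl⟩)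

lemma dX_filX (V : Ch S) (i n : ℤ) : ν.filX V i n ≤ (ν.filX V i (n - 1)).comap (ν.dX V) := by
  refine Submodule.span_le.2 ?_
  rintro _ ⟨j, m, rfl, hj, e, he, b, hb, rfl⟩
  simp only [SetLike.mem_coe, Submodule.mem_comap, dX, LinearMap.add_apply, act_tmul,
    LinearMap.id_apply]
  exact add_mem
    (Submodule.subset_span ⟨j - 1, m, by ring, by omega, _, dTens_deg j he, _, hb, rfl⟩)
    (Submodule.subset_span ⟨j, m - 1, by ring, hj, _, sgnTens_deg j he, _, ν.dB_mem m hb, rfl⟩)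

lemma dX_invX (V : Ch S) (n m : ℤ) (h : m + 1 = n) : ∀ x ∈ ν.invX V n, ν.dX V x ∈ ν.invX V m := by
  obtain rfl : m = n - 1 := by omega
  rintro x ⟨hx, hx'⟩
  refine ⟨ν.dX_degX V n hx, ?_⟩
  rw [SetLike.mem_coe, LinearMap.mem_ker, LinearMap.sub_apply, sub_eq_zero] at hx' ⊢
  have := congrArg (fun f => f x) (ν.dX_genX V)
  simp only [LinearMap.comp_apply, hx', LinearMap.id_apply] at this
  exact this.symm

/-- The Tate complex `(V^{⊗ p} ⊗ P̄ ⊗ I)^{ℤ/p}`. -/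
def tateCh (V : Ch S) : Ch S where
  X n := ModuleCat.of S (ν.invX V n)
  d n m := if h : m + 1 = n then ModuleCat.ofHom ((ν.dX V).restrict (ν.dX_invX V n m h)) else 0
  shape n m h := dif_neg h
  d_comp_d' n m l h h' := by
    rw [dif_pos (show m + 1 = n from h), dif_pos (show l + 1 = m from h')]
    apply ModuleCat.hom_ext
    refine LinearMap.ext fun x => Subtype.ext ?_
    exact congrArg (fun f => f x.1) (ν.dX_dX V)

lemma tateCh_d (V : Ch S) (n m : ℤ) (h : m + 1 = n) :
    (ν.tateCh V).d n m = ModuleCat.ofHom ((ν.dX V).restrict (ν.dX_invX V n m h)) :=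
  dif_pos h

/-- The Tate complex with its filtration. -/
def tateObj (V : Ch S) : FiltCh S where
  K := ν.tateCh V
  F i n := (ν.filX V i n).comap (ν.invX V n).subtype
  anti i j n h := by
    refine Submodule.comap_mono (Submodule.span_mono ?_)
    rintro _ ⟨k, m, hk, hj, e⟩
    refine ⟨k, m, hk, hj.trans ?_, e⟩
    have := mul_le_mul_of_nonneg_right h (Int.natCast_nonneg p)
    omega
  d_mem i n m x hx := by
    by_cases h : m + 1 = n
    · rw [Submodule.mem_comap, ν.tateCh_d V n m h]
      obtain rfl : m = n - 1 := by omega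
      exact ν.dX_filX V i n hx
    · have : (ν.tateCh V).d n m = 0 := (ν.tateCh V).shape n m h
      rw [Submodule.mem_comap, this]
      exact zero_mem _

/-- The map `f ⊗ 1` on `V^{⊗ p} ⊗ P̄ ⊗ I`. -/
def mapX {V W : Ch S} (f : TensHom p V W) : ν.X V →ₗ[S] ν.X W := ν.act f.toLin LinearMap.id

lemma mapX_dX {V W : Ch S} (f : TensHom p V W) :
    ν.mapX f ∘ₗ ν.dX V = ν.dX W ∘ₗ ν.mapX f := by
  rw [mapX, dX, dX, LinearMap.add_comp, LinearMap.comp_add]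
  simp only [act_comp, f.comm_d, f.comm_sgn, LinearMap.id_comp, LinearMap.comp_id]

lemma mapX_genX {V W : Ch S} (f : TensHom p V W) :
    ν.mapX f ∘ₗ ν.genX V = ν.genX W ∘ₗ ν.mapX f := by
  rw [mapX, genX, genX]
  simp only [act_comp, f.comm_rot, LinearMap.id_comp, LinearMap.comp_id]

lemma mapX_filX {V W : Ch S} (f : TensHom p V W) (i n : ℤ) :
    ν.filX V i n ≤ (ν.filX W i n).comap (ν.mapX f) := by
  refine Submodule.span_le.2 ?_
  rintro _ ⟨j, m, rfl, hj, e, he, b, hb, rfl⟩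
  exact Submodule.subset_span ⟨j, m, rfl, hj, _, f.deg j he, _, hb, rfl⟩

lemma mapX_invX {V W : Ch S} (f : TensHom p V W) (n : ℤ) :
    ∀ x ∈ ν.invX V n, ν.mapX f x ∈ ν.invX W n := by
  rintro x ⟨hx, hx'⟩
  constructor
  · revert x
    have : ν.degX V n ≤ (ν.degX W n).comap (ν.mapX f) := by
      refine Submodule.span_le.2 ?_
      rintro _ ⟨j, m, rfl, e, he, b, hb, rfl⟩
      exact Submodule.subset_span ⟨j, m, rfl, _, f.deg j he, _, hb, rfl⟩
    exact fun x hx _ => this hx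
  · rw [SetLike.mem_coe, LinearMap.mem_ker, LinearMap.sub_apply, sub_eq_zero] at hx' ⊢
    have := congrArg (fun f => f x) (ν.mapX_genX f)
    simp only [LinearMap.comp_apply, hx', LinearMap.id_apply] at this
    exact this.symm

/-- The map of Tate complexes induced by a map of tensor powers. -/
def tateMap {V W : Ch S} (f : TensHom p V W) : ν.tateObj V ⟶ ν.tateObj W where
  f :=
    { f := fun n => ModuleCat.ofHom ((ν.mapX f).restrict (ν.mapX_invX f n))
      comm' := fun n m h => by
        change _ ≫ (ν.tateCh W).d n m = (ν.tateCh V).d n m ≫ _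
        rw [ν.tateCh_d V n m h, ν.tateCh_d W n m h]
        apply ModuleCat.hom_ext
        refine LinearMap.ext fun x => Subtype.ext ?_
        exact congrArg (fun f => f x.1) (ν.mapX_dX f).symm }
  mem i n x hx := ν.mapX_filX f i n hx

lemma tateMap_id (V : Ch S) : ν.tateMap (TensHom.id p V) = 𝟙 (ν.tateObj V) := by
  apply FiltCh.hom_ext
  apply HomologicalComplex.hom_ext
  intro n
  apply ModuleCat.hom_ext
  refine LinearMap.ext fun x => Subtype.ext ?_
  exact congrArg (fun f => f x.1) (TensorProduct.AlgebraTensorModule.map_id (R := ℤ) (A := S))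

lemma tateMap_comp {V W U : Ch S} (f : TensHom p V W) (g : TensHom p W U) :
    ν.tateMap (f.comp g) = ν.tateMap f ≫ ν.tateMap g := by
  apply FiltCh.hom_ext
  apply HomologicalComplex.hom_ext
  intro n
  apply ModuleCat.hom_ext
  refine LinearMap.ext fun x => Subtype.ext ?_
  exact congrArg (fun f => f x.1) (ν.act_comp f.toLin LinearMap.id g.toLin LinearMap.id).symm

lemma tateMap_comp_zero {V W U : Ch S} (f : TensHom p V W) (g : TensHom p W U)
    (h : g.toLin ∘ₗ f.toLin = 0) : (ν.tateMap f ≫ ν.tateMap g).f = 0 := by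
  apply HomologicalComplex.hom_ext
  intro n
  apply ModuleCat.hom_ext
  refine LinearMap.ext fun x => Subtype.ext ?_
  have e : ν.mapX g ∘ₗ ν.mapX f = 0 := by
    rw [mapX, mapX, act_comp, h]
    exact ν.X_ext fun e b => by simp
  exact congrArg (fun f => f x.1) e

end Tate

/-- The complex `C(V) = τ^F_{[0,1]} (V^{⊗ p} ⊗ P̄ ⊗ I)^{ℤ/p}` with its filtration. -/
def C {p : ℕ} (ν : MulResolutionData.{u} p) {S : Type u} [CommRing S] (V : Ch S) : FiltCh S :=
  (FiltCh.trunc01 S).obj (ν.tateObj V)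

/-- The map of complexes `C(V)` induced by a map of tensor powers. -/
def CMap {p : ℕ} (ν : MulResolutionData.{u} p) {S : Type u} [CommRing S] {V W : Ch S}
    (f : TensHom p V W) : ν.C V ⟶ ν.C W :=
  (FiltCh.trunc01 S).map (ν.tateMap f)

section
variable {p : ℕ} (ν : MulResolutionData.{u} p) {S : Type u} [CommRing S]

lemma CMap_id (V : Ch S) : ν.CMap (TensHom.id p V) = 𝟙 (ν.C V) := by
  rw [CMap, tateMap_id, CategoryTheory.Functor.map_id]
  rfl

lemma CMap_comp {V W U : Ch S} (f : TensHom p V W) (g : TensHom p W U) :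
    ν.CMap (f.comp g) = ν.CMap f ≫ ν.CMap g := by
  rw [CMap, tateMap_comp, Functor.map_comp]
  rfl

lemma CMap_comp_zero {V W U : Ch S} (f : TensHom p V W) (g : TensHom p W U)
    (h : g.toLin ∘ₗ f.toLin = 0) : (ν.CMap f ≫ ν.CMap g).f = 0 := by
  have e := ν.tateMap_comp_zero f g h
  apply HomologicalComplex.hom_ext
  intro n
  apply ModuleCat.hom_ext
  refine LinearMap.ext fun x => Subtype.ext ?_
  obtain ⟨x, hx⟩ := x
  induction x using Submodule.Quotient.induction_on with
  | _ y =>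
    have e' := congrArg (fun f => (f.f n).hom y) e
    exact (congrArg (Submodule.Quotient.mk) e').trans (Submodule.Quotient.mk_zero _)

end

end MulResolutionData

/-! ### Reduction modulo `p` for complexes over `W_2(R)` -/

section Witt
variable (p : ℕ) [Fact p.Prime] (R : Type u) [CommRing R]

/-- The ring `W_2(R)` of Witt vectors of length two. -/
abbrev W2 : Type u := TruncatedWittVector p 2 R

/-- The projection `W_2(R) → R`. -/
def resid : W2 p R →+* R where
  toFun x := x.coeff 0
  map_one' := by
    rw [← map_one (WittVector.truncate 2 : WittVector p R →+* _), WittVector.coeff_truncate]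
    exact WittVector.one_coeff_zero p R
  map_mul' x y := by
    obtain ⟨a, rfl⟩ := WittVector.truncate_surjective p 2 R x
    obtain ⟨b, rfl⟩ := WittVector.truncate_surjective p 2 R y
    rw [← map_mul, WittVector.coeff_truncate, WittVector.coeff_truncate,
      WittVector.coeff_truncate]
    exact WittVector.mul_coeff_zero a b
  map_zero' := TruncatedWittVector.coeff_zero p 2 R 0
  map_add' x y := by
    obtain ⟨a, rfl⟩ := WittVector.truncate_surjective p 2 R x
    obtain ⟨b, rfl⟩ := WittVector.truncate_surjective p 2 R y
    rw [← map_add, WittVector.coeff_truncate, WittVector.coeff_truncate,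
      WittVector.coeff_truncate]
    exact WittVector.add_coeff_zero a b

lemma resid_surjective : Function.Surjective (resid p R) := fun x =>
  ⟨TruncatedWittVector.mk p fun _ => x, TruncatedWittVector.coeff_mk (p := p) (fun _ : Fin 2 => x) 0⟩

lemma p_mul_eq_zero [CharP R p] (x : W2 p R) (hx : resid p R x = 0) : x * (p : W2 p R) = 0 := by
  obtain ⟨a, rfl⟩ := WittVector.truncate_surjective p 2 R x
  have h0 : a.coeff 0 = 0 := (WittVector.coeff_truncate a 0).symm.trans hx
  rw [← map_natCast (WittVector.truncate 2 : WittVector p R →+* _), ← map_mul]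
  apply TruncatedWittVector.ext
  intro i
  rw [WittVector.coeff_truncate, TruncatedWittVector.coeff_zero]
  fin_cases i
  · exact WittVector.mul_charP_coeff_zero a
  · refine (WittVector.mul_charP_coeff_succ a 0).trans ?_
    rw [h0, zero_pow (Fact.out : p.Prime).ne_zero]

/-- The map `R → W_2(R)` sending the residue of `x` to `p x`. -/
def mulP (r : R) : W2 p R := TruncatedWittVector.mk p (fun _ => r) * (p : W2 p R)

lemma mulP_resid [CharP R p] {r : R} (x : W2 p R) (hx : resid p R x = r) :
    mulP p R r = x * (p : W2 p R) := by
  rw [mulP, ← sub_eq_zero, ← sub_mul]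
  apply p_mul_eq_zero
  rw [map_sub, hx, sub_eq_zero]
  exact TruncatedWittVector.coeff_mk (p := p) (fun _ : Fin 2 => r) 0

/-- The map `V/p → V` induced by multiplication by `p`. -/
def timesP [CharP R p] (V : ModuleCat.{u} (W2 p R)) :
    ((ModuleCat.restrictScalars (resid p R)).obj (ModuleCat.of R R)) ⊗[W2 p R] V →ₗ[W2 p R] V :=
  TensorProduct.lift
    { toFun := fun r => mulP p R r • LinearMap.id
      map_add' := fun r s => by
        obtain ⟨x, hx⟩ := resid_surjective p R r
        obtain ⟨y, hy⟩ := resid_surjective p R s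
        refine (congrArg (· • LinearMap.id) (?_ : _ = mulP p R r + mulP p R s)).trans
          (add_smul _ _ _)
        rw [mulP_resid p R x hx, mulP_resid p R y hy, ← add_mul]
        exact mulP_resid p R (x + y) (by rw [map_add, hx, hy]; rfl)
      map_smul' := fun c r => by
        obtain ⟨x, hx⟩ := resid_surjective p R r
        refine (congrArg (· • LinearMap.id) (?_ : _ = c * mulP p R r)).trans (mul_smul _ _ _)
        rw [mulP_resid p R x hx, ← mul_assoc]
        exact mulP_resid p R (c * x) (by rw [map_mul, hx]; rfl) }

instance : (ModuleCat.extendScalars.{u, u, u} (resid p R)).Additive :=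
  (ModuleCat.extendRestrictScalarsAdj (resid p R)).left_adjoint_additive

/-- `V ↦ V/p = R ⊗ V`, from complexes over `W_2(R)` to complexes over `R`. -/
def qUp : Ch (W2 p R) ⥤ Ch R :=
  (ModuleCat.extendScalars.{u, u, u} (resid p R)).mapHomologicalComplex _

/-- Complexes over `R` considered as complexes over `W_2(R)`. -/
def qLow : Ch R ⥤ Ch (W2 p R) :=
  (ModuleCat.restrictScalars.{u, u, u} (resid p R)).mapHomologicalComplex _

/-- The quotient map `V → V/p`. -/
def toQuot : 𝟭 (Ch (W2 p R)) ⟶ qUp p R ⋙ qLow p R where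
  app V :=
    { f := fun n => (ModuleCat.extendRestrictScalarsAdj (resid p R)).unit.app (V.X n)
      comm' := fun n m _ =>
        ((ModuleCat.extendRestrictScalarsAdj (resid p R)).unit.naturality (V.d n m)).symm }
  naturality V W f := by
    apply HomologicalComplex.hom_ext
    intro n
    exact (ModuleCat.extendRestrictScalarsAdj (resid p R)).unit.naturality (f.f n)

lemma toQuot_surj (V : Ch (W2 p R)) (n : ℤ) :
    Function.Surjective (((toQuot p R).app V).f n).hom := by
  intro z
  refine TensorProduct.induction_on
    (motive := fun z => ∃ v, (((toQuot p R).app V).f n).hom v = z) z ?_ ?_ ?_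
  · exact ⟨0, map_zero _⟩
  · intro r v
    obtain ⟨s, rfl⟩ := resid_surjective p R r
    refine ⟨s • v, ?_⟩
    let o : (ModuleCat.restrictScalars (resid p R)).obj (ModuleCat.of R R) := (1 : R)
    refine (TensorProduct.smul_tmul (R := W2 p R) s o v).symm.trans ?_
    exact congrArg (fun t : (ModuleCat.restrictScalars (resid p R)).obj (ModuleCat.of R R) =>
      t ⊗ₜ[W2 p R] v) (mul_one (resid p R s))
  · rintro _ _ ⟨v, rfl⟩ ⟨w, rfl⟩
    exact ⟨v + w, map_add _ _ _⟩

lemma qLow_kill [CharP R p] (W : Ch R) (n : ℤ) (w : ((qLow p R).obj W).X n) :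
    (p : W2 p R) • w = 0 := by
  change resid p R (p : W2 p R) • (show W.X n from w) = 0
  rw [map_natCast, CharP.cast_eq_zero, zero_smul]

lemma toQuot_isPQuot [CharP R p] (V : Ch (W2 p R)) : IsPQuot p ((toQuot p R).app V) where
  surj := toQuot_surj p R V
  ker n v hv := by
    have e : timesP p R (V.X n) ((((toQuot p R).app V).f n).hom v) = (p : W2 p R) • v := by
      refine (TensorProduct.lift.tmul _ _).trans ?_
      change mulP p R 1 • v = _
      rw [mulP_resid p R 1 (map_one _), one_mul]
    rw [← e, hv]
    exact map_zero (timesP p R (V.X n))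

end Witt

/-! ### The splittings -/

namespace MulResolutionData

/-- The functor `V ↦ C(V)` on complexes of `S`-modules. -/
def cyc {p : ℕ} (ν : MulResolutionData.{u} p) (S : Type u) [CommRing S] : Ch S ⥤ Ch S where
  obj V := (ν.C V).K
  map f := (ν.CMap (TensHom.ofMap p f)).f
  map_id V := by rw [TensHom.ofMap_id, CMap_id]; rfl
  map_comp f g := by rw [TensHom.ofMap_comp, CMap_comp]; rfl

section Splittings
variable {p : ℕ} [Fact p.Prime] (ν : MulResolutionData.{u} p) (R : Type u) [CommRing R]

/-- The functor `W ↦ C(W)` from complexes over `R` to complexes over `W_2(R)`.  As `W_2(R) → R` is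
surjective, tensor products over `R` and over `W_2(R)` coincide for `R`-modules. -/
def cycR : Ch R ⥤ Ch (W2 p R) := qLow p R ⋙ ν.cyc (W2 p R)

/-- `V/p` as a complex over `W_2(R)`. -/
abbrev modp (V : Ch (W2 p R)) : Ch (W2 p R) := (qLow p R).obj ((qUp p R).obj V)

/-- The map `q : C(V) → C(V/p)` induced by the quotient map. -/
def qMap (V : Ch (W2 p R)) : ν.C V ⟶ ν.C (modp R V) :=
  ν.CMap (TensHom.ofMap p ((toQuot p R).app V))

lemma qMap_natural {V V' : Ch (W2 p R)} (f : V ⟶ V') :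
    ν.CMap (TensHom.ofMap p f) ≫ ν.qMap R V' =
      ν.qMap R V ≫ ν.CMap (TensHom.ofMap p ((qLow p R).map ((qUp p R).map f))) := by
  rw [qMap, qMap, ← CMap_comp, ← CMap_comp, ← TensHom.ofMap_comp, ← TensHom.ofMap_comp]
  exact congrArg (fun g => ν.CMap (TensHom.ofMap p g)) ((toQuot p R).naturality f)

/-- The degree `i` term of `C^r(V) ⊆ C(V)`: the kernel of the composition of `q : C(V) → C(V/p)` and
the projection `C(V/p) → C̄^l(V/p) = C(V/p) / τ^F_{≥ 1} C(V/p)`. -/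
def crSub (V : Ch (W2 p R)) (i : ℤ) : Submodule (W2 p R) ((ν.C V).K.X i) :=
  ((ν.C (modp R V)).geSub 1 i).comap ((ν.qMap R V).f.f i).hom

lemma crSub_d (V : Ch (W2 p R)) (i j : ℤ) :
    ν.crSub R V i ≤ (ν.crSub R V j).comap ((ν.C V).K.d i j).hom := by
  intro x hx
  have e : ((ν.qMap R V).f.f j).hom (((ν.C V).K.d i j).hom x) =
      ((ν.C (modp R V)).K.d i j).hom (((ν.qMap R V).f.f i).hom x) :=
    congrArg (fun g => g.hom x) ((ν.qMap R V).f.comm i j).symm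
  rw [crSub, Submodule.mem_comap, Submodule.mem_comap, e]
  exact (ν.C (modp R V)).geSub_d 1 i j hx

lemma crSub_map {V V' : Ch (W2 p R)} (f : V ⟶ V') (i : ℤ) :
    ν.crSub R V i ≤ (ν.crSub R V' i).comap (((ν.cyc (W2 p R)).map f).f i).hom := by
  intro x hx
  have e := congrArg (fun g => (g.f.f i).hom x) (ν.qMap_natural R f)
  refine (congrArg (· ∈ (ν.C (modp R V')).geSub 1 i) e).mpr ?_
  exact FiltCh.geSub_map (ν.CMap (TensHom.ofMap p ((qLow p R).map ((qUp p R).map f)))) 1 i hx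

/-- The functor `V ↦ C^r(V)`. -/
def cr : Ch (W2 p R) ⥤ Ch (W2 p R) where
  obj V := subCh (ν.C V).K (ν.crSub R V) (ν.crSub_d R V)
  map f := subChMap ((ν.cyc (W2 p R)).map f) (ν.crSub_map R f)
  map_id V := by
    apply HomologicalComplex.hom_ext
    intro n
    apply ModuleCat.hom_ext
    refine LinearMap.ext fun x => Subtype.ext ?_
    exact congrArg (fun g => (g.f n).hom x.1) ((ν.cyc (W2 p R)).map_id V)
  map_comp f g := by
    apply HomologicalComplex.hom_ext
    intro n
    apply ModuleCat.hom_ext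
    refine LinearMap.ext fun x => Subtype.ext ?_
    exact congrArg (fun g => (g.f n).hom x.1) ((ν.cyc (W2 p R)).map_comp f g)

variable [CharP R p]

/-- The map `p : C(V/p) → C(V)` induced by multiplication by `p`, `V^{⊗ p}/p → V^{⊗ p}`. -/
def pMap (V : Ch (W2 p R)) : ν.C (modp R V) ⟶ ν.C V :=
  ν.CMap (toQuot_isPQuot p R V).pHom

lemma pMap_natural {V V' : Ch (W2 p R)} (f : V ⟶ V') :
    ν.CMap (TensHom.ofMap p ((qLow p R).map ((qUp p R).map f))) ≫ ν.pMap R V' =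
      ν.pMap R V ≫ ν.CMap (TensHom.ofMap p f) := by
  rw [pMap, pMap, ← CMap_comp, ← CMap_comp]
  exact congrArg (fun g => ν.CMap g) ((toQuot_isPQuot p R V).pHom_natural
    (toQuot_isPQuot p R V') f _ ((toQuot p R).naturality f).symm)

lemma pMap_qMap (V : Ch (W2 p R)) : (ν.pMap R V ≫ ν.qMap R V).f = 0 :=
  ν.CMap_comp_zero _ _ ((toQuot_isPQuot p R V).pHom_comp_ofMap (qLow_kill p R _)
    (Fact.out : p.Prime).pos)

/-- The degree `i` term of `p (C̄^r(V/p)) ⊆ C(V)`, where `C̄^r(V/p)` is the kernel of the projection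
`C(V/p) → τ^F_{≤ 0} C(V/p)`. -/
def clSub (V : Ch (W2 p R)) (i : ℤ) : Submodule (W2 p R) ((ν.C V).K.X i) :=
  ((ν.C (modp R V)).leSub 0 i).map ((ν.pMap R V).f.f i).hom

lemma clSub_d (V : Ch (W2 p R)) (i j : ℤ) :
    ν.clSub R V i ≤ (ν.clSub R V j).comap ((ν.C V).K.d i j).hom := by
  rintro _ ⟨x, hx, rfl⟩
  have e : ((ν.pMap R V).f.f j).hom (((ν.C (modp R V)).K.d i j).hom x) =
      ((ν.C V).K.d i j).hom (((ν.pMap R V).f.f i).hom x) :=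
    congrArg (fun g => g.hom x) ((ν.pMap R V).f.comm i j).symm
  rw [clSub, Submodule.mem_comap, ← e]
  exact ⟨_, (ν.C (modp R V)).leSub_d 0 i j hx, rfl⟩

lemma clSub_map {V V' : Ch (W2 p R)} (f : V ⟶ V') (i : ℤ) :
    ν.clSub R V i ≤ (ν.clSub R V' i).comap (((ν.cyc (W2 p R)).map f).f i).hom := by
  rintro _ ⟨x, hx, rfl⟩
  have e := congrArg (fun g => (g.f.f i).hom x) (ν.pMap_natural R f)
  exact ⟨_, FiltCh.leSub_map (ν.CMap (TensHom.ofMap p ((qLow p R).map ((qUp p R).map f)))) 0 i hx,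
    e⟩

/-- The functor `V ↦ C^l(V) = C(V) / p (C̄^r(V/p))`. -/
def cl : Ch (W2 p R) ⥤ Ch (W2 p R) where
  obj V := quotCh (ν.C V).K (ν.clSub R V) (ν.clSub_d R V)
  map f := quotChMap ((ν.cyc (W2 p R)).map f) (ν.clSub_map R f)
  map_id V := by
    apply HomologicalComplex.hom_ext
    intro n
    apply ModuleCat.hom_ext
    apply Submodule.linearMap_qext
    refine LinearMap.ext fun x => ?_
    exact congrArg (fun g => (ν.clSub R V n).mkQ ((g.f n).hom x)) ((ν.cyc (W2 p R)).map_id V)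
  map_comp {_ _ V''} f g := by
    apply HomologicalComplex.hom_ext
    intro n
    apply ModuleCat.hom_ext
    apply Submodule.linearMap_qext
    refine LinearMap.ext fun x => ?_
    exact congrArg (fun g => (ν.clSub R V'' n).mkQ ((g.f n).hom x)) ((ν.cyc (W2 p R)).map_comp f g)

/-- The projection `C^l(V) → C(V/p)` induced by `q : C(V) → C(V/p)`. -/
def clTo : ν.cl R ⟶ qUp p R ⋙ ν.cycR R where
  app V :=
    { f := fun n => ModuleCat.ofHom ((ν.clSub R V n).liftQ ((ν.qMap R V).f.f n).hom (by
        rintro _ ⟨x, _, rfl⟩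
        exact congrArg (fun g => (g.f n).hom x) (ν.pMap_qMap R V)))
      comm' := fun n m _ => by
        apply ModuleCat.hom_ext
        apply Submodule.linearMap_qext
        refine LinearMap.ext fun x => ?_
        exact congrArg (fun g => g.hom x) ((ν.qMap R V).f.comm n m) }
  naturality V V' f := by
    apply HomologicalComplex.hom_ext
    intro n
    apply ModuleCat.hom_ext
    apply Submodule.linearMap_qext
    refine LinearMap.ext fun x => ?_
    exact congrArg (fun g => (g.f.f n).hom x) (ν.qMap_natural R f)

/-- The embedding `C(V/p) → C^r(V)` induced by `p : C(V/p) → C(V)`. -/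
def toCr : qUp p R ⋙ ν.cycR R ⟶ ν.cr R where
  app V :=
    { f := fun n => ModuleCat.ofHom (((ν.pMap R V).f.f n).hom.codRestrict (ν.crSub R V n)
        fun x => by
          have e := congrArg (fun g => (g.f n).hom x) (ν.pMap_qMap R V)
          exact (congrArg (· ∈ (ν.C (modp R V)).geSub 1 n) e).mpr (zero_mem _))
      comm' := fun n m _ => by
        apply ModuleCat.hom_ext
        refine LinearMap.ext fun x => Subtype.ext ?_
        exact congrArg (fun g => g.hom x) ((ν.pMap R V).f.comm n m) }
  naturality V V' f := by
    apply HomologicalComplex.hom_ext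
    intro n
    apply ModuleCat.hom_ext
    refine LinearMap.ext fun x => Subtype.ext ?_
    exact congrArg (fun g => (g.f.f n).hom x) (ν.pMap_natural R f)

end Splittings

end MulResolutionData

/-! ### Perfect complexes -/

/-- Bounded complexes of finitely generated projective modules. -/
def isPf (S : Type u) [CommRing S] : ObjectProperty (Ch S) := fun K =>
  (∀ n, Module.Finite S (K.X n) ∧ Module.Projective S (K.X n)) ∧
    ∃ N : ℤ, ∀ n, N < |n| → Subsingleton (K.X n)

/-- The category `C^{pf}(S)` of bounded complexes of finitely generated projective `S`-modules and
maps of complexes. -/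
abbrev Cpf (S : Type u) [CommRing S] := (isPf S).FullSubcategory

/-- The functor `q^* : C^{pf}(W_2(R)) → C^{pf}(R)`, `V ↦ V/p`. -/
def qPull (p : ℕ) [Fact p.Prime] (R : Type u) [CommRing R] : Cpf (W2 p R) ⥤ Cpf R :=
  (isPf R).lift ((isPf (W2 p R)).ι ⋙ qUp p R) fun V => by
    let : Algebra (W2 p R) R := (resid p R).toAlgebra
    obtain ⟨h, N, hN⟩ := V.property
    refine ⟨fun n => ?_, N, fun n hn => ?_⟩
    · obtain ⟨h1, h2⟩ := h n
      exact ⟨Module.Finite.base_change (W2 p R) R (V.obj.X n),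
        inferInstanceAs (Module.Projective R (R ⊗[W2 p R] V.obj.X n))⟩
    · have := hN n hn
      exact inferInstanceAs (Subsingleton (R ⊗[W2 p R] V.obj.X n))

namespace MulResolutionData

section
variable {p : ℕ} [Fact p.Prime] (ν : MulResolutionData.{u} p) (R : Type u) [CommRing R] [CharP R p]

/-- The functor `C : C^{pf}(R) → C(W_2(R))`. -/
def pfC : Cpf R ⥤ Ch (W2 p R) := (isPf R).ι ⋙ ν.cycR R

/-- The functor `C^l : C^{pf}(W_2(R)) → C(W_2(R))`. -/
def pfCl : Cpf (W2 p R) ⥤ Ch (W2 p R) := (isPf (W2 p R)).ι ⋙ ν.cl R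

/-- The functor `C^r : C^{pf}(W_2(R)) → C(W_2(R))`. -/
def pfCr : Cpf (W2 p R) ⥤ Ch (W2 p R) := (isPf (W2 p R)).ι ⋙ ν.cr R

/-- The structure map `l : C^l(V) → C(V/p)` of the left splitting. -/
def pfL : ν.pfCl R ⟶ qPull p R ⋙ ν.pfC R :=
  Functor.whiskerLeft (isPf (W2 p R)).ι (ν.clTo R)

/-- The structure map `r : C(V/p) → C^r(V)` of the right splitting. -/
def pfR : qPull p R ⋙ ν.pfC R ⟶ ν.pfCr R :=
  Functor.whiskerLeft (isPf (W2 p R)).ι (ν.toCr R)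

end

end MulResolutionData

end CyclicPowers

end

/-!
Write `f : V/p → V'/p` for a map of complexes. A graded lift `a : V → V'` of `f` need not be a chain
map, but `d a - a d = p b` for some `b`. Pick `u` of degree `1` in the acyclic algebra `P̄` with
`d u = 1`, and let `h_t` be left multiplication by the translate `g^t u`; each `h_t` is a
contracting homotopy. Then

  `a^{⊗ p} ⊗ 1 - p ∑_t (a ⊗ ⋯ ⊗ b ⊗ ⋯ ⊗ a) ⊗ h_t`   (`b` in the `t`-th slot, up to signs)

is a filtered chain map, equivariant because the sum runs over a full `ℤ/p`-orbit. Replacing `a` by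
`a + p c` changes it by `p` times the homotopy given by the same sum with `c` in place of `b`. Such
multiples of `p` vanish on `C^l`, where `p C̄^r` has been divided out, and dually on `C^r`. So `C^l`
and `C^r` are functors of maps `V/p → V'/p`.

It remains that `q^*` is essentially surjective: a complex over a field has bases which `d` maps to
basis vectors or to zero, and the complex with the same matrices over `W_2(R)` lifts it.
-/

noncomputable section

namespace CyclicPowers

section Multilinear
variable {S ι N : Type*} {M : ι → Type*} [CommRing S] [∀ i, AddCommGroup (M i)]
  [∀ i, Module S (M i)] [AddCommGroup N] [Module S N]

lemma smul_multilinearMap_congr [Finite ι] (m : MultilinearMap S M N) (c : S) {f g : ∀ i, M i}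
    (h : ∀ i, c • f i = c • g i) : c • m f = c • m g := by
  classical
  cases nonempty_fintype ι
  have smul_piecewise (s : Finset ι) : c • m (s.piecewise g f) = c • m f := by
    induction s using Finset.induction_on with
    | empty => rw [Finset.piecewise_empty]
    | insert i s hi ih =>
      rw [Finset.piecewise_insert, ← MultilinearMap.map_update_smul, ← h,
        ← Finset.piecewise_eq_of_notMem s g f hi, MultilinearMap.map_update_smul,
        Function.update_eq_self, ih]
  rw [← smul_piecewise Finset.univ, Finset.piecewise_univ]

lemma multilinearMap_add_smul [Fintype ι] [DecidableEq ι] (m : MultilinearMap S M N) {c : S}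
    (hc : c * c = 0) (f g : ∀ i, M i) :
    m (f + c • g) = m f + c • ∑ i, m (Function.update f i (g i)) := by
  have map_piecewise (s : Finset ι) : m (s.piecewise (f + c • g) f) =
      m f + c • ∑ i ∈ s, m (Function.update f i (g i)) := by
    induction s using Finset.induction_on with
    | empty => simp
    | insert i s hi ih =>
      have hfi := Finset.piecewise_eq_of_notMem s (f + c • g) f hi
      rw [Finset.piecewise_insert, Pi.add_apply, MultilinearMap.map_update_add, ← hfi,
        Function.update_eq_self, ih, Finset.sum_insert hi, smul_add, add_assoc,
        add_comm (c • m _), Pi.smul_apply, MultilinearMap.map_update_smul]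
      congr 2
      refine smul_multilinearMap_congr m c fun j => ?_
      by_cases hj : j = i
      · subst hj; simp
      · by_cases hjs : j ∈ s <;> simp [hj, hjs, smul_smul, hc]
  rw [← map_piecewise Finset.univ, Finset.piecewise_univ]

end Multilinear

section GradedMaps
variable {S : Type u} [CommRing S] {V W U : Ch S}

/-- A linear map of total modules that is homogeneous of degree `k`; it need not be a chain map. -/
def HasDeg (k : ℤ) (f : Tot V →ₗ[S] Tot W) : Prop :=
  ∀ n (v : V.X n), ∃ w, inc W (n + k) w = f (inc V n v)

lemma HasDeg.comp {k l m : ℤ} {g : Tot W →ₗ[S] Tot U} {f : Tot V →ₗ[S] Tot W}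
    (hg : HasDeg l g) (hf : HasDeg k f) (h : k + l = m) : HasDeg m (g ∘ₗ f) := by
  intro n v
  obtain ⟨w, hw⟩ := hf n v
  rw [LinearMap.comp_apply, ← hw]
  exact inc_congr (by omega) (hg (n + k) w)

lemma HasDeg.comp_zero {k : ℤ} {g : Tot W →ₗ[S] Tot U} {f : Tot V →ₗ[S] Tot W}
    (hg : HasDeg k g) (hf : HasDeg 0 f) : HasDeg k (g ∘ₗ f) := hg.comp hf (zero_add k)

lemma HasDeg.zero_comp {k : ℤ} {g : Tot W →ₗ[S] Tot U} {f : Tot V →ₗ[S] Tot W}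
    (hg : HasDeg 0 g) (hf : HasDeg k f) : HasDeg k (g ∘ₗ f) := hg.comp hf (add_zero k)

lemma HasDeg.zero (k : ℤ) : HasDeg k (0 : Tot V →ₗ[S] Tot W) := fun _ _ => ⟨0, by simp⟩

lemma HasDeg.add {k : ℤ} {f g : Tot V →ₗ[S] Tot W} (hf : HasDeg k f) (hg : HasDeg k g) :
    HasDeg k (f + g) := by
  intro n v
  obtain ⟨x, hx⟩ := hf n v
  obtain ⟨y, hy⟩ := hg n v
  exact ⟨x + y, by rw [map_add, hx, hy, LinearMap.add_apply]⟩

lemma HasDeg.sub {k : ℤ} {f g : Tot V →ₗ[S] Tot W} (hf : HasDeg k f) (hg : HasDeg k g) :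
    HasDeg k (f - g) := by
  intro n v
  obtain ⟨x, hx⟩ := hf n v
  obtain ⟨y, hy⟩ := hg n v
  exact ⟨x - y, by rw [map_sub, hx, hy, LinearMap.sub_apply]⟩

lemma hasDeg_mapTot (f : V ⟶ W) : HasDeg 0 (mapTot f) :=
  fun n v => inc_congr (add_zero n) ⟨_, (mapTot_inc f n v).symm⟩

lemma hasDeg_sgnTot : HasDeg 0 (sgnTot V) := fun n v =>
  inc_congr (add_zero n) (sgnTot_inc_mem n v)

lemma hasDeg_dTot : HasDeg (-1) (dTot V) := fun n v => ⟨_, (dTot_inc V n v).symm⟩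

lemma tot_apply_ext {M : Type*} [AddCommMonoid M] [Module S M] {f g : Tot V →ₗ[S] M}
    (h : ∀ n (v : V.X n), f (inc V n v) = g (inc V n v)) (x : Tot V) : f x = g x :=
  congrArg (fun f => f x) (tot_ext V h)

/-- Linear maps of total modules that preserve the parity of degrees. -/
structure PreservesParity (f : Tot V →ₗ[S] Tot W) : Prop where
  evenTot_apply (x : Tot V) : evenTot W (f x) = f (evenTot V x)
  oddTot_apply (x : Tot V) : oddTot W (f x) = f (oddTot V x)

/-- Linear maps of total modules that exchange even and odd degrees. -/
structure ReversesParity (f : Tot V →ₗ[S] Tot W) : Prop where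
  evenTot_apply (x : Tot V) : evenTot W (f x) = f (oddTot V x)
  oddTot_apply (x : Tot V) : oddTot W (f x) = f (evenTot V x)

lemma HasDeg.preservesParity {k : ℤ} {f : Tot V →ₗ[S] Tot W} (hf : HasDeg k f) (hk : Even k) :
    PreservesParity f where
  evenTot_apply := tot_apply_ext (f := evenTot W ∘ₗ f) (g := f ∘ₗ evenTot V) fun n v => by
    obtain ⟨w, hw⟩ := hf n v
    by_cases hn : Even n <;> simp [hn, ← hw, Int.even_add, hk]
  oddTot_apply := tot_apply_ext (f := oddTot W ∘ₗ f) (g := f ∘ₗ oddTot V) fun n v => by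
    obtain ⟨w, hw⟩ := hf n v
    by_cases hn : Even n <;> simp [hn, ← hw, Int.even_add, hk]

lemma HasDeg.reversesParity {k : ℤ} {f : Tot V →ₗ[S] Tot W} (hf : HasDeg k f) (hk : Odd k) :
    ReversesParity f where
  evenTot_apply := tot_apply_ext (f := evenTot W ∘ₗ f) (g := f ∘ₗ oddTot V) fun n v => by
    obtain ⟨w, hw⟩ := hf n v
    by_cases hn : Even n <;> simp [hn, ← hw, Int.even_add, Int.not_even_iff_odd.2 hk]
  oddTot_apply := tot_apply_ext (f := oddTot W ∘ₗ f) (g := f ∘ₗ evenTot V) fun n v => by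
    obtain ⟨w, hw⟩ := hf n v
    by_cases hn : Even n <;> simp [hn, ← hw, Int.even_add, Int.not_even_iff_odd.2 hk]

lemma sgnTot_apply_eq (x : Tot V) : sgnTot V x = evenTot V x - oddTot V x :=
  tot_apply_ext (g := evenTot V - oddTot V)
    (fun n v => by by_cases hn : Even n <;> simp [hn]) x

lemma PreservesParity.sgnTot_apply {f : Tot V →ₗ[S] Tot W} (hf : PreservesParity f) (x : Tot V) :
    sgnTot W (f x) = f (sgnTot V x) := by
  rw [sgnTot_apply_eq, sgnTot_apply_eq, hf.evenTot_apply, hf.oddTot_apply, map_sub]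

lemma ReversesParity.sgnTot_apply {f : Tot V →ₗ[S] Tot W} (hf : ReversesParity f) (x : Tot V) :
    sgnTot W (f x) = -f (sgnTot V x) := by
  rw [sgnTot_apply_eq, sgnTot_apply_eq, hf.evenTot_apply, hf.oddTot_apply, map_sub, neg_sub]

lemma reversesParity_dTot : ReversesParity (dTot V) :=
  hasDeg_dTot.reversesParity (by decide)

@[simp] lemma sgnTot_sgnTot_apply (x : Tot V) : sgnTot V (sgnTot V x) = x :=
  congrArg (fun f => f x) (sgnTot_sgnTot V)

lemma sgnTot_evenTot_apply (x : Tot V) : sgnTot V (evenTot V x) = evenTot V x :=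
  congrArg (fun f => f x) (sgnTot_evenTot V)

lemma sgnTot_oddTot_apply (x : Tot V) : sgnTot V (oddTot V x) = -oddTot V x :=
  congrArg (fun f => f x) (sgnTot_oddTot V)

end GradedMaps

section TensorMaps
variable {p : ℕ} {S : Type u} [CommRing S] {V W U : Ch S}

/-- `f ↦ f_0 ⊗ ⋯ ⊗ f_{p-1}` as a multilinear map, which makes the general lemmas on multilinear
maps available for `mapTens`. -/
def mapTensMultilinear (p : ℕ) (V W : Ch S) :
    MultilinearMap S (fun _ : Fin p => Tot V →ₗ[S] Tot W) (TensPow p V →ₗ[S] TensPow p W) :=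
  PiTensorProduct.mapMultilinear S (fun _ => Tot V) (fun _ => Tot W)

lemma mapTens_congr {f g : Fin p → Tot V →ₗ[S] Tot W} (h : ∀ s x, f s x = g s x) :
    mapTens p f = mapTens p g :=
  congrArg (mapTens p) (funext fun s => LinearMap.ext (h s))

lemma smul_mapTens_congr (c : S) {f g : Fin p → Tot V →ₗ[S] Tot W}
    (h : ∀ s x, c • f s x = c • g s x) : c • mapTens p f = c • mapTens p g :=
  smul_multilinearMap_congr (mapTensMultilinear p V W) c fun s => LinearMap.ext (h s)

lemma smul_mapTens_eq_neg (c : S) {f g : Fin p → Tot V →ₗ[S] Tot W} (t : Fin p)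
    (ht : ∀ x, c • f t x = -c • g t x) (h : ∀ s ≠ t, ∀ x, c • f s x = c • g s x) :
    c • mapTens p f = -c • mapTens p g := by
  have neg_update : mapTens p (Function.update g t (-g t)) = -mapTens p g :=
    mapTens_neg _ g t (by simp) fun s hs => by simp [hs]
  rw [neg_smul, ← smul_neg, ← neg_update]
  refine smul_mapTens_congr c fun s x => ?_
  by_cases hs : s = t
  · subst hs; simp [ht]
  · simp [hs, h s hs]

lemma mapTens_eq_neg {f g : Fin p → Tot V →ₗ[S] Tot W} (t : Fin p) (ht : ∀ x, f t x = -g t x)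
    (h : ∀ s ≠ t, ∀ x, f s x = g s x) : mapTens p f = -mapTens p g :=
  mapTens_neg f g t (LinearMap.ext ht) fun s hs => LinearMap.ext (h s hs)

lemma mapTens_congr_of_neg_of_neg {f g : Fin p → Tot V →ₗ[S] Tot W} {s t : Fin p} (hst : s ≠ t)
    (hs : ∀ x, f s x = -g s x) (ht : ∀ x, f t x = -g t x)
    (h : ∀ r, r ≠ s → r ≠ t → ∀ x, f r x = g r x) : mapTens p f = mapTens p g := by
  rw [mapTens_eq_neg (g := Function.update g t (-g t)) s (by simp [hst, hs]) fun r hrs x => ?_,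
    mapTens_eq_neg (g := g) t (by simp) (fun r hr => by simp [hr]), neg_neg]
  by_cases hr : r = t
  · subst hr; simp [ht]
  · simp [hr, h r hrs hr]

lemma mapTens_mem_degTens {f : Fin p → Tot V →ₗ[S] Tot W} {k : Fin p → ℤ}
    (hf : ∀ t, HasDeg (k t) (f t)) (j : ℤ) :
    degTens p V j ≤ (degTens p W (j + ∑ t, k t)).comap (mapTens p f) := by
  refine Submodule.span_le.2 ?_
  rintro _ ⟨l, v, rfl, rfl⟩
  rw [SetLike.mem_coe, Submodule.mem_comap, mapTens_pure]
  exact pure_mem_degTens (fun t => l t + k t) Finset.sum_add_distrib _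
    fun t => hf t (l t) (v t)

lemma mapTens_mem_degTens_of_zero {f : Fin p → Tot V →ₗ[S] Tot W} (hf : ∀ s, HasDeg 0 (f s))
    (j : ℤ) : degTens p V j ≤ (degTens p W j).comap (mapTens p f) := by
  simpa only [Finset.sum_const_zero, add_zero] using mapTens_mem_degTens hf j

lemma mapTens_comp_sgnTens {f : Fin p → Tot V →ₗ[S] Tot W} (hf : ∀ s, PreservesParity (f s)) :
    mapTens p f ∘ₗ sgnTens p V = sgnTens p W ∘ₗ mapTens p f := by
  rw [sgnTens, sgnTens, mapTens_comp, mapTens_comp]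
  exact mapTens_congr fun s x => ((hf s).sgnTot_apply x).symm

/-- The factor of `rotTens` that puts in the Koszul signs before the factors are permuted. -/
def rotSigns (p : ℕ) (V : Ch S) : TensPow p V →ₗ[S] TensPow p V :=
  (mapTens p fun s => if (s : ℕ) + 1 = p then evenTot V else LinearMap.id) +
    mapTens p fun s => if (s : ℕ) + 1 = p then oddTot V else sgnTot V

lemma mapTens_comp_rotTens {f g : Fin p → Tot V →ₗ[S] Tot W}
    (h : (mapTens p fun s => f (finRotate p s)) ∘ₗ rotSigns p V = rotSigns p W ∘ₗ mapTens p g) :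
    mapTens p f ∘ₗ rotTens p V = rotTens p W ∘ₗ mapTens p g := by
  change mapTens p f ∘ₗ reTens p V ∘ₗ rotSigns p V = (reTens p W ∘ₗ rotSigns p W) ∘ₗ mapTens p g
  rw [← LinearMap.comp_assoc, mapTens_rot, LinearMap.comp_assoc, h, LinearMap.comp_assoc]

lemma mapTens_comp_rotTens_of_preservesParity {f : Fin p → Tot V →ₗ[S] Tot W}
    (hf : ∀ s, PreservesParity (f s)) :
    mapTens p f ∘ₗ rotTens p V = rotTens p W ∘ₗ mapTens p fun s => f (finRotate p s) := by
  refine mapTens_comp_rotTens ?_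
  rw [rotSigns, rotSigns, LinearMap.comp_add, LinearMap.add_comp]
  simp only [mapTens_comp]
  congr 1 <;> refine mapTens_congr fun s x => ?_ <;> split_ifs
  · exact ((hf _).evenTot_apply x).symm
  · rfl
  · exact ((hf _).oddTot_apply x).symm
  · exact ((hf _).sgnTot_apply x).symm

end TensorMaps

section Insertions
variable {p : ℕ} {S : Type u} [CommRing S] {V W U : Ch S} {a b c : Tot V →ₗ[S] Tot W}

/-- `a ⊗ ⋯ ⊗ b ⊗ ⋯ ⊗ a` with `b` in the `t`-th slot, linear in `b`. The Koszul signs are those of a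
parity reversing `b`: the factors in front of `b` carry a sign operator. -/
def oddIns (t : Fin p) (a : Tot V →ₗ[S] Tot W) :
    (Tot V →ₗ[S] Tot W) →ₗ[S] TensPow p V →ₗ[S] TensPow p W :=
  (mapTensMultilinear p V W).toLinearMap (fun s => if s < t then a ∘ₗ sgnTot V else a) t

/-- `a ⊗ ⋯ ⊗ c ⊗ ⋯ ⊗ a` with `c` in the `t`-th slot, without signs, linear in `c`. -/
def evenIns (t : Fin p) (a : Tot V →ₗ[S] Tot W) :
    (Tot V →ₗ[S] Tot W) →ₗ[S] TensPow p V →ₗ[S] TensPow p W :=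
  (mapTensMultilinear p V W).toLinearMap (fun _ => a) t

lemma oddIns_apply (t : Fin p) (a b : Tot V →ₗ[S] Tot W) :
    oddIns t a b = mapTens p fun s => if s < t then a ∘ₗ sgnTot V else if s = t then b else a := by
  refine congrArg (mapTens p) (funext fun s => ?_)
  by_cases hs : s = t
  · subst hs; simp
  · simp [hs]

lemma evenIns_apply (t : Fin p) (a c : Tot V →ₗ[S] Tot W) :
    evenIns t a c = mapTens p fun s => if s = t then c else a :=
  congrArg (mapTens p) (funext fun _ => Function.update_apply _ _ _ _)

lemma dTens_eq_sum_oddIns : dTens p V = ∑ t, oddIns t LinearMap.id (dTot V) := by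
  simp only [dTens, oddIns_apply, LinearMap.id_comp]

lemma mapTens_const_add_smul {k : S} (hk : k * k = 0) (a c : Tot V →ₗ[S] Tot W) :
    (mapTens p fun _ => a + k • c) = (mapTens p fun _ => a) + k • ∑ t, evenIns t a c :=
  multilinearMap_add_smul (mapTensMultilinear p V W) hk (fun _ => a) fun _ => c

lemma smul_oddIns_congr (k : S) {a a' b b' : Tot V →ₗ[S] Tot W} (ha : k • a = k • a')
    (hb : k • b = k • b') (t : Fin p) : k • oddIns t a b = k • oddIns t a' b' := by
  have ha' (x) : k • a x = k • a' x := congrArg (· x) ha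
  have hb' (x) : k • b x = k • b' x := congrArg (· x) hb
  rw [oddIns_apply, oddIns_apply]
  refine smul_mapTens_congr k fun s x => ?_
  split_ifs
  exacts [ha' _, hb' x, ha' x]

lemma oddIns_comp_mapTens {g h : Tot W →ₗ[S] Tot U} (ha : PreservesParity a) (t : Fin p) :
    (oddIns t g h ∘ₗ mapTens p fun _ => a) = oddIns t (g ∘ₗ a) (h ∘ₗ a) := by
  rw [oddIns_apply, oddIns_apply, mapTens_comp]
  refine mapTens_congr fun s x => ?_
  split_ifs <;> simp [ha.sgnTot_apply]

lemma mapTens_comp_oddIns {g : Tot W →ₗ[S] Tot U} (t : Fin p) :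
    (mapTens p fun _ => g) ∘ₗ oddIns t a b = oddIns t (g ∘ₗ a) (g ∘ₗ b) := by
  rw [oddIns_apply, oddIns_apply, mapTens_comp]
  refine mapTens_congr fun s x => ?_
  split_ifs <;> rfl

lemma evenIns_mem_degTens (ha : HasDeg 0 a) (hc : HasDeg 0 c) (t : Fin p) (j : ℤ) :
    degTens p V j ≤ (degTens p W j).comap (evenIns t a c) := by
  rw [evenIns_apply]
  exact mapTens_mem_degTens_of_zero (fun s => by split_ifs <;> assumption) j

lemma oddIns_mem_degTens {k : ℤ} (ha : HasDeg 0 a) (hb : HasDeg k b) (t : Fin p) (j : ℤ) :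
    degTens p V j ≤ (degTens p W (j + k)).comap (oddIns t a b) := by
  have hasDeg_slot (s : Fin p) : HasDeg (if s = t then k else 0)
      (if s < t then a ∘ₗ sgnTot V else if s = t then b else a) := by
    rcases lt_trichotomy s t with h | h | h
    · simpa [h, h.ne] using ha.comp_zero hasDeg_sgnTot
    · simpa [h] using hb
    · simpa [h.not_gt, h.ne'] using ha
  rw [oddIns_apply]
  simpa using mapTens_mem_degTens hasDeg_slot j

lemma evenIns_comp_sgnTens (ha : PreservesParity a) (hc : PreservesParity c) (t : Fin p) :
    evenIns t a c ∘ₗ sgnTens p V = sgnTens p W ∘ₗ evenIns t a c := by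
  rw [evenIns_apply]
  exact mapTens_comp_sgnTens fun s => by split_ifs <;> assumption

lemma oddIns_comp_sgnTens (ha : PreservesParity a) (hb : ReversesParity b) (t : Fin p) :
    oddIns t a b ∘ₗ sgnTens p V = -(sgnTens p W ∘ₗ oddIns t a b) := by
  rw [oddIns_apply, sgnTens, sgnTens, mapTens_comp, mapTens_comp]
  refine mapTens_eq_neg t (fun x => ?_) fun s hs x => ?_
  · simp [hb.sgnTot_apply]
  · by_cases h : s < t <;> simp [h, hs, ha.sgnTot_apply]

lemma evenIns_comp_rotTens (ha : PreservesParity a) (hc : PreservesParity c) (t : Fin p) :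
    evenIns (finRotate p t) a c ∘ₗ rotTens p V = rotTens p W ∘ₗ evenIns t a c := by
  rw [evenIns_apply, evenIns_apply,
    mapTens_comp_rotTens_of_preservesParity fun s => by split_ifs <;> assumption]
  simp only [Equiv.apply_eq_iff_eq]

lemma not_finRotate_lt_finRotate_of_last {t : Fin p} (ht : (t : ℕ) + 1 = p) (s : Fin p) :
    ¬ finRotate p s < finRotate p t := by
  rw [Fin.lt_def, val_finRotate t, if_pos ht]
  exact Nat.not_lt_zero _

lemma finRotate_lt_finRotate_iff {t : Fin p} (ht : (t : ℕ) + 1 ≠ p) (s : Fin p) :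
    finRotate p s < finRotate p t ↔ s < t ∨ (s : ℕ) + 1 = p := by
  rw [Fin.lt_def, val_finRotate, val_finRotate, if_neg ht, Fin.lt_def]
  split_ifs <;> omega

/-- When `b` sits in the last slot, it exchanges the even and the odd summand of `rotSigns`. -/
lemma oddIns_comp_rotTens_of_last (ha : PreservesParity a) (hb : ReversesParity b) {t : Fin p}
    (ht : (t : ℕ) + 1 = p) :
    oddIns (finRotate p t) a b ∘ₗ rotTens p V = rotTens p W ∘ₗ oddIns t a b := by
  rw [oddIns_apply, oddIns_apply]
  refine mapTens_comp_rotTens ?_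
  rw [rotSigns, rotSigns, LinearMap.comp_add, LinearMap.add_comp, add_comm]
  simp only [mapTens_comp, not_finRotate_lt_finRotate_of_last ht, Equiv.apply_eq_iff_eq, if_false]
  have lt_of_ne {s : Fin p} (hs : s ≠ t) : s < t := by omega
  have not_last {s : Fin p} (hs : s ≠ t) : (s : ℕ) + 1 ≠ p := by omega
  congr 1 <;> refine mapTens_congr fun s x => ?_ <;> by_cases hs : s = t
  · subst hs; simp [ht, hb.evenTot_apply]
  · simp [hs, lt_of_ne hs, not_last hs]
  · subst hs; simp [ht, hb.oddTot_apply]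
  · simp [hs, lt_of_ne hs, not_last hs, ha.sgnTot_apply]

/-- In the odd summand of `rotSigns` the signs of the last slot and of the slot of `b` cancel. -/
lemma oddIns_comp_rotTens_of_not_last (ha : PreservesParity a) (hb : ReversesParity b) {t : Fin p}
    (ht : (t : ℕ) + 1 ≠ p) :
    oddIns (finRotate p t) a b ∘ₗ rotTens p V = rotTens p W ∘ₗ oddIns t a b := by
  obtain ⟨l, hl⟩ : ∃ l : Fin p, (l : ℕ) + 1 = p := ⟨⟨p - 1, by omega⟩, by grind⟩
  have hlt : l ≠ t := by rintro rfl; exact ht hl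
  have not_lt : ¬ l < t := by omega
  have not_last {s : Fin p} (hs : s ≠ l) : (s : ℕ) + 1 ≠ p := by omega
  rw [oddIns_apply, oddIns_apply]
  refine mapTens_comp_rotTens ?_
  rw [rotSigns, rotSigns, LinearMap.comp_add, LinearMap.add_comp]
  simp only [mapTens_comp, finRotate_lt_finRotate_iff ht, Equiv.apply_eq_iff_eq]
  congr 1
  · refine mapTens_congr fun s x => ?_
    by_cases hs : s = l
    · subst hs; simp [hl, hlt, not_lt, ha.evenTot_apply, sgnTot_evenTot_apply]
    · simp [not_last hs]
  · refine mapTens_congr_of_neg_of_neg hlt (fun x => ?_) (fun x => ?_) fun s hsl hst x => ?_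
    · simp [hl, hlt, not_lt, ha.oddTot_apply, sgnTot_oddTot_apply]
    · simp [ht, hb.sgnTot_apply]
    · by_cases h : s < t <;> simp [h, hst, not_last hsl, ha.sgnTot_apply]

lemma oddIns_comp_rotTens (ha : PreservesParity a) (hb : ReversesParity b) (t : Fin p) :
    oddIns (finRotate p t) a b ∘ₗ rotTens p V = rotTens p W ∘ₗ oddIns t a b :=
  (em ((t : ℕ) + 1 = p)).elim (oddIns_comp_rotTens_of_last ha hb)
    (oddIns_comp_rotTens_of_not_last ha hb)

lemma dTens_comp_mapTens_sub (ha : PreservesParity a) :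
    (dTens p W ∘ₗ mapTens p fun _ => a) - (mapTens p fun _ => a) ∘ₗ dTens p V =
      ∑ t, oddIns t a (dTot W ∘ₗ a - a ∘ₗ dTot V) := by
  rw [dTens_eq_sum_oddIns, dTens_eq_sum_oddIns, sum_comp_aux, comp_sum_aux,
    ← Finset.sum_sub_distrib]
  refine Finset.sum_congr rfl fun t _ => ?_
  rw [oddIns_comp_mapTens ha, mapTens_comp_oddIns, map_sub]
  rfl

lemma smul_dTens_comp_oddIns (k : S) (ha : PreservesParity a) (hb : ReversesParity b)
    (hda : k • (dTot W ∘ₗ a) = k • (a ∘ₗ dTot V))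
    (hdb : k • (dTot W ∘ₗ b) = -k • (b ∘ₗ dTot V)) (t : Fin p) :
    k • (dTens p W ∘ₗ oddIns t a b) = -k • (oddIns t a b ∘ₗ dTens p V) := by
  have hda' (x) : k • dTot W (a x) = k • a (dTot V x) := congrArg (· x) hda
  have hdb' (x) : k • dTot W (b x) = -k • b (dTot V x) := congrArg (· x) hdb
  rw [dTens_eq_sum_oddIns, dTens_eq_sum_oddIns, sum_comp_aux, comp_sum_aux,
    Finset.smul_sum, Finset.smul_sum]
  refine Finset.sum_congr rfl fun r _ => ?_
  simp only [oddIns_apply, mapTens_comp]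
  -- The sign comes from the first of the two slots `r` of `d` and `t` of `b`.
  refine smul_mapTens_eq_neg k (min r t) (fun x => ?_) fun s hs x => ?_
  · rcases lt_trichotomy r t with h | h | h
    · simp [h, h.le, reversesParity_dTot.sgnTot_apply, hda']
    · simp [h, hdb']
    · simp [h, h.le, hb.sgnTot_apply]
  · grind [LinearMap.comp_apply, LinearMap.id_apply, ha.sgnTot_apply, sgnTot_sgnTot_apply]

lemma smul_dTens_comp_evenIns_sub (k : S) (ha : PreservesParity a) (hc : PreservesParity c)
    (hda : k • (dTot W ∘ₗ a) = k • (a ∘ₗ dTot V)) (t : Fin p) :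
    k • (dTens p W ∘ₗ evenIns t a c - evenIns t a c ∘ₗ dTens p V) =
      k • oddIns t a (dTot W ∘ₗ c - c ∘ₗ dTot V) := by
  have hda' (x) : k • dTot W (a x) = k • a (dTot V x) := congrArg (· x) hda
  rw [dTens_eq_sum_oddIns, dTens_eq_sum_oddIns, sum_comp_aux, comp_sum_aux,
    ← Finset.sum_sub_distrib, Finset.smul_sum, Finset.sum_eq_single_of_mem t (Finset.mem_univ t)]
  · rw [map_sub]
    simp only [oddIns_apply, evenIns_apply, mapTens_comp]
    congr 2 <;> refine mapTens_congr fun s x => ?_ <;> by_cases hs : s = t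
    · simp [hs]
    · by_cases h : s < t <;> simp [h, hs, ha.sgnTot_apply]
    · simp [hs]
    · by_cases h : s < t <;> simp [h, hs]
  · intro r _ hr
    rw [smul_sub, sub_eq_zero]
    simp only [oddIns_apply, evenIns_apply, mapTens_comp]
    refine smul_mapTens_congr k fun s x => ?_
    by_cases hs : s = t
    · subst hs
      rcases lt_or_gt_of_ne hr with h | h <;> simp [h, h.not_gt, h.ne', hc.sgnTot_apply]
    · rcases lt_trichotomy s r with h | h | h
      · simp [h, hs, ha.sgnTot_apply]
      · subst h; simp [hr, hda']
      · simp [h.not_gt, h.ne', hs]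

end Insertions

namespace FiltCh
variable {S : Type u} [CommRing S] (E : FiltCh S)

lemma leSub_le_F (n i : ℤ) : E.leSub n i ≤ E.F (n - i) i := by
  refine sup_le (E.anti _ _ _ (by omega)) ?_
  rintro _ ⟨x, hx, rfl⟩
  exact E.d_mem _ _ _ hx

lemma mkQ_mem_F_iff {n j i : ℤ} (h : j ≤ n - i) {y : E.K.X i} :
    (E.leSub n i).mkQ y ∈ ((le S n).obj E).F j i ↔ y ∈ E.F j i := by
  change y ∈ ((E.F j i).map (E.leSub n i).mkQ).comap (E.leSub n i).mkQ ↔ _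
  rw [Submodule.comap_map_mkQ, sup_eq_right.2 ((E.leSub_le_F n i).trans (E.anti _ _ _ h))]

lemma mkQ_mem_geSub_iff {m n i : ℤ} (h : n ≤ m) {y : E.K.X i} :
    (E.leSub m i).mkQ y ∈ ((le S m).obj E).geSub n i ↔ y ∈ E.geSub n i :=
  and_congr (E.mkQ_mem_F_iff (n := m) (by omega)) (E.mkQ_mem_F_iff (n := m) (by omega))

variable {E} in
/-- `y ∈ E_i` represents `x ∈ (τ^F_{[0,1]} E)_i`, a submodule of a quotient of `E_i`. -/
def Represents {i : ℤ} (y : E.K.X i) (x : ((trunc01 S).obj E).K.X i) : Prop :=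
  (E.leSub 1 i).mkQ y = (((le S 1).obj E).geSub 0 i).subtype x

variable {E}

lemma exists_represents {i : ℤ} (x : ((trunc01 S).obj E).K.X i) : ∃ y : E.K.X i, Represents y x :=
  Submodule.mkQ_surjective _ _

lemma exists_represents_of_mem {i : ℤ} {y : E.K.X i} (hy : y ∈ E.geSub 0 i) :
    ∃ x, Represents y x :=
  ⟨⟨_, (E.mkQ_mem_geSub_iff zero_le_one).2 hy⟩, rfl⟩

namespace Represents
variable {i : ℤ} {y y' : E.K.X i} {x x' : ((trunc01 S).obj E).K.X i}

lemma mem_geSub_zero (h : Represents y x) : y ∈ E.geSub 0 i :=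
  (E.mkQ_mem_geSub_iff zero_le_one).1 (h ▸ x.2)

lemma mem_geSub_one (h : Represents y x) (hx : x ∈ ((trunc01 S).obj E).geSub 1 i) :
    y ∈ E.geSub 1 i := by
  have hx' : (((le S 1).obj E).geSub 0 i).subtype x ∈ ((le S 1).obj E).geSub 1 i := hx
  rw [← h] at hx'
  exact (E.mkQ_mem_geSub_iff le_rfl).1 hx'

lemma mem_F (h : Represents y x) {j : ℤ} (hy : y ∈ E.F j i) : x ∈ ((trunc01 S).obj E).F j i := by
  change (((le S 1).obj E).geSub 0 i).subtype x ∈ ((le S 1).obj E).F j i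
  rw [← h]
  exact ⟨y, hy, rfl⟩

lemma add (h : Represents y x) (h' : Represents y' x') : Represents (y + y') (x + x') :=
  (map_add _ y y').trans (congrArg₂ (· + ·) h h')

lemma sub (h : Represents y x) (h' : Represents y' x') : Represents (y - y') (x - x') :=
  (map_sub _ y y').trans (congrArg₂ (· - ·) h h')

lemma d {j : ℤ} (h : Represents y x) :
    Represents ((E.K.d i j).hom y) ((((trunc01 S).obj E).K.d i j).hom x) :=
  congrArg (((le S 1).obj E).K.d i j).hom h

lemma map {E' : FiltCh S} (φ : E ⟶ E') (h : Represents y x) :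
    Represents ((φ.f.f i).hom y) ((((trunc01 S).map φ).f.f i).hom x) :=
  congrArg (((le S 1).map φ).f.f i).hom h

lemma unique (h : Represents y x) (h' : Represents y x') : x = x' :=
  Subtype.ext (h.symm.trans h')

lemma eq_zero (h : Represents y x) (hy : y ∈ E.leSub 1 i) : x = 0 :=
  Subtype.ext (h.symm.trans ((Submodule.Quotient.mk_eq_zero _).2 hy))

end Represents

lemma exists_mem_leSub_represents {i : ℤ} {z : E.K.X (i + 1)} (hz : z ∈ E.F (0 - i) (i + 1))
    {y : E.K.X i} (hy : y ∈ E.F (0 + 1 - i) i) :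
    ∃ x ∈ ((trunc01 S).obj E).leSub 0 i, Represents ((E.K.d (i + 1) i).hom z + y) x := by
  have dz_mem : (E.K.d (i + 1) (i + 1 - 1)).hom z ∈ E.F (0 + 1 - (i + 1)) (i + 1 - 1) :=
    E.anti _ _ _ (by omega) (E.d_mem _ _ _ hz)
  obtain ⟨z', hz'⟩ := exists_represents_of_mem ⟨dz_mem, E.anti _ _ _ (by omega) hz⟩
  obtain ⟨y', hy'⟩ := exists_represents_of_mem ⟨E.d_mem _ _ _ hy, E.anti _ _ _ (by omega) hy⟩
  exact ⟨_, add_mem (Submodule.mem_sup_right ⟨z', hz'.mem_F hz, rfl⟩)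
    (Submodule.mem_sup_left (hy'.mem_F hy)), hz'.d.add hy'⟩

/-- Filtered homotopies `h` with `φ' - φ = c (d h + h d)`, that is, the multiple by `c` of `h` is a
homotopy between `φ` and `φ'`. -/
structure SmulHtpy (c : S) {E E' : FiltCh S} (φ φ' : E ⟶ E') where
  h : ∀ n m, n + 1 = m → (E.K.X n →ₗ[S] E'.K.X m)
  mem : ∀ n m e i y, y ∈ E.F i n → h n m e y ∈ E'.F i m
  eq : ∀ i y, (φ'.f.f i).hom y = (φ.f.f i).hom y +
    c • ((E'.K.d (i + 1) i).hom (h i (i + 1) rfl y) +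
      h (i - 1) i (by omega) ((E.K.d i (i - 1)).hom y))

namespace SmulHtpy
variable {c : S} {E E' Q : FiltCh S} {φ φ' : E ⟶ E'}

lemma map_sub_map_mem_map_leSub (H : SmulHtpy c φ φ') (q : E' ⟶ Q) (π : Q ⟶ E')
    (hc : ∀ i y, (π.f.f i).hom ((q.f.f i).hom y) = c • y) {i : ℤ}
    (x : ((trunc01 S).obj E).K.X i) :
    (((trunc01 S).map φ').f.f i).hom x - (((trunc01 S).map φ).f.f i).hom x ∈
      (((trunc01 S).obj Q).leSub 0 i).map (((trunc01 S).map π).f.f i).hom := by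
  obtain ⟨y, hy⟩ := exists_represents x
  obtain ⟨dy_mem, y_mem⟩ := hy.mem_geSub_zero
  obtain ⟨w, hw, hw'⟩ := exists_mem_leSub_represents (q.mem _ _ (H.mem i (i + 1) rfl _ y y_mem))
    (q.mem _ _ (H.mem (i - 1) i (by omega) _ _ dy_mem))
  have q_d : (Q.K.d (i + 1) i).hom ((q.f.f (i + 1)).hom (H.h i (i + 1) rfl y)) =
      (q.f.f i).hom ((E'.K.d (i + 1) i).hom (H.h i (i + 1) rfl y)) :=
    congrArg (fun f => f.hom (H.h i (i + 1) rfl y)) (q.f.comm (i + 1) i)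
  refine ⟨w, hw, (hw'.map π).unique ?_⟩
  rw [q_d, ← map_add, hc, ← add_sub_cancel_left ((φ.f.f i).hom y) (c • _), ← H.eq]
  exact (hy.map φ').sub (hy.map φ)

lemma map_eq_map_of_mem_geSub (H : SmulHtpy c φ φ') (q : E ⟶ Q) (π : Q ⟶ E)
    (hc : ∀ i y, (π.f.f i).hom ((q.f.f i).hom y) = c • y) {i : ℤ}
    (x : ((trunc01 S).obj E).K.X i)
    (hx : (((trunc01 S).map q).f.f i).hom x ∈ ((trunc01 S).obj Q).geSub 1 i) :
    (((trunc01 S).map φ').f.f i).hom x = (((trunc01 S).map φ).f.f i).hom x := by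
  obtain ⟨y, hy⟩ := exists_represents x
  obtain ⟨dqy_mem, qy_mem⟩ := (hy.map q).mem_geSub_one hx
  have q_d : (Q.K.d i (i - 1)).hom ((q.f.f i).hom y) =
      (q.f.f (i - 1)).hom ((E.K.d i (i - 1)).hom y) :=
    congrArg (fun f => f.hom y) (q.f.comm i (i - 1))
  rw [SetLike.mem_coe, Submodule.mem_comap, q_d] at dqy_mem
  have cy_mem := π.mem _ _ qy_mem
  have cdy_mem := π.mem _ _ dqy_mem
  rw [Submodule.mem_comap, hc] at cy_mem cdy_mem
  refine sub_eq_zero.1 (((hy.map φ').sub (hy.map φ)).eq_zero ?_)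
  rw [H.eq, add_sub_cancel_left, smul_add, ← map_smul, ← map_smul, ← map_smul]
  exact add_mem (Submodule.mem_sup_right ⟨_, H.mem _ _ _ _ _ cy_mem, rfl⟩)
    (Submodule.mem_sup_left (H.mem _ _ _ _ _ cdy_mem))

end SmulHtpy

end FiltCh

namespace EquivariantDGRing
variable {p : ℕ} (D : EquivariantDGRing.{u} p)

/-- Left multiplication by `u`. -/
def mulLin (u : D.A) : D.A →ₗ[ℤ] D.A := LinearMap.mulLeft ℤ u

lemma d_one : D.d 1 = 0 := by
  simpa using D.leibniz 0 1 1 SetLike.GradedOne.one_mem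

lemma d_proj_one (y : D.A) : D.d (GradedRing.proj D.gr 1 y) = GradedRing.proj D.gr 0 (D.d y) := by
  simp only [GradedRing.proj_apply]
  induction y using DirectSum.Decomposition.inductionOn D.gr with
  | zero => simp
  | @homogeneous i m =>
    have dm_mem := D.d_mem i m m.2
    by_cases hi : i = 1
    · subst hi
      rw [sub_self] at dm_mem
      rw [DirectSum.decompose_of_mem_same _ m.2, DirectSum.decompose_of_mem_same _ dm_mem]
    · rw [DirectSum.decompose_of_mem_ne _ m.2 hi, DirectSum.decompose_of_mem_ne _ dm_mem (by omega),
        map_zero]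
  | add a b ha hb => simpa using congrArg₂ (· + ·) ha hb

lemma exists_mem_gr_one_d_eq_one (hacyclic : ∃ y, D.d y = 1) : ∃ u ∈ D.gr 1, D.d u = 1 := by
  obtain ⟨y, hy⟩ := hacyclic
  refine ⟨GradedRing.proj D.gr 1 y, SetLike.coe_mem _, ?_⟩
  rw [D.d_proj_one, hy, GradedRing.proj_apply,
    DirectSum.decompose_of_mem_same _ SetLike.GradedOne.one_mem]

variable {D} {u : D.A} (hu : u ∈ D.gr 1)
include hu

lemma mulLin_mem {i : ℤ} {x : D.A} (hx : x ∈ D.gr i) : D.mulLin u x ∈ D.gr (i + 1) := by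
  rw [add_comm]
  exact SetLike.GradedMul.mul_mem hu hx

lemma dLin_mulLin (hdu : D.d u = 1) (x : D.A) :
    D.dLin (D.mulLin u x) = x - D.mulLin u (D.dLin x) := by
  have leibniz := D.leibniz 1 u x hu
  rwa [hdu, one_mul, Int.negOnePow_one, Units.neg_smul, one_smul, ← sub_eq_add_neg] at leibniz

lemma sgn_mulLin (x : D.A) : D.sgn (D.mulLin u x) = -D.mulLin u (D.sgn x) := by
  refine congrArg (fun f => f x) (D.hom_ext (f := D.sgn ∘ₗ D.mulLin u)
    (g := -(D.mulLin u ∘ₗ D.sgn)) fun i x hx => ?_)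
  simp only [LinearMap.comp_apply, LinearMap.neg_apply]
  rw [D.sgn_of_mem hx, D.sgn_of_mem (mulLin_mem hu hx), Int.negOnePow_succ, Units.neg_smul,
    Units.smul_def, Units.smul_def, map_zsmul]

end EquivariantDGRing

namespace MulResolutionData
variable {p : ℕ} (ν : MulResolutionData.{u} p)

section ContractingHomotopies

lemma exists_unitHtpy : ∃ u ∈ ν.P.gr 1, ν.P.d u = 1 :=
  ν.P.exists_mem_gr_one_d_eq_one (ν.P_acyclic 1 ν.P.d_one)

/-- The translate by the `t`-th element of the group of a fixed element of degree one of `P̄` with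
differential `1`; multiplication by it is a contracting homotopy of `P̄`. -/
def unitHtpy (t : Fin p) : ν.P.A :=
  Multiplicative.ofAdd ((t : ℕ) : ZMod p) • ν.exists_unitHtpy.choose

lemma unitHtpy_mem (t : Fin p) : ν.unitHtpy t ∈ ν.P.gr 1 :=
  ν.P.smul_mem _ _ _ ν.exists_unitHtpy.choose_spec.1

lemma d_unitHtpy (t : Fin p) : ν.P.d (ν.unitHtpy t) = 1 := by
  rw [unitHtpy, ν.P.d_smul, ν.exists_unitHtpy.choose_spec.2, smul_one]

lemma gen_unitHtpy (t : Fin p) : ν.P.gen (ν.unitHtpy t) = ν.unitHtpy (finRotate p t) := by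
  have cast_finRotate : ((finRotate p t : ℕ) : ZMod p) = 1 + (t : ℕ) := by
    rw [val_finRotate]
    split_ifs with h
    · rw [← Nat.cast_one, ← Nat.cast_add, add_comm, h, ZMod.natCast_self, Nat.cast_zero]
    · rw [Nat.cast_add, Nat.cast_one, add_comm]
  change Multiplicative.ofAdd (1 : ZMod p) • ν.unitHtpy t = _
  rw [unitHtpy, unitHtpy, smul_smul, ← ofAdd_add, cast_finRotate]

/-- The contracting homotopy of `P̄ ⊗ I` given by multiplication by `unitHtpy t`. -/
def contrB (t : Fin p) : ν.B →ₗ[ℤ] ν.B := ν.mapB (ν.P.mulLin (ν.unitHtpy t)) LinearMap.id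

lemma dB_contrB (t : Fin p) (b : ν.B) : ν.dB (ν.contrB t b) = b - ν.contrB t (ν.dB b) := by
  refine congrArg (fun f => f b) (ν.B_ext (f := ν.dB ∘ₗ ν.contrB t)
    (g := LinearMap.id - ν.contrB t ∘ₗ ν.dB) fun x y => ?_)
  have sub_tmulB (x x' : ν.P.A) : ν.tmulB (x - x') y = ν.tmulB x y - ν.tmulB x' y :=
    TensorProduct.sub_tmul x x' y
  simp only [LinearMap.comp_apply, LinearMap.sub_apply, LinearMap.id_apply, contrB, dB,
    LinearMap.add_apply, mapB_tmulB, map_add, tmulB_neg, sub_tmulB,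
    EquivariantDGRing.dLin_mulLin (ν.unitHtpy_mem t) (ν.d_unitHtpy t),
    EquivariantDGRing.sgn_mulLin (ν.unitHtpy_mem t)]
  abel

lemma contrB_finRotate_comp_genB (t : Fin p) :
    ν.contrB (finRotate p t) ∘ₗ ν.genB = ν.genB ∘ₗ ν.contrB t := by
  refine ν.B_ext fun x y => congrArg (ν.tmulB · (ν.I.gen y)) ?_
  rw [← gen_unitHtpy]
  exact (smul_mul' _ _ _).symm

lemma contrB_mem (t : Fin p) (m : ℤ) : ν.degB m ≤ (ν.degB (m + 1)).comap (ν.contrB t) := by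
  refine Submodule.span_le.2 ?_
  rintro _ ⟨a, b, rfl, x, hx, y, hy, rfl⟩
  exact Submodule.subset_span ⟨a + 1, b, by ring, _,
    EquivariantDGRing.mulLin_mem (ν.unitHtpy_mem t) hx, y, hy, rfl⟩

end ContractingHomotopies

variable {S : Type u} [CommRing S] {V W U : Ch S}

section Act

/-- `ν.act f g` as a linear function of `f`. -/
def actHom (g : ν.B →ₗ[ℤ] ν.B) :
    (TensPow p V →ₗ[S] TensPow p W) →ₗ[S] ν.X V →ₗ[S] ν.X W where
  toFun f := ν.act f g
  map_add' _ _ := TensorProduct.AlgebraTensorModule.map_add_left _ _ _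
  map_smul' _ _ := TensorProduct.AlgebraTensorModule.map_smul_left _ _ _

lemma act_zero (g : ν.B →ₗ[ℤ] ν.B) : ν.act (0 : TensPow p V →ₗ[S] TensPow p W) g = 0 :=
  map_zero (ν.actHom g)

lemma act_add (f f' : TensPow p V →ₗ[S] TensPow p W) (g : ν.B →ₗ[ℤ] ν.B) :
    ν.act (f + f') g = ν.act f g + ν.act f' g := map_add (ν.actHom g) f f'

lemma act_smul (k : S) (f : TensPow p V →ₗ[S] TensPow p W) (g : ν.B →ₗ[ℤ] ν.B) :
    ν.act (k • f) g = k • ν.act f g := map_smul (ν.actHom g) k f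

lemma act_mem_degX {k l n m : ℤ} {f : TensPow p V →ₗ[S] TensPow p W} {g : ν.B →ₗ[ℤ] ν.B}
    (hf : ∀ j, degTens p V j ≤ (degTens p W (j + k)).comap f)
    (hg : ∀ m, ν.degB m ≤ (ν.degB (m + l)).comap g) (h : n + (k + l) = m) :
    ν.degX V n ≤ (ν.degX W m).comap (ν.act f g) := by
  refine Submodule.span_le.2 ?_
  rintro _ ⟨j, i, rfl, e, he, b, hb, rfl⟩
  exact Submodule.subset_span ⟨j + k, i + l, by omega, _, hf j he, _, hg i hb, rfl⟩

lemma act_mem_filX {k l n m : ℤ} {f : TensPow p V →ₗ[S] TensPow p W} {g : ν.B →ₗ[ℤ] ν.B}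
    (hf : ∀ j, degTens p V j ≤ (degTens p W (j + k)).comap f)
    (hg : ∀ m, ν.degB m ≤ (ν.degB (m + l)).comap g) (h : n + (k + l) = m) (hk : k ≤ 0) (i : ℤ) :
    ν.filX V i n ≤ (ν.filX W i m).comap (ν.act f g) := by
  refine Submodule.span_le.2 ?_
  rintro _ ⟨j, r, rfl, hj, e, he, b, hb, rfl⟩
  exact Submodule.subset_span
    ⟨j + k, r + l, by omega, by omega, _, hf j he, _, hg r hb, rfl⟩

end Act

section ContrSum

/-- `∑_t (sgn ∘ L_t) ⊗ h_t`, where `h_t` is the contracting homotopy of `P̄ ⊗ I` given by the `t`-th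
translate of a fixed one; this is equivariant as soon as the `L_t` are permuted by the rotation. -/
def contrSum : (Fin p → TensPow p V →ₗ[S] TensPow p W) →ₗ[S] ν.X V →ₗ[S] ν.X W :=
  ∑ t, ν.actHom (ν.contrB t) ∘ₗ LinearMap.compRight S (sgnTens p W) ∘ₗ LinearMap.proj t

lemma contrSum_apply (L : Fin p → TensPow p V →ₗ[S] TensPow p W) :
    ν.contrSum L = ∑ t, ν.act (sgnTens p W ∘ₗ L t) (ν.contrB t) := by
  simp only [contrSum, LinearMap.sum_apply]
  rfl

lemma contrSum_comp_act (L : Fin p → TensPow p W →ₗ[S] TensPow p U)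
    (f : TensPow p V →ₗ[S] TensPow p W) :
    ν.contrSum L ∘ₗ ν.act f LinearMap.id = ν.contrSum fun t => L t ∘ₗ f := by
  simp only [contrSum_apply, sum_comp_aux, act_comp, LinearMap.comp_assoc, LinearMap.comp_id]

lemma act_comp_contrSum {f : TensPow p W →ₗ[S] TensPow p U}
    (hf : f ∘ₗ sgnTens p W = sgnTens p U ∘ₗ f) (L : Fin p → TensPow p V →ₗ[S] TensPow p W) :
    ν.act f LinearMap.id ∘ₗ ν.contrSum L = ν.contrSum fun t => f ∘ₗ L t := by
  simp only [contrSum_apply, comp_sum_aux, act_comp, ← LinearMap.comp_assoc, hf, LinearMap.id_comp]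

lemma dX_comp_act {f : TensPow p V →ₗ[S] TensPow p W}
    (hf : f ∘ₗ sgnTens p V = sgnTens p W ∘ₗ f) :
    ν.dX W ∘ₗ ν.act f LinearMap.id - ν.act f LinearMap.id ∘ₗ ν.dX V =
      ν.act (dTens p W ∘ₗ f - f ∘ₗ dTens p V) LinearMap.id := by
  have hf' (x) : f (sgnTens p V x) = sgnTens p W (f x) := congrArg (fun g => g x) hf
  refine ν.X_ext fun x b => ?_
  simp [dX, hf', sub_tmul]

lemma dX_comp_contrSum {e : S} (he : e * e = 1) {L : Fin p → TensPow p V →ₗ[S] TensPow p W}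
    (hL : ∀ t, L t ∘ₗ sgnTens p V = e • (sgnTens p W ∘ₗ L t)) :
    ν.dX W ∘ₗ ν.contrSum L + e • (ν.contrSum L ∘ₗ ν.dX V) =
      ν.act (∑ t, L t) LinearMap.id -
        ν.contrSum fun t => dTens p W ∘ₗ L t - e • (L t ∘ₗ dTens p V) := by
  have L_sgn (t x) : L t (sgnTens p V x) = e • sgnTens p W (L t x) :=
    congrArg (fun g => g x) (hL t)
  have d_sgn (x) : dTens p W (sgnTens p W x) = -sgnTens p W (dTens p W x) := by
    rw [eq_neg_iff_add_eq_zero, add_comm, ← eq_neg_iff_add_eq_zero]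
    exact congrArg (fun g => g x) (sgnTens_dTens (V := W))
  have sgn_sgn (x) : sgnTens p W (sgnTens p W x) = x :=
    congrArg (fun g => g x) (sgnTens_sgnTens (V := W))
  refine ν.X_ext fun x b => ?_
  simp only [contrSum_apply, dX, LinearMap.add_apply, LinearMap.sub_apply, LinearMap.smul_apply,
    LinearMap.comp_apply, LinearMap.sum_apply, act_tmul, LinearMap.id_apply, map_sum, sum_tmul,
    Finset.smul_sum, map_add, dB_contrB, L_sgn, d_sgn, sgn_sgn, map_sub, map_smul, sub_tmul,
    tmul_sub, neg_tmul, smul_add, ← smul_tmul', smul_smul, he, one_smul,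
    ← Finset.sum_add_distrib, ← Finset.sum_sub_distrib]
  refine Finset.sum_congr rfl fun t _ => ?_
  abel

end ContrSum

/-- Linear maps of the modules `V^{⊗ p} ⊗ P̄ ⊗ I` that are equivariant, homogeneous of degree `k`
and respect the filtrations. -/
structure IsFiltEquiv (k : ℤ) (T : ν.X V →ₗ[S] ν.X W) : Prop where
  gen : T ∘ₗ ν.genX V = ν.genX W ∘ₗ T
  deg : ∀ n m, n + k = m → ν.degX V n ≤ (ν.degX W m).comap T
  fil : ∀ i n m, n + k = m → ν.filX V i n ≤ (ν.filX W i m).comap T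

namespace IsFiltEquiv
variable {ν} {k : ℤ} {T T' : ν.X V →ₗ[S] ν.X W}

lemma sub (h : ν.IsFiltEquiv k T) (h' : ν.IsFiltEquiv k T') : ν.IsFiltEquiv k (T - T') where
  gen := by rw [LinearMap.sub_comp, LinearMap.comp_sub, h.gen, h'.gen]
  deg n m e x hx := (ν.degX W m).sub_mem (h.deg n m e hx) (h'.deg n m e hx)
  fil i n m e x hx := (ν.filX W i m).sub_mem (h.fil i n m e hx) (h'.fil i n m e hx)

lemma smul (h : ν.IsFiltEquiv k T) (c : S) : ν.IsFiltEquiv k (c • T) where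
  gen := by rw [LinearMap.smul_comp, LinearMap.comp_smul, h.gen]
  deg n m e x hx := (ν.degX W m).smul_mem c (h.deg n m e hx)
  fil i n m e x hx := (ν.filX W i m).smul_mem c (h.fil i n m e hx)

lemma act {f : TensPow p V →ₗ[S] TensPow p W} (hrot : f ∘ₗ rotTens p V = rotTens p W ∘ₗ f)
    (hdeg : ∀ j, degTens p V j ≤ (degTens p W j).comap f) :
    ν.IsFiltEquiv 0 (ν.act f LinearMap.id) := by
  have hf (j) : degTens p V j ≤ (degTens p W (j + 0)).comap f := (add_zero j).symm ▸ hdeg j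
  have hid (m) : ν.degB m ≤ (ν.degB (m + 0)).comap LinearMap.id := (add_zero m).symm ▸ le_rfl
  refine ⟨?_, fun n m e => ν.act_mem_degX hf hid e, fun i n m e => ν.act_mem_filX hf hid e le_rfl i⟩
  rw [genX, genX, act_comp, act_comp, hrot, LinearMap.id_comp, LinearMap.comp_id]

lemma contrSum {L : Fin p → TensPow p V →ₗ[S] TensPow p W} {l : ℤ} (hl : l + 1 = k) (hl₀ : l ≤ 0)
    (hrot : ∀ t, L (finRotate p t) ∘ₗ rotTens p V = rotTens p W ∘ₗ L t)
    (hdeg : ∀ t j, degTens p V j ≤ (degTens p W (j + l)).comap (L t)) :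
    ν.IsFiltEquiv k (ν.contrSum L) := by
  have hsgn (t j) : degTens p V j ≤ (degTens p W (j + l)).comap (sgnTens p W ∘ₗ L t) :=
    fun x hx => sgnTens_deg (V := W) _ (hdeg t j hx)
  rw [contrSum_apply]
  refine ⟨?_, fun n m e x hx => ?_, fun i n m e x hx => ?_⟩
  · rw [genX, genX, sum_comp_aux, comp_sum_aux, ← Equiv.sum_comp (finRotate p)]
    refine Finset.sum_congr rfl fun t _ => ?_
    rw [act_comp, act_comp, contrB_finRotate_comp_genB, LinearMap.comp_assoc, hrot,
      ← LinearMap.comp_assoc, ← LinearMap.comp_assoc, sgnTens_rotTens]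
  · rw [Submodule.mem_comap, LinearMap.sum_apply]
    exact sum_mem fun t _ => ν.act_mem_degX (hsgn t) (ν.contrB_mem t) (by omega) hx
  · rw [Submodule.mem_comap, LinearMap.sum_apply]
    exact sum_mem fun t _ => ν.act_mem_filX (hsgn t) (ν.contrB_mem t) (by omega) hl₀ i hx

lemma mem_invX (h : ν.IsFiltEquiv k T) {n m : ℤ} (e : n + k = m) :
    ∀ x ∈ ν.invX V n, T x ∈ ν.invX W m := by
  rintro x ⟨x_mem, x_inv⟩
  refine ⟨h.deg n m e x_mem, ?_⟩
  rw [SetLike.mem_coe, LinearMap.mem_ker, LinearMap.sub_apply, sub_eq_zero] at x_inv ⊢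
  calc ν.genX W (T x) = T (ν.genX V x) := congrArg (fun f => f x) h.gen.symm
    _ = T x := congrArg T x_inv

end IsFiltEquiv

section TateComplexes
variable {T T' : ν.X V →ₗ[S] ν.X W}

/-- The map of Tate complexes induced by a map of the modules `V^{⊗ p} ⊗ P̄ ⊗ I`. -/
def tateMapX (h : ν.IsFiltEquiv 0 T) (hd : T ∘ₗ ν.dX V = ν.dX W ∘ₗ T) :
    ν.tateObj V ⟶ ν.tateObj W where
  f :=
    { f := fun n => ModuleCat.ofHom (T.restrict (h.mem_invX (add_zero n)))
      comm' := fun n m e => by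
        change _ ≫ (ν.tateCh W).d n m = (ν.tateCh V).d n m ≫ _
        rw [ν.tateCh_d V n m e, ν.tateCh_d W n m e]
        apply ModuleCat.hom_ext
        refine LinearMap.ext fun x => Subtype.ext ?_
        exact congrArg (fun f => f x.1) hd.symm }
  mem i n x hx := h.fil i n n (add_zero n) hx

lemma tateMapX_comp (h : ν.IsFiltEquiv 0 T) (hd : T ∘ₗ ν.dX V = ν.dX W ∘ₗ T)
    {T₁ : ν.X W →ₗ[S] ν.X U} (h₁ : ν.IsFiltEquiv 0 T₁) (hd₁ : T₁ ∘ₗ ν.dX W = ν.dX U ∘ₗ T₁)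
    {T₂ : ν.X V →ₗ[S] ν.X U} (h₂ : ν.IsFiltEquiv 0 T₂) (hd₂ : T₂ ∘ₗ ν.dX V = ν.dX U ∘ₗ T₂)
    (e : T₁ ∘ₗ T = T₂) : ν.tateMapX h hd ≫ ν.tateMapX h₁ hd₁ = ν.tateMapX h₂ hd₂ := by
  subst e; rfl

lemma isFiltEquiv_mapX (f : TensHom p V W) : ν.IsFiltEquiv 0 (ν.mapX f) := .act f.comm_rot f.deg

lemma tateMapX_eq_tateMap (h : ν.IsFiltEquiv 0 T) (hd : T ∘ₗ ν.dX V = ν.dX W ∘ₗ T)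
    (f : TensHom p V W) (e : T = ν.mapX f) : ν.tateMapX h hd = ν.tateMap f := by
  subst e; rfl

/-- The homotopy of maps of Tate complexes induced by a homotopy of maps of `V^{⊗ p} ⊗ P̄ ⊗ I`. -/
def tateHtpy (h : ν.IsFiltEquiv 0 T) (hd : T ∘ₗ ν.dX V = ν.dX W ∘ₗ T)
    (h' : ν.IsFiltEquiv 0 T') (hd' : T' ∘ₗ ν.dX V = ν.dX W ∘ₗ T') {H : ν.X V →ₗ[S] ν.X W}
    (hH : ν.IsFiltEquiv 1 H) (c : S) (e : T' = T + c • (ν.dX W ∘ₗ H + H ∘ₗ ν.dX V)) :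
    FiltCh.SmulHtpy c (ν.tateMapX h hd) (ν.tateMapX h' hd') where
  h n m e := H.restrict (hH.mem_invX e)
  mem n m e i y hy := hH.fil i n m e hy
  eq i y := by
    have d_succ : (ν.tateObj W).K.d (i + 1) i = _ := ν.tateCh_d W (i + 1) i rfl
    have d_pred : (ν.tateObj V).K.d i (i - 1) = _ := ν.tateCh_d V i (i - 1) (by omega)
    rw [d_succ, d_pred]
    exact Subtype.ext (congrArg (fun f => f y.1) e)

end TateComplexes

end MulResolutionData

section ChainUpTo
variable {S : Type u} [CommRing S] {V W U : Ch S}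

/-- A graded map `a` that commutes with the differentials up to `c b`. -/
structure IsChainUpTo (c : S) (a b : Tot V →ₗ[S] Tot W) : Prop where
  deg : HasDeg 0 a
  deg_htpy : HasDeg (-1) b
  comm : dTot W ∘ₗ a - a ∘ₗ dTot V = c • b

namespace IsChainUpTo
variable {c : S} {a b : Tot V →ₗ[S] Tot W}

lemma comp {a' b' : Tot W →ₗ[S] Tot U} (h' : IsChainUpTo c a' b') (h : IsChainUpTo c a b) :
    IsChainUpTo c (a' ∘ₗ a) (b' ∘ₗ a + a' ∘ₗ b) where
  deg := h'.deg.comp_zero h.deg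
  deg_htpy := (h'.deg_htpy.comp_zero h.deg).add (h'.deg.zero_comp h.deg_htpy)
  comm := by
    rw [smul_add, ← LinearMap.smul_comp, ← LinearMap.comp_smul, ← h'.comm, ← h.comm]
    ext x
    simp

lemma mapTot (c : S) (f : V ⟶ W) : IsChainUpTo c (mapTot f) 0 where
  deg := hasDeg_mapTot f
  deg_htpy := HasDeg.zero _
  comm := by rw [mapTot_dTot, sub_self, smul_zero]

lemma preservesParity (h : IsChainUpTo c a b) : PreservesParity a :=
  h.deg.preservesParity Even.zero

lemma reversesParity (h : IsChainUpTo c a b) : ReversesParity b :=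
  h.deg_htpy.reversesParity (by decide)

lemma smul_comm (h : IsChainUpTo c a b) (hc : c * c = 0) :
    c • (dTot W ∘ₗ a) = c • (a ∘ₗ dTot V) := by
  have smul_comm_sub : c • (dTot W ∘ₗ a - a ∘ₗ dTot V) = 0 := by
    rw [h.comm, smul_smul, hc, zero_smul]
  exact sub_eq_zero.1 ((smul_sub c _ _).symm.trans smul_comm_sub)

lemma smul_anticomm (h : IsChainUpTo c a b) :
    c • (dTot W ∘ₗ b) = -c • (b ∘ₗ dTot V) := by
  have dTot_dTot_apply {V : Ch S} (x : Tot V) : dTot V (dTot V x) = 0 :=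
    congrArg (· x) (dTot_dTot V)
  have comm_apply (x) : c • b x = dTot W (a x) - a (dTot V x) := congrArg (· x) h.comm.symm
  refine LinearMap.ext fun x => ?_
  simp only [LinearMap.smul_apply, LinearMap.comp_apply, neg_smul, ← map_smul (dTot W), comm_apply,
    map_sub, map_zero, dTot_dTot_apply, zero_sub, sub_zero]

end IsChainUpTo

end ChainUpTo

namespace MulResolutionData
variable {p : ℕ} (ν : MulResolutionData.{u} p) {S : Type u} [CommRing S] {V W U : Ch S}
  {a b a' b' c : Tot V →ₗ[S] Tot W}

lemma smul_contrSum_congr {k : S} {L L' : Fin p → TensPow p V →ₗ[S] TensPow p W}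
    (h : ∀ t, k • L t = k • L' t) : k • ν.contrSum L = k • ν.contrSum L' := by
  rw [← map_smul, ← map_smul]
  exact congrArg ν.contrSum (funext h)

/-- `a^{⊗ p} ⊗ 1`, corrected by a multiple of `p` so as to commute with the differentials when `a`
commutes with them up to `p b`. -/
def powX (a b : Tot V →ₗ[S] Tot W) : ν.X V →ₗ[S] ν.X W :=
  ν.act (mapTens p fun _ => a) LinearMap.id - (p : S) • ν.contrSum fun t => oddIns t a b

lemma isFiltEquiv_powX (h : IsChainUpTo (p : S) a b) : ν.IsFiltEquiv 0 (ν.powX a b) := by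
  refine .sub ?_ (.smul ?_ _)
  · exact .act (mapTens_comp_rotTens_of_preservesParity fun _ => h.preservesParity)
      (mapTens_mem_degTens_of_zero fun _ => h.deg)
  · exact .contrSum (neg_add_cancel 1) (by decide)
      (oddIns_comp_rotTens h.preservesParity h.reversesParity)
      (oddIns_mem_degTens h.deg h.deg_htpy)

lemma smul_dX_comp_contrSum_oddIns_sub (hp : (p : S) * (p : S) = 0)
    (h : IsChainUpTo (p : S) a b) :
    (p : S) • (ν.dX W ∘ₗ (ν.contrSum fun t => oddIns t a b) -
        (ν.contrSum fun t => oddIns t a b) ∘ₗ ν.dX V) =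
      (p : S) • ν.act (∑ t, oddIns t a b) LinearMap.id := by
  have smul_anticomm_eq_zero (t : Fin p) : (p : S) • (dTens p W ∘ₗ oddIns t a b -
      (-1 : S) • (oddIns t a b ∘ₗ dTens p V)) = (p : S) • 0 := by
    have := smul_dTens_comp_oddIns (p : S) h.preservesParity h.reversesParity (h.smul_comm hp)
      h.smul_anticomm t
    rw [smul_sub, this]
    module
  have dX_comp := ν.dX_comp_contrSum (e := (-1 : S)) (by ring) (L := fun t => oddIns t a b)
    fun t => by
      rw [oddIns_comp_sgnTens h.preservesParity h.reversesParity, neg_one_smul]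
  calc _ = (p : S) • (ν.dX W ∘ₗ (ν.contrSum fun t => oddIns t a b) +
        (-1 : S) • ((ν.contrSum fun t => oddIns t a b) ∘ₗ ν.dX V)) := by module
    _ = (p : S) • ν.act (∑ t, oddIns t a b) LinearMap.id - (p : S) • ν.contrSum 0 := by
      rw [dX_comp, smul_sub, ν.smul_contrSum_congr smul_anticomm_eq_zero]
      rfl
    _ = _ := by rw [map_zero, smul_zero, sub_zero]

lemma powX_comp_dX (hp : (p : S) * (p : S) = 0) (h : IsChainUpTo (p : S) a b) :
    ν.powX a b ∘ₗ ν.dX V = ν.dX W ∘ₗ ν.powX a b := by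
  have defect := ν.dX_comp_act (mapTens_comp_sgnTens (p := p) fun _ => h.preservesParity)
  have correction := ν.smul_dX_comp_contrSum_oddIns_sub hp h
  simp only [dTens_comp_mapTens_sub h.preservesParity, h.comm, map_smul, ← Finset.smul_sum,
    act_smul, ← correction, smul_sub] at defect
  rw [powX, LinearMap.sub_comp, LinearMap.comp_sub, LinearMap.smul_comp, LinearMap.comp_smul,
    eq_comm, ← sub_eq_zero, sub_sub_sub_comm, defect, sub_self]

lemma contrSum_oddIns_add :
    (ν.contrSum fun t => oddIns t a (b + b')) =
      (ν.contrSum fun t => oddIns t a b) + ν.contrSum fun t => oddIns t a b' := by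
  rw [← map_add]
  exact congrArg _ (funext fun t => map_add _ _ _)

lemma contrSum_oddIns_comp_act {g h : Tot W →ₗ[S] Tot U} (ha : PreservesParity a) :
    (ν.contrSum fun t => oddIns t g h) ∘ₗ ν.act (mapTens p fun _ => a) LinearMap.id =
      ν.contrSum fun t => oddIns t (g ∘ₗ a) (h ∘ₗ a) := by
  simp only [contrSum_comp_act, oddIns_comp_mapTens ha]

lemma act_comp_contrSum_oddIns {g : Tot W →ₗ[S] Tot U} (hg : PreservesParity g) :
    ν.act (mapTens p fun _ => g) LinearMap.id ∘ₗ (ν.contrSum fun t => oddIns t a b) =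
      ν.contrSum fun t => oddIns t (g ∘ₗ a) (g ∘ₗ b) := by
  rw [act_comp_contrSum _ (mapTens_comp_sgnTens fun _ => hg)]
  simp only [mapTens_comp_oddIns]

lemma powX_comp (hp : (p : S) * (p : S) = 0) {g h : Tot W →ₗ[S] Tot U} (ha : PreservesParity a)
    (hg : PreservesParity g) :
    ν.powX g h ∘ₗ ν.powX a b = ν.powX (g ∘ₗ a) (h ∘ₗ a + g ∘ₗ b) := by
  simp only [powX, LinearMap.sub_comp, LinearMap.comp_sub, LinearMap.smul_comp,
    LinearMap.comp_smul, smul_sub, smul_smul, hp, zero_smul, sub_zero, contrSum_oddIns_add,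
    smul_add, ν.contrSum_oddIns_comp_act ha, ν.act_comp_contrSum_oddIns hg, act_comp, mapTens_comp,
    LinearMap.id_comp]
  abel

lemma powX_mapTot (f : V ⟶ W) : ν.powX (mapTot f) 0 = ν.mapX (TensHom.ofMap p f) := by
  have oddIns_zero : (fun t : Fin p => oddIns t (mapTot f) 0) = 0 := funext fun t => map_zero _
  rw [powX, oddIns_zero, map_zero, smul_zero, sub_zero]
  rfl

/-- The homotopy between the maps `powX` of two graded maps `a` and `a + p c`. -/
def htpyX (a c : Tot V →ₗ[S] Tot W) : ν.X V →ₗ[S] ν.X W :=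
  ν.contrSum fun t => evenIns t a c

lemma isFiltEquiv_htpyX (ha : HasDeg 0 a) (hc : HasDeg 0 c) : ν.IsFiltEquiv 1 (ν.htpyX a c) := by
  refine .contrSum (zero_add 1) le_rfl (evenIns_comp_rotTens (ha.preservesParity Even.zero)
    (hc.preservesParity Even.zero)) fun t j => ?_
  rw [add_zero]
  exact evenIns_mem_degTens ha hc t j

lemma smul_dX_comp_htpyX_add (hp : (p : S) * (p : S) = 0) (h : IsChainUpTo (p : S) a b)
    (hc : PreservesParity c) :
    (p : S) • (ν.dX W ∘ₗ ν.htpyX a c + ν.htpyX a c ∘ₗ ν.dX V) =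
      (p : S) • ν.act (∑ t, evenIns t a c) LinearMap.id -
        (p : S) • ν.contrSum fun t => oddIns t a (dTot W ∘ₗ c - c ∘ₗ dTot V) := by
  have dX_comp := ν.dX_comp_contrSum (e := (1 : S)) (by ring) (L := fun t => evenIns t a c)
    fun t => by rw [evenIns_comp_sgnTens h.preservesParity hc, one_smul]
  simp only [one_smul] at dX_comp
  rw [htpyX, dX_comp, smul_sub, ν.smul_contrSum_congr
    (smul_dTens_comp_evenIns_sub (p : S) h.preservesParity hc (h.smul_comm hp))]

lemma powX_eq_of_congr (hp : (p : S) * (p : S) = 0) (h : IsChainUpTo (p : S) a b)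
    (h' : IsChainUpTo (p : S) a' b') (hc : HasDeg 0 c) (ha' : a' = a + (p : S) • c) :
    ν.powX a' b' = ν.powX a b + (p : S) • (ν.dX W ∘ₗ ν.htpyX a c + ν.htpyX a c ∘ₗ ν.dX V) := by
  have smul_a' : (p : S) • a' = (p : S) • a := by
    rw [ha', smul_add, smul_smul, hp, zero_smul, add_zero]
  have smul_b' : (p : S) • b' = (p : S) • (b + (dTot W ∘ₗ c - c ∘ₗ dTot V)) := by
    rw [← h'.comm, smul_add, ← h.comm, ha', LinearMap.comp_add, LinearMap.add_comp,
      LinearMap.comp_smul, LinearMap.smul_comp]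
    module
  have contrSum_b' : (p : S) • (ν.contrSum fun t => oddIns t a' b') =
      (p : S) • (ν.contrSum fun t => oddIns t a b) +
        (p : S) • ν.contrSum fun t => oddIns t a (dTot W ∘ₗ c - c ∘ₗ dTot V) := by
    rw [ν.smul_contrSum_congr (smul_oddIns_congr (p : S) smul_a' smul_b'),
      contrSum_oddIns_add, smul_add]
  rw [ν.smul_dX_comp_htpyX_add hp h (hc.preservesParity Even.zero), powX, powX, contrSum_b', ha',
    mapTens_const_add_smul hp, act_add, act_smul]
  abel

section Reduction
variable {V' W' : Ch S} {η : V ⟶ V'} {η' : W ⟶ W'}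

lemma smul_mapX_ofMap_eq_zero [NeZero p] (h : IsPQuot p η)
    (hV' : ∀ n (v : V'.X n), (p : S) • v = 0) :
    (p : S) • ν.mapX (TensHom.ofMap p η) = 0 := by
  have smul_eq : (p : S) • (TensHom.ofMap p η).toLin = 0 :=
    calc _ = (TensHom.ofMap p η).toLin ∘ₗ h.pLin ∘ₗ (TensHom.ofMap p η).toLin := by
          rw [h.pLin_comp, LinearMap.comp_smul, LinearMap.comp_id]
      _ = 0 := by
          rw [← LinearMap.comp_assoc, h.pHom_comp_ofMap hV' (NeZero.pos p), LinearMap.zero_comp]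
  rw [mapX, ← act_smul, smul_eq, act_zero]

lemma smul_mapX_pHom_eq_zero (hp : (p : S) * (p : S) = 0) (h : IsPQuot p η) :
    (p : S) • ν.mapX h.pHom = 0 := by
  have smul_eq : (p : S) • h.pLin = 0 := h.cancel <| by
    rw [LinearMap.smul_comp, h.pLin_comp, smul_smul, hp, zero_smul, LinearMap.zero_comp]
  rw [mapX, ← act_smul, IsPQuot.pHom_toLin, smul_eq, act_zero]

variable {g : V' ⟶ W'} (hg : mapTot η' ∘ₗ a = mapTot g ∘ₗ mapTot η)
include hg

lemma mapX_comp_powX [NeZero p] (hη' : IsPQuot p η') (hW' : ∀ n (w : W'.X n), (p : S) • w = 0) :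
    ν.mapX (TensHom.ofMap p η') ∘ₗ ν.powX a b =
      ν.mapX (TensHom.ofMap p g) ∘ₗ ν.mapX (TensHom.ofMap p η) := by
  rw [powX, LinearMap.comp_sub, LinearMap.comp_smul, ← LinearMap.smul_comp,
    ν.smul_mapX_ofMap_eq_zero hη' hW', LinearMap.zero_comp, sub_zero]
  simp only [mapX, act_comp, TensHom.ofMap_toLin, mapTens_comp, hg]

lemma mapTens_comp_pLin (hη : IsPQuot p η) (hη' : IsPQuot p η') :
    (mapTens p fun _ => a) ∘ₗ hη.pLin = hη'.pLin ∘ₗ (TensHom.ofMap p g).toLin := by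
  have comm : (TensHom.ofMap p g).toLin ∘ₗ (TensHom.ofMap p η).toLin =
      (TensHom.ofMap p η').toLin ∘ₗ mapTens p fun _ => a := by
    simp only [TensHom.ofMap_toLin, mapTens_comp, hg]
  refine hη.cancel ?_
  rw [LinearMap.comp_assoc, hη.pLin_comp, LinearMap.comp_assoc, comm, ← LinearMap.comp_assoc,
    hη'.pLin_comp, LinearMap.comp_smul, LinearMap.smul_comp]
  rfl

lemma powX_comp_mapX_pHom (hp : (p : S) * (p : S) = 0) (hη : IsPQuot p η) (hη' : IsPQuot p η') :
    ν.powX a b ∘ₗ ν.mapX hη.pHom = ν.mapX hη'.pHom ∘ₗ ν.mapX (TensHom.ofMap p g) := by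
  rw [powX, LinearMap.sub_comp, LinearMap.smul_comp, ← LinearMap.comp_smul,
    ν.smul_mapX_pHom_eq_zero hp hη, LinearMap.comp_zero, sub_zero]
  simp only [mapX, act_comp, IsPQuot.pHom_toLin, mapTens_comp_pLin hg hη hη']

end Reduction

end MulResolutionData

section GradedLift
variable {S : Type u} [CommRing S] {V V' W : Ch S} [∀ n, Module.Projective S (V.X n)] {k : ℤ}
  {F : Tot V →ₗ[S] Tot W}

lemma exists_hasDeg_mapTot_comp_eq {η : V' ⟶ W}
    (hF : ∀ n (v : V.X n), ∃ w : V'.X (n + k), mapTot η (inc V' (n + k) w) = F (inc V n v)) :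
    ∃ a : Tot V →ₗ[S] Tot V', HasDeg k a ∧ mapTot η ∘ₗ a = F := by
  let component (n : ℤ) : V.X n →ₗ[S] W.X (n + k) :=
    DirectSum.component S ℤ (fun m => W.X m) (n + k) ∘ₗ F ∘ₗ inc V n
  have component_eq (n : ℤ) (v : V.X n) (w : V'.X (n + k))
      (hw : mapTot η (inc V' (n + k) w) = F (inc V n v)) :
      (η.f (n + k)).hom w = component n v := by
    rw [LinearMap.comp_apply, LinearMap.comp_apply, ← hw, mapTot_inc, inc,
      DirectSum.component.lof_self]
  have component_mem_range (n : ℤ) (v : V.X n) :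
      component n v ∈ LinearMap.range (η.f (n + k)).hom :=
    (hF n v).imp (component_eq n v)
  choose a ha using fun n => Module.projective_lifting_property (η.f (n + k)).hom.rangeRestrict
    ((component n).codRestrict _ (component_mem_range n)) (LinearMap.surjective_rangeRestrict _)
  have a_apply (n : ℤ) (v : V.X n) : (η.f (n + k)).hom (a n v) = component n v :=
    congrArg (fun f => (f v).1) (ha n)
  refine ⟨DirectSum.toModule S ℤ _ fun n => inc V' (n + k) ∘ₗ a n,
    fun n v => ⟨a n v, by simp [DirectSum.toModule_lof]⟩, tot_ext _ fun n v => ?_⟩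
  obtain ⟨w, hw⟩ := hF n v
  rw [LinearMap.comp_apply, inc, DirectSum.toModule_lof, LinearMap.comp_apply, mapTot_inc, a_apply,
    ← component_eq n v w hw, ← mapTot_inc, hw]

lemma HasDeg.exists_mapTot_comp_eq {η : V' ⟶ W} (hη : ∀ n, Function.Surjective (η.f n).hom)
    (hF : HasDeg k F) : ∃ a : Tot V →ₗ[S] Tot V', HasDeg k a ∧ mapTot η ∘ₗ a = F :=
  exists_hasDeg_mapTot_comp_eq fun n v => by
    obtain ⟨w', hw'⟩ := hF n v
    obtain ⟨w, rfl⟩ := hη _ w'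
    exact ⟨w, by rw [mapTot_inc, hw']⟩

lemma HasDeg.exists_eq_smul {F : Tot V →ₗ[S] Tot V'} {η : V' ⟶ W} {c : S}
    (hη : ∀ n v, (η.f n).hom v = 0 → ∃ w : V'.X n, c • w = v) (hF : HasDeg k F)
    (hηF : mapTot η ∘ₗ F = 0) : ∃ a, HasDeg k a ∧ F = c • a := by
  have mapTot_smul_id : mapTot (c • 𝟙 V') = c • LinearMap.id := tot_ext _ fun n v => by simp
  obtain ⟨a, ha, rfl⟩ := exists_hasDeg_mapTot_comp_eq (F := F) (η := c • 𝟙 V') (k := k)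
    fun n v => by
      obtain ⟨w', hw'⟩ := hF n v
      have red_w' : (η.f (n + k)).hom w' = 0 := by
        have := congrArg (DirectSum.component S ℤ (fun m => W.X m) (n + k))
          (congrArg (· (inc V n v)) hηF)
        simpa [← hw'] using this
      obtain ⟨w, rfl⟩ := hη _ _ red_w'
      exact ⟨w, by simp [mapTot_smul_id, ← hw']⟩
  exact ⟨a, ha, by rw [mapTot_smul_id]; rfl⟩

end GradedLift

section Witt
variable (p : ℕ) [Fact p.Prime] (R : Type u) [CommRing R] [CharP R p]

lemma natCast_mul_self_eq_zero : (p : W2 p R) * (p : W2 p R) = 0 :=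
  p_mul_eq_zero p R p (by rw [map_natCast, CharP.cast_eq_zero])

lemma exists_eq_mul_natCast [PerfectRing R p] {x : W2 p R} (hx : resid p R x = 0) :
    ∃ y : W2 p R, x = y * (p : W2 p R) := by
  obtain ⟨a, rfl⟩ := WittVector.truncate_surjective p 2 R x
  have coeff_zero : a.coeff 0 = 0 := (WittVector.coeff_truncate a 0).symm.trans hx
  obtain ⟨r, hr⟩ := surjective_frobenius R p (a.coeff 1)
  refine ⟨WittVector.truncate 2 (WittVector.mk p fun _ => r), ?_⟩
  rw [← map_natCast (WittVector.truncate 2 : WittVector p R →+* _), ← map_mul]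
  refine TruncatedWittVector.ext fun i => ?_
  rw [WittVector.coeff_truncate, WittVector.coeff_truncate]
  fin_cases i
  · exact coeff_zero.trans (WittVector.mul_charP_coeff_zero _).symm
  · refine Eq.trans ?_ (WittVector.mul_charP_coeff_succ _ 0).symm
    rw [WittVector.coeff_mk, ← frobenius_def]
    exact hr.symm

variable {p R}

/-- The quotient map `V → V/p`. -/
abbrev redMap {R : Type u} [CommRing R] (V : Ch (W2 p R)) :
    V ⟶ (qLow p R).obj ((qUp p R).obj V) := (toQuot p R).app V

lemma exists_natCast_smul_eq_of_redMap_eq_zero [PerfectRing R p] (V : Ch (W2 p R)) (n : ℤ)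
    (v : V.X n) (hv : ((redMap V).f n).hom v = 0) : ∃ w : V.X n, (p : W2 p R) • w = v := by
  let residLin : W2 p R →ₗ[W2 p R]
      (ModuleCat.restrictScalars (resid p R)).obj (ModuleCat.of R R) :=
    { toFun := resid p R, map_add' := map_add (resid p R), map_smul' := map_mul (resid p R) }
  have exact_mul : Function.Exact (LinearMap.mulRight (W2 p R) (p : W2 p R)) residLin := by
    refine fun x => ⟨fun hx => ?_, ?_⟩
    · obtain ⟨y, rfl⟩ := exists_eq_mul_natCast p R hx
      exact ⟨y, rfl⟩
    · rintro ⟨y, rfl⟩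
      change resid p R (y * p) = 0
      rw [map_mul, map_natCast, CharP.cast_eq_zero, mul_zero]
  have residLin_surjective : Function.Surjective residLin := resid_surjective p R
  obtain ⟨z, hz⟩ := (rTensor_exact (V.X n) exact_mul residLin_surjective (1 ⊗ₜ v)).1 <| by
    rw [LinearMap.rTensor_tmul]
    refine (congrArg (· ⊗ₜ[W2 p R] v) ?_).trans hv
    exact map_one (resid p R)
  refine ⟨TensorProduct.lid _ _ z, ?_⟩
  have lid_rTensor : (TensorProduct.lid _ (V.X n)).toLinearMap ∘ₗ
      (LinearMap.mulRight (W2 p R) (p : W2 p R)).rTensor (V.X n) =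
      (p : W2 p R) • (TensorProduct.lid _ (V.X n)).toLinearMap :=
    TensorProduct.ext' fun x y => by simp [mul_comm x, mul_smul]
  calc _ = TensorProduct.lid _ _ ((LinearMap.mulRight _ (p : W2 p R)).rTensor (V.X n) z) :=
        congrArg (· z) lid_rTensor.symm
    _ = v := by rw [hz, TensorProduct.lid_tmul, one_smul]

end Witt

section Lift
variable {p : ℕ} [Fact p.Prime] {R : Type u} [CommRing R] {V V' V'' : Ch (W2 p R)}

/-- The pair `a, b` consists of a graded map lifting a map `f : V/p → V'/p` of complexes and of a
witness that it commutes with the differentials modulo `p`. -/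
structure IsLift (f : (qUp p R).obj V ⟶ (qUp p R).obj V') (a b : Tot V →ₗ[W2 p R] Tot V') :
    Prop where
  chain : IsChainUpTo (p : W2 p R) a b
  red : mapTot (redMap V') ∘ₗ a = mapTot ((qLow p R).map f) ∘ₗ mapTot (redMap V)

variable {f : (qUp p R).obj V ⟶ (qUp p R).obj V'} {a b a' b' : Tot V →ₗ[W2 p R] Tot V'}

lemma isLift_mapTot (φ : V ⟶ V') : IsLift ((qUp p R).map φ) (mapTot φ) 0 where
  chain := IsChainUpTo.mapTot _ φ
  red := by
    rw [← mapTot_comp, ← mapTot_comp]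
    exact congrArg mapTot ((toQuot p R).naturality φ)

lemma IsLift.comp {f' : (qUp p R).obj V' ⟶ (qUp p R).obj V''}
    {a' b' : Tot V' →ₗ[W2 p R] Tot V''} (h : IsLift f a b) (h' : IsLift f' a' b') :
    IsLift (f ≫ f') (a' ∘ₗ a) (b' ∘ₗ a + a' ∘ₗ b) where
  chain := h'.chain.comp h.chain
  red := by
    rw [← LinearMap.comp_assoc, h'.red, LinearMap.comp_assoc, h.red, ← LinearMap.comp_assoc,
      ← mapTot_comp, Functor.map_comp]

variable [CharP R p] [PerfectRing R p] [∀ n, Module.Projective (W2 p R) (V.X n)]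

lemma exists_isLift (f : (qUp p R).obj V ⟶ (qUp p R).obj V') : ∃ a b, IsLift f a b := by
  obtain ⟨a, ha, red_a⟩ := HasDeg.exists_mapTot_comp_eq (V' := V') (η := redMap V')
    (toQuot_surj p R V')
    ((hasDeg_mapTot ((qLow p R).map f)).comp_zero (hasDeg_mapTot (redMap V)))
  have hasDeg_defect : HasDeg (-1) (dTot V' ∘ₗ a - a ∘ₗ dTot V) :=
    (hasDeg_dTot.comp_zero ha).sub (ha.zero_comp hasDeg_dTot)
  have red_defect : mapTot (redMap V') ∘ₗ (dTot V' ∘ₗ a - a ∘ₗ dTot V) = 0 := by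
    rw [LinearMap.comp_sub, ← LinearMap.comp_assoc, ← LinearMap.comp_assoc, mapTot_dTot, red_a,
      LinearMap.comp_assoc, red_a, LinearMap.comp_assoc, mapTot_dTot, ← LinearMap.comp_assoc,
      ← mapTot_dTot, LinearMap.comp_assoc, sub_self]
  obtain ⟨b, hb, defect_eq⟩ :=
    hasDeg_defect.exists_eq_smul (exists_natCast_smul_eq_of_redMap_eq_zero V') red_defect
  exact ⟨a, b, ⟨ha, hb, defect_eq⟩, red_a⟩

lemma IsLift.exists_eq_add_smul (h : IsLift f a b) (h' : IsLift f a' b') :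
    ∃ c, HasDeg 0 c ∧ a' = a + (p : W2 p R) • c := by
  obtain ⟨c, hc, sub_eq⟩ := (h'.chain.deg.sub h.chain.deg).exists_eq_smul
    (exists_natCast_smul_eq_of_redMap_eq_zero V')
    (by rw [LinearMap.comp_sub, h.red, h'.red, sub_self])
  exact ⟨c, hc, sub_eq_iff_eq_add'.1 sub_eq⟩

end Lift

namespace MulResolutionData
variable {p : ℕ} [Fact p.Prime] (ν : MulResolutionData.{u} p) {R : Type u} [CommRing R]
  {V V' V'' : Ch (W2 p R)}

section Ext
variable {ν} {K : Ch (W2 p R)}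

lemma cr_hom_ext {φ ψ : K ⟶ (ν.cr R).obj V}
    (h : ∀ n x, (ν.crSub R V n).subtype ((φ.f n).hom x) =
      (ν.crSub R V n).subtype ((ψ.f n).hom x)) : φ = ψ :=
  HomologicalComplex.hom_ext _ _ fun n => ModuleCat.hom_ext <|
    LinearMap.ext fun x => Subtype.ext (h n x)

variable [CharP R p]

lemma cl_hom_ext {φ ψ : (ν.cl R).obj V ⟶ K}
    (h : ∀ n x, (φ.f n).hom ((ν.clSub R V n).mkQ x) = (ψ.f n).hom ((ν.clSub R V n).mkQ x)) :
    φ = ψ :=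
  HomologicalComplex.hom_ext _ _ fun n => ModuleCat.hom_ext <|
    Submodule.linearMap_qext _ <| LinearMap.ext (h n)

end Ext

variable {f : (qUp p R).obj V ⟶ (qUp p R).obj V'}
  {f' : (qUp p R).obj V' ⟶ (qUp p R).obj V''} {a b a₁ b₁ : Tot V →ₗ[W2 p R] Tot V'}
  {a' b' : Tot V' →ₗ[W2 p R] Tot V''} [CharP R p]

lemma tateMap_pHom_tateMap_redMap (i : ℤ) (y : (ν.tateObj V).K.X i) :
    ((ν.tateMap (toQuot_isPQuot p R V).pHom).f.f i).hom
      (((ν.tateMap (TensHom.ofMap p (redMap V))).f.f i).hom y) = (p : W2 p R) • y := by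
  refine Subtype.ext ?_
  have comp_eq : ν.mapX (toQuot_isPQuot p R V).pHom ∘ₗ ν.mapX (TensHom.ofMap p (redMap V)) =
      (p : W2 p R) • LinearMap.id := by
    rw [mapX, mapX, act_comp, IsPQuot.pHom_toLin, (toQuot_isPQuot p R V).pLin_comp, act_smul]
    exact congrArg ((p : W2 p R) • ·)
      (TensorProduct.AlgebraTensorModule.map_id (R := ℤ) (A := W2 p R))
  exact congrArg (· y.1) comp_eq

/-- The map of Tate complexes given by the corrected `p`-th power of a lift `a` of `f`. -/
def liftTate (h : IsLift f a b) : ν.tateObj V ⟶ ν.tateObj V' :=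
  ν.tateMapX (ν.isFiltEquiv_powX h.chain)
    (ν.powX_comp_dX (natCast_mul_self_eq_zero p R) h.chain)

/-- The map `C(V) → C(V')` induced by a lift of `f : V/p → V'/p`. -/
def liftC (h : IsLift f a b) : ν.C V ⟶ ν.C V' := (FiltCh.trunc01 _).map (ν.liftTate h)

lemma liftC_comp (h : IsLift f a b) (h' : IsLift f' a' b') :
    ν.liftC (h.comp h') = ν.liftC h ≫ ν.liftC h' := by
  refine Eq.trans (congrArg (FiltCh.trunc01 _).map ?_) ((FiltCh.trunc01 _).map_comp _ _)
  exact (ν.tateMapX_comp _ _ _ _ _ _ (ν.powX_comp (natCast_mul_self_eq_zero p R)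
    h.chain.preservesParity h'.chain.preservesParity)).symm

lemma liftC_isLift_mapTot (φ : V ⟶ V') :
    ν.liftC (isLift_mapTot φ) = ν.CMap (TensHom.ofMap p φ) :=
  congrArg (FiltCh.trunc01 _).map (ν.tateMapX_eq_tateMap _ _ _ (ν.powX_mapTot φ))

lemma liftC_comp_qMap (h : IsLift f a b) :
    ν.liftC h ≫ ν.qMap R V' = ν.qMap R V ≫ ν.CMap (TensHom.ofMap p ((qLow p R).map f)) := by
  have : NeZero p := ⟨(Fact.out : p.Prime).ne_zero⟩
  rw [qMap, qMap, ← CMap_comp, CMap, CMap, liftC]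
  refine ((FiltCh.trunc01 _).map_comp _ _).symm.trans (congrArg (FiltCh.trunc01 _).map ?_)
  refine ν.tateMapX_comp _ _ (ν.isFiltEquiv_mapX _) (ν.mapX_dX _) (ν.isFiltEquiv_mapX _)
    (ν.mapX_dX _) ?_
  exact (ν.mapX_comp_powX h.red (toQuot_isPQuot p R V') (qLow_kill p R _)).trans
    (ν.act_comp _ _ _ _)

lemma pMap_comp_liftC (h : IsLift f a b) :
    ν.pMap R V ≫ ν.liftC h = ν.CMap (TensHom.ofMap p ((qLow p R).map f)) ≫ ν.pMap R V' := by
  rw [pMap, pMap, ← CMap_comp, CMap, CMap, liftC]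
  refine ((FiltCh.trunc01 _).map_comp _ _).symm.trans (congrArg (FiltCh.trunc01 _).map ?_)
  refine ν.tateMapX_comp (ν.isFiltEquiv_mapX _) (ν.mapX_dX _) _ _ (ν.isFiltEquiv_mapX _)
    (ν.mapX_dX _) ?_
  exact (ν.powX_comp_mapX_pHom h.red (natCast_mul_self_eq_zero p R) (toQuot_isPQuot p R V)
    (toQuot_isPQuot p R V')).trans (ν.act_comp _ _ _ _)

/-- The map `C^l(V) → C^l(V')` induced by a lift of `f : V/p → V'/p`. -/
def liftCl (h : IsLift f a b) : (ν.cl R).obj V ⟶ (ν.cl R).obj V' :=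
  quotChMap (ν.liftC h).f <| by
    rintro n _ ⟨x, hx, rfl⟩
    exact ⟨_, FiltCh.leSub_map (ν.CMap (TensHom.ofMap p ((qLow p R).map f))) 0 n hx,
      (congrArg (fun g => (g.f.f n).hom x) (ν.pMap_comp_liftC h)).symm⟩

/-- The map `C^r(V) → C^r(V')` induced by a lift of `f : V/p → V'/p`. -/
def liftCr (h : IsLift f a b) : (ν.cr R).obj V ⟶ (ν.cr R).obj V' :=
  subChMap (ν.liftC h).f fun n x hx =>
    (congrArg (· ∈ (ν.C (modp R V')).geSub 1 n)
      (congrArg (fun g => (g.f.f n).hom x) (ν.liftC_comp_qMap h))).mpr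
      (FiltCh.geSub_map (ν.CMap (TensHom.ofMap p ((qLow p R).map f))) 1 n hx)

lemma liftCl_comp (h : IsLift f a b) (h' : IsLift f' a' b') :
    ν.liftCl (h.comp h') = ν.liftCl h ≫ ν.liftCl h' :=
  cl_hom_ext fun n x => congrArg (fun g => (ν.clSub R V'' n).mkQ ((g.f.f n).hom x))
    (ν.liftC_comp h h')

lemma liftCr_comp (h : IsLift f a b) (h' : IsLift f' a' b') :
    ν.liftCr (h.comp h') = ν.liftCr h ≫ ν.liftCr h' :=
  cr_hom_ext fun n x => congrArg (fun g => (g.f.f n).hom x.1) (ν.liftC_comp h h')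

lemma liftCl_isLift_mapTot (φ : V ⟶ V') : ν.liftCl (isLift_mapTot φ) = (ν.cl R).map φ :=
  cl_hom_ext fun n x => congrArg (fun g => (ν.clSub R V' n).mkQ ((g.f.f n).hom x))
    (ν.liftC_isLift_mapTot φ)

lemma liftCr_isLift_mapTot (φ : V ⟶ V') : ν.liftCr (isLift_mapTot φ) = (ν.cr R).map φ :=
  cr_hom_ext fun n x => congrArg (fun g => (g.f.f n).hom x.1) (ν.liftC_isLift_mapTot φ)

lemma liftCl_comp_clTo (h : IsLift f a b) :
    ν.liftCl h ≫ (ν.clTo R).app V' = (ν.clTo R).app V ≫ (ν.cycR R).map f :=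
  cl_hom_ext fun n x => congrArg (fun g => (g.f.f n).hom x) (ν.liftC_comp_qMap h)

lemma toCr_comp_liftCr (h : IsLift f a b) :
    (ν.toCr R).app V ≫ ν.liftCr h = (ν.cycR R).map f ≫ (ν.toCr R).app V' :=
  cr_hom_ext fun n x => congrArg (fun g => (g.f.f n).hom x) (ν.pMap_comp_liftC h)

variable [PerfectRing R p] [∀ n, Module.Projective (W2 p R) (V.X n)]

lemma nonempty_smulHtpy_liftTate (h : IsLift f a b) (h₁ : IsLift f a₁ b₁) :
    Nonempty (FiltCh.SmulHtpy (p : W2 p R) (ν.liftTate h) (ν.liftTate h₁)) := by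
  obtain ⟨c, hc, eq_add⟩ := h.exists_eq_add_smul h₁
  exact ⟨ν.tateHtpy _ _ _ _ (ν.isFiltEquiv_htpyX h.chain.deg hc) _
    (ν.powX_eq_of_congr (natCast_mul_self_eq_zero p R) h.chain h₁.chain hc eq_add)⟩

lemma liftCl_unique (h : IsLift f a b) (h₁ : IsLift f a₁ b₁) : ν.liftCl h = ν.liftCl h₁ := by
  obtain ⟨H⟩ := ν.nonempty_smulHtpy_liftTate h h₁
  exact cl_hom_ext fun n x => Eq.symm <| (Submodule.Quotient.eq (ν.clSub R V' n)).2 <|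
    H.map_sub_map_mem_map_leSub (ν.tateMap (TensHom.ofMap p (redMap V')))
      (ν.tateMap (toQuot_isPQuot p R V').pHom) ν.tateMap_pHom_tateMap_redMap x

lemma liftCr_unique (h : IsLift f a b) (h₁ : IsLift f a₁ b₁) : ν.liftCr h = ν.liftCr h₁ := by
  obtain ⟨H⟩ := ν.nonempty_smulHtpy_liftTate h h₁
  exact cr_hom_ext fun _ x => Eq.symm <|
    H.map_eq_map_of_mem_geSub (ν.tateMap (TensHom.ofMap p (redMap V)))
      (ν.tateMap (toQuot_isPQuot p R V).pHom) ν.tateMap_pHom_tateMap_redMap x.1 x.2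

end MulResolutionData

section AdaptedBasis

lemma exists_linearIndepOn_isCompl_span {K V : Type*} [DivisionRing K] [AddCommGroup V]
    [Module K V] (U : Submodule K V) :
    ∃ q : Set V, LinearIndepOn K id q ∧ IsCompl U (Submodule.span K q) := by
  obtain ⟨U', hU'⟩ := U.exists_isCompl
  obtain ⟨q, -, span_q, linearIndep_q⟩ := exists_linearIndependent K (U' : Set V)
  exact ⟨q, linearIndep_q, by rwa [span_q, Submodule.span_eq]⟩

lemma exists_linearIndepOn_span_eq_ker {K V₁ V₂ V₃ : Type*} [DivisionRing K] [AddCommGroup V₁]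
    [Module K V₁] [AddCommGroup V₂] [Module K V₂] [AddCommGroup V₃] [Module K V₃]
    {f : V₁ →ₗ[K] V₂} {g : V₂ →ₗ[K] V₃} (hgf : ∀ x, g (f x) = 0) {q : Set V₁}
    (hq : LinearIndepOn K id q) (hqf : Disjoint (LinearMap.ker f) (Submodule.span K q)) :
    ∃ t : Set V₂, LinearIndepOn K id t ∧ Submodule.span K t = LinearMap.ker g ∧
      ∀ x ∈ q, f x ∈ t := by
  obtain ⟨t, t_le_ker, image_subset_t, ker_le_span, linearIndep_t⟩ :=
    exists_linearIndepOn_id_extension (t := (LinearMap.ker g : Set V₂))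
      (hq.image (f := f) (by simpa using hqf.symm)) (by rintro _ ⟨x, -, rfl⟩; exact hgf x)
  exact ⟨t, linearIndep_t, le_antisymm (Submodule.span_le.2 t_le_ker) ker_le_span,
    fun x hx => image_subset_t ⟨x, hx, rfl⟩⟩

/-- A family of bases of the terms of a complex is adapted if the differential sends every basis
vector to zero or to a basis vector. -/
def IsAdapted {S : Type u} [CommRing S] {W : Ch S} {J : ℤ → Type*}
    (b : ∀ n, Module.Basis (J n) S (W.X n)) : Prop :=
  ∀ n m x, (W.d n m).hom (b n x) = 0 ∨ ∃ y, (W.d n m).hom (b n x) = b m y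

lemma exists_isAdapted {K : Type u} [Field K] (W : Ch K) :
    ∃ (J : ℤ → Type u) (b : ∀ n, Module.Basis (J n) K (W.X n)), IsAdapted b := by
  choose q linearIndep_q isCompl_q using fun n =>
    exists_linearIndepOn_isCompl_span (LinearMap.ker (W.d n (n - 1)).hom)
  have exists_cycles (n m : ℤ) (h : m = n + 1) : ∃ t : Set (W.X n), LinearIndepOn K id t ∧
      Submodule.span K t = LinearMap.ker (W.d n (n - 1)).hom ∧
      ∀ x ∈ q m, (W.d m n).hom x ∈ t := by
    obtain rfl : n = m - 1 := by lia
    exact exists_linearIndepOn_span_eq_ker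
      (fun x => congrArg (fun f => f.hom x) (W.d_comp_d m (m - 1) (m - 1 - 1))) (linearIndep_q m)
      (isCompl_q m).disjoint
  choose t linearIndep_t span_t d_mem_t using fun n => exists_cycles n _ rfl
  have linearIndep (n : ℤ) : LinearIndepOn K id (t n ∪ q n) :=
    (linearIndep_t n).id_union (linearIndep_q n) (by rw [span_t]; exact (isCompl_q n).disjoint)
  have span_eq_top (n : ℤ) : Submodule.span K (t n ∪ q n) = ⊤ := by
    rw [Submodule.span_union, span_t, (isCompl_q n).sup_eq_top]
  let b (n : ℤ) : Module.Basis ↥(t n ∪ q n) K (W.X n) :=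
    Module.Basis.mk (linearIndep n) (by simp only [id_eq, Subtype.range_coe, span_eq_top, le_refl])
  have b_apply (n : ℤ) (x : ↥(t n ∪ q n)) : b n x = x := Module.Basis.mk_apply _ _ x
  refine ⟨fun n => ↥(t n ∪ q n), b, fun n m x => ?_⟩
  simp only [b_apply]
  by_cases hnm : m + 1 = n
  · rcases x.2 with hx | hx
    · obtain rfl : m = n - 1 := by lia
      exact .inl <| (span_t n).le (Submodule.subset_span hx)
    · subst hnm
      exact .inr ⟨⟨_, .inl (d_mem_t m _ hx)⟩, rfl⟩
  · exact .inl <| congrArg (fun f => f.hom x.1) (W.shape n m hnm)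

end AdaptedBasis

section WittLift
variable (p : ℕ) [Fact p.Prime] {R : Type u} [CommRing R]

/-- The Teichmüller representatives in `W_2(R)`. -/
def teichmuller (r : R) : W2 p R := WittVector.truncate 2 (WittVector.teichmuller p r)

lemma teichmuller_zero : teichmuller p (0 : R) = 0 := by
  rw [teichmuller, WittVector.teichmuller_zero, map_zero]

lemma resid_teichmuller (r : R) : resid p R (teichmuller p r) = r :=
  (WittVector.coeff_truncate (WittVector.teichmuller p r) (0 : Fin 2)).trans
    (WittVector.teichmuller_coeff_zero p r)

variable {W : Ch R} {J : ℤ → Type u} (b : ∀ n, Module.Basis (J n) R (W.X n))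

/-- The Teichmüller lift of the matrix of a differential of `W`. -/
def wittDiff (n m : ℤ) : (J n →₀ W2 p R) →ₗ[W2 p R] J m →₀ W2 p R :=
  Finsupp.linearCombination (W2 p R) fun x =>
    ((b m).repr ((W.d n m).hom (b n x))).mapRange (teichmuller p) (teichmuller_zero p)

variable {p b} in
lemma wittDiff_single (n m : ℤ) (x : J n) :
    wittDiff p b n m (Finsupp.single x 1) =
      ((b m).repr ((W.d n m).hom (b n x))).mapRange (teichmuller p) (teichmuller_zero p) := by
  rw [wittDiff, Finsupp.linearCombination_single, one_smul]

lemma wittDiff_eq_zero {n m : ℤ} (h : ∀ x, (W.d n m).hom (b n x) = 0) : wittDiff p b n m = 0 :=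
  Finsupp.lhom_ext' fun x => LinearMap.ext_ring <| by
    simp [wittDiff_single, h]

variable {b}

/-- A complex over `W_2(R)` lifting a complex over `R` that has an adapted basis. -/
def wittLift (hb : IsAdapted b) : Ch (W2 p R) where
  X n := ModuleCat.of _ (J n →₀ W2 p R)
  d n m := ModuleCat.ofHom (wittDiff p b n m)
  shape n m h := by
    rw [wittDiff_eq_zero p b fun x => by rw [W.shape n m h]; rfl, ModuleCat.ofHom_zero]
  d_comp_d' n m l _ _ := by
    have d_d (v : W.X n) : (W.d m l).hom ((W.d n m).hom v) = 0 :=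
      congrArg (fun f => f.hom v) (W.d_comp_d n m l)
    refine ModuleCat.hom_ext <| Finsupp.lhom_ext' fun x => LinearMap.ext_ring ?_
    change wittDiff p b m l (wittDiff p b n m (Finsupp.single x 1)) = 0
    rw [wittDiff_single]
    rcases hb n m x with hx | ⟨y, hy⟩
    · simp [hx]
    · have d_basis_y : (W.d m l).hom (b m y) = 0 := hy ▸ d_d (b n x)
      simp [hy, wittDiff, d_basis_y]

variable (hb : IsAdapted b)

/-- The basis of the reduction of `wittLift p hb` modulo `p`. -/
def wittLiftBasis (n : ℤ) : Module.Basis (J n) R (((qUp p R).obj (wittLift p hb)).X n) :=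
  letI : Algebra (W2 p R) R := (resid p R).toAlgebra
  Module.Basis.baseChange R (Finsupp.basisSingleOne (ι := J n) (R := W2 p R))

lemma wittLiftBasis_apply (n : ℤ) (x : J n) :
    wittLiftBasis p hb n x =
      ((redMap (wittLift p hb)).f n).hom (Finsupp.single x 1 : J n →₀ W2 p R) := by
  let : Algebra (W2 p R) R := (resid p R).toAlgebra
  refine (Module.Basis.baseChange_apply R
    (Finsupp.basisSingleOne (ι := J n) (R := W2 p R)) x).trans ?_
  rw [Finsupp.coe_basisSingleOne]
  rfl

lemma wittLiftBasis_repr_redMap (n : ℤ) (z : J n →₀ W2 p R) (i : J n) :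
    (wittLiftBasis p hb n).repr (((redMap (wittLift p hb)).f n).hom z) i = resid p R (z i) := by
  let : Algebra (W2 p R) R := (resid p R).toAlgebra
  exact (Module.Basis.baseChange_repr_tmul R
    (Finsupp.basisSingleOne (ι := J n) (R := W2 p R)) 1 z i).trans (mul_one (resid p R (z i)))

lemma wittLiftBasis_repr_d (n m : ℤ) (x : J n) :
    (wittLiftBasis p hb m).repr
        ((((qUp p R).obj (wittLift p hb)).d n m).hom (wittLiftBasis p hb n x)) =
      (b m).repr ((W.d n m).hom (b n x)) := by
  have d_redMap : (((qUp p R).obj (wittLift p hb)).d n m).hom (wittLiftBasis p hb n x) =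
      ((redMap (wittLift p hb)).f m).hom (wittDiff p b n m (Finsupp.single x 1)) := by
    rw [wittLiftBasis_apply]
    exact congrArg (fun f => f.hom (Finsupp.single x 1 : J n →₀ W2 p R))
      ((redMap (wittLift p hb)).comm n m)
  ext i
  rw [d_redMap, wittLiftBasis_repr_redMap, wittDiff_single, Finsupp.mapRange_apply,
    resid_teichmuller]

/-- The reduction of `wittLift p hb` modulo `p` is the original complex. -/
def wittLiftIso : (qUp p R).obj (wittLift p hb) ≅ W :=
  HomologicalComplex.Hom.isoOfComponents
    (fun n => ((wittLiftBasis p hb n).repr ≪≫ₗ (b n).repr.symm).toModuleIso) fun n m _ =>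
      ModuleCat.hom_ext <| (wittLiftBasis p hb n).ext fun x => by
        simp [wittLiftBasis_repr_d]

end WittLift

instance qPull_essSurj (p : ℕ) [Fact p.Prime] (K : Type u) [Field K] :
    (qPull p K).EssSurj where
  mem_essImage W := by
    obtain ⟨J, b, hb⟩ := exists_isAdapted W.obj
    obtain ⟨finite_projective, N, subsingleton_of_gt⟩ := W.property
    have (n : ℤ) : Finite (J n) :=
      have := (finite_projective n).1
      Module.Finite.finite_basis (b n)
    refine ⟨⟨wittLift p hb, fun n => ⟨?_, ?_⟩, N, fun n hn => ?_⟩,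
      ⟨(isPf K).isoMk (wittLiftIso p hb)⟩⟩
    · exact inferInstanceAs (Module.Finite (W2 p K) (J n →₀ W2 p K))
    · exact inferInstanceAs (Module.Projective (W2 p K) (J n →₀ W2 p K))
    · have := subsingleton_of_gt n hn
      have : IsEmpty (J n) := ⟨fun x => (b n).ne_zero x (Subsingleton.elim _ _)⟩
      exact inferInstanceAs (Subsingleton (J n →₀ W2 p K))

section Factorization
variable {A A' B E : Type*} [Category* A] [Category* A'] [Category* B] [Category* E] (T : A ⥤ A')
  (I : A' ≌ B) {K : A ⥤ E} {K' : A' ⥤ E} (κ : T ⋙ K' ≅ K) {C : B ⥤ E}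

lemma exists_factorization_to {L : K ⟶ (T ⋙ I.functor) ⋙ C} {L' : K' ⟶ I.functor ⋙ C}
    (hL : κ.hom ≫ L = Functor.whiskerLeft T L') :
    ∃ (F : B ⥤ E) (e : (T ⋙ I.functor) ⋙ F ≅ K) (l : F ⟶ C),
      e.hom ≫ L = Functor.whiskerLeft (T ⋙ I.functor) l := by
  refine ⟨I.inverse ⋙ K',
    Functor.isoWhiskerLeft T (Functor.isoWhiskerRight I.unitIso.symm K') ≪≫ κ,
    Functor.whiskerLeft I.inverse L' ≫ Functor.whiskerRight I.counit C, ?_⟩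
  ext X
  have hLX : κ.hom.app X ≫ L.app X = L'.app (T.obj X) := congr_app hL X
  simp [hLX, I.counit_app_functor]

lemma exists_factorization_from {r : (T ⋙ I.functor) ⋙ C ⟶ K} {r' : I.functor ⋙ C ⟶ K'}
    (hr : Functor.whiskerLeft T r' ≫ κ.hom = r) :
    ∃ (F : B ⥤ E) (e : (T ⋙ I.functor) ⋙ F ≅ K) (s : C ⟶ F),
      Functor.whiskerLeft (T ⋙ I.functor) s ≫ e.hom = r := by
  refine ⟨I.inverse ⋙ K',
    Functor.isoWhiskerLeft T (Functor.isoWhiskerRight I.unitIso.symm K') ≪≫ κ,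
    Functor.whiskerRight I.counitInv C ≫ Functor.whiskerLeft I.inverse r', ?_⟩
  ext X
  have hrX : r'.app (T.obj X) ≫ κ.hom.app X = r.app X := congr_app hr X
  have naturality : C.map (I.functor.map (I.unit.app (T.obj X))) ≫
      r'.app (I.inverse.obj (I.functor.obj (T.obj X))) =
        r'.app (T.obj X) ≫ K'.map (I.unit.app (T.obj X)) := r'.naturality _
  have unit_inv : K'.map (I.unit.app (T.obj X)) ≫ K'.map (I.unitIso.inv.app (T.obj X)) = 𝟙 _ := by
    rw [← K'.map_comp, I.unitIso.hom_inv_id_app, K'.map_id, Functor.id_obj]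
  simp [← hrX, I.counitInv_app_functor, reassoc_of% naturality, reassoc_of% unit_inv]

end Factorization

namespace MulResolutionData
variable {p : ℕ} [Fact p.Prime] (ν : MulResolutionData.{u} p) {R : Type u} [CommRing R] [CharP R p]
  [PerfectRing R p] {V V' V'' : Ch (W2 p R)} [∀ n, Module.Projective (W2 p R) (V.X n)]

/-- The map `C^l(V) → C^l(V')` induced by a map `V/p → V'/p` through any of its lifts. -/
def clMap (f : (qUp p R).obj V ⟶ (qUp p R).obj V') : (ν.cl R).obj V ⟶ (ν.cl R).obj V' :=
  ν.liftCl (exists_isLift f).choose_spec.choose_spec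

/-- The map `C^r(V) → C^r(V')` induced by a map `V/p → V'/p` through any of its lifts. -/
def crMap (f : (qUp p R).obj V ⟶ (qUp p R).obj V') : (ν.cr R).obj V ⟶ (ν.cr R).obj V' :=
  ν.liftCr (exists_isLift f).choose_spec.choose_spec

lemma clMap_map (φ : V ⟶ V') : ν.clMap ((qUp p R).map φ) = (ν.cl R).map φ :=
  (ν.liftCl_unique _ (isLift_mapTot φ)).trans (ν.liftCl_isLift_mapTot φ)

lemma crMap_map (φ : V ⟶ V') : ν.crMap ((qUp p R).map φ) = (ν.cr R).map φ :=
  (ν.liftCr_unique _ (isLift_mapTot φ)).trans (ν.liftCr_isLift_mapTot φ)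

lemma clMap_comp_clTo (f : (qUp p R).obj V ⟶ (qUp p R).obj V') :
    ν.clMap f ≫ (ν.clTo R).app V' = (ν.clTo R).app V ≫ (ν.cycR R).map f :=
  ν.liftCl_comp_clTo _

lemma toCr_comp_crMap (f : (qUp p R).obj V ⟶ (qUp p R).obj V') :
    (ν.toCr R).app V ≫ ν.crMap f = (ν.cycR R).map f ≫ (ν.toCr R).app V' :=
  ν.toCr_comp_liftCr _

variable [∀ n, Module.Projective (W2 p R) (V'.X n)] (f : (qUp p R).obj V ⟶ (qUp p R).obj V')
  (g : (qUp p R).obj V' ⟶ (qUp p R).obj V'')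

lemma clMap_comp : ν.clMap (f ≫ g) = ν.clMap f ≫ ν.clMap g :=
  (ν.liftCl_unique _ _).trans (ν.liftCl_comp _ _)

lemma crMap_comp : ν.crMap (f ≫ g) = ν.crMap f ≫ ν.crMap g :=
  (ν.liftCr_unique _ _).trans (ν.liftCr_comp _ _)

end MulResolutionData

section ModP
variable (p : ℕ) [Fact p.Prime] (R : Type u) [CommRing R]

/-- The category of bounded complexes `V` of finitely generated projective `W_2(R)`-modules in
which the maps from `V` to `V'` are the maps of complexes `V/p → V'/p`. -/
abbrev CpfModP := InducedCategory (Cpf R) (qPull p R).obj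

/-- The functor sending a map `V → V'` to its reduction `V/p → V'/p`. -/
def toModP : Cpf (W2 p R) ⥤ CpfModP p R where
  obj V := V
  map φ := InducedCategory.homMk ((qPull p R).map φ)

instance [(qPull p R).EssSurj] : (inducedFunctor (qPull p R).obj).EssSurj where
  mem_essImage W := ⟨(qPull p R).objPreimage W, ⟨(qPull p R).objObjPreimageIso W⟩⟩

instance [(qPull p R).EssSurj] : (inducedFunctor (qPull p R).obj).IsEquivalence where

variable {p R} [CharP R p] [PerfectRing R p]

instance (V : Cpf (W2 p R)) (n : ℤ) : Module.Projective (W2 p R) (V.obj.X n) := (V.property.1 n).2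

namespace MulResolutionData
variable (ν : MulResolutionData.{u} p)

attribute [local irreducible] cl cr cycR clTo toCr

/-- `C^l` as a functor of `V/p`. -/
def clModP : CpfModP p R ⥤ Ch (W2 p R) where
  obj V := (ν.cl R).obj V.obj
  map {V V'} f := ν.clMap (V := V.obj) (V' := V'.obj) f.hom.hom
  map_id V := (congrArg (ν.clMap (V := V.obj) (V' := V.obj)) ((qUp p R).map_id V.obj).symm).trans <|
    (ν.clMap_map (𝟙 V.obj)).trans ((ν.cl R).map_id _)
  map_comp {V V' V''} f g :=
    ν.clMap_comp (V := V.obj) (V' := V'.obj) (V'' := V''.obj) f.hom.hom g.hom.hom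

/-- `C^r` as a functor of `V/p`. -/
def crModP : CpfModP p R ⥤ Ch (W2 p R) where
  obj V := (ν.cr R).obj V.obj
  map {V V'} f := ν.crMap (V := V.obj) (V' := V'.obj) f.hom.hom
  map_id V := (congrArg (ν.crMap (V := V.obj) (V' := V.obj)) ((qUp p R).map_id V.obj).symm).trans <|
    (ν.crMap_map (𝟙 V.obj)).trans ((ν.cr R).map_id _)
  map_comp {V V' V''} f g :=
    ν.crMap_comp (V := V.obj) (V' := V'.obj) (V'' := V''.obj) f.hom.hom g.hom.hom

/-- The restriction of `clModP` to maps of complexes over `W_2(R)` is `C^l`. -/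
def toModPCompClModP : toModP p R ⋙ ν.clModP ≅ ν.pfCl R :=
  NatIso.ofComponents (fun _ => Iso.refl _) fun {V V'} φ =>
    (Category.comp_id _).trans <|
      (ν.clMap_map (V := V.obj) (V' := V'.obj) φ.hom).trans (Category.id_comp _).symm

/-- The restriction of `crModP` to maps of complexes over `W_2(R)` is `C^r`. -/
def toModPCompCrModP : toModP p R ⋙ ν.crModP ≅ ν.pfCr R :=
  NatIso.ofComponents (fun _ => Iso.refl _) fun {V V'} φ =>
    (Category.comp_id _).trans <|
      (ν.crMap_map (V := V.obj) (V' := V'.obj) φ.hom).trans (Category.id_comp _).symm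

/-- The structure map `C^l(V) → C(V/p)` as a natural transformation of functors of `V/p`. -/
def clModPTo : ν.clModP ⟶ inducedFunctor (qPull p R).obj ⋙ ν.pfC R where
  app V := (ν.clTo R).app V.obj
  naturality V V' f := ν.clMap_comp_clTo (V := V.obj) (V' := V'.obj) f.hom.hom

/-- The structure map `C(V/p) → C^r(V)` as a natural transformation of functors of `V/p`. -/
def toCrModP : inducedFunctor (qPull p R).obj ⋙ ν.pfC R ⟶ ν.crModP where
  app V := (ν.toCr R).app V.obj
  naturality V V' f := (ν.toCr_comp_crMap (V := V.obj) (V' := V'.obj) f.hom.hom).symm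

variable {R : Type u} [Field R] [CharP R p] [PerfectRing R p]

lemma exists_factorization_pfCl : ∃ (F : Cpf R ⥤ Ch (W2 p R)) (e : qPull p R ⋙ F ≅ ν.pfCl R)
    (l : F ⟶ ν.pfC R), e.hom ≫ ν.pfL R = Functor.whiskerLeft (qPull p R) l :=
  exists_factorization_to (toModP p R) (inducedFunctor (qPull p R).obj).asEquivalence
    ν.toModPCompClModP (L := ν.pfL R) (L' := ν.clModPTo)
    (NatTrans.ext <| funext fun _ => Category.id_comp _)

lemma exists_factorization_pfCr : ∃ (F : Cpf R ⥤ Ch (W2 p R)) (e : qPull p R ⋙ F ≅ ν.pfCr R)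
    (r : ν.pfC R ⟶ F), Functor.whiskerLeft (qPull p R) r ≫ e.hom = ν.pfR R :=
  exists_factorization_from (toModP p R) (inducedFunctor (qPull p R).obj).asEquivalence
    ν.toModPCompCrModP (r := ν.pfR R) (r' := ν.toCrModP)
    (NatTrans.ext <| funext fun _ => Category.comp_id _)

end MulResolutionData
end ModP

end CyclicPowers

end

theorem mainTheorem10 (p : ℕ) [Fact p.Prime] (R : Type u) [Field R] [CharP R p] [PerfectRing R p]
    (ν : CyclicPowers.MulResolutionData.{u} p) :
    (∃ (F : CyclicPowers.Cpf R ⥤ CyclicPowers.Ch (CyclicPowers.W2 p R))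
        (e : CyclicPowers.qPull p R ⋙ F ≅ ν.pfCl R) (l : F ⟶ ν.pfC R),
        e.hom ≫ ν.pfL R = Functor.whiskerLeft (CyclicPowers.qPull p R) l) ∧
      (∃ (F : CyclicPowers.Cpf R ⥤ CyclicPowers.Ch (CyclicPowers.W2 p R))
        (e : CyclicPowers.qPull p R ⋙ F ≅ ν.pfCr R) (r : ν.pfC R ⟶ F),
        Functor.whiskerLeft (CyclicPowers.qPull p R) r ≫ e.hom = ν.pfR R) :=
  ⟨ν.exists_factorization_pfCl, ν.exists_factorization_pfCr⟩
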